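/- **Setting.** A marked poset $(P,A,\lambda)$ is a finite nonempty poset $P$, a subposet $A\subseteq P$ containing all minimal and all maximal elements of $P$, and an order-preserving map $\lambda\colon A\to\mathbb R$. Its marked order polytope is $\mathcal O(P,A)_\lambda=\{x\in\mathbb R^P : x_p\le x_q \text{ for } p<q,\ x_a=\lambda(a)\text{ for }a\in A\}$. Put $\widehat P=P\sqcup\{\hat 0,\hat 1\}$; the marked elements of $\widehat P$ are those of $A$, together with $\hat 0$, marked by $\min\lambda$, and $\hat 1$, marked by $\max\lambda$, and we put $x_{\hat 0}=\min\lambda$, $x_{\hat 1}=\max\lambda$ for $x\in\mathbb R^P$. A bounded embedding $H$ of $P$ is a drawing in the plane without crossings, with all edges going upwards, of the Hasse diagram of $\widehat P$ and of two additional edges from $\hat 0$ to $\hat 1$, one to the left and one to the right of everything else. A face is a bounded connected component $F$ of the complement; its left (right) boundary consists of the edges having $F$ immediately on their right (left), with their endpoints, $\min F$ and $\max F$ included. $H$ is a bounded strongly planar embedding of $(P,A,\lambda)$ if, whenever the left boundary of a face $F$ contains a marked element, both $\min F$ and $\max F$ are marked. The flow network $G=G_{(P,A,\lambda)}$ has one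 edge $e$ for each edge $p\lessdot q$ of the Hasse diagram of $\widehat P$; $e$ crosses $p\lessdot q$ and goes from the face on its right to the face on its left. A face $F$ with unmarked left boundary gives a vertex $v_F$ of netflow $0$. A face $F$ with marked left boundary gives a sink, the head of the edges crossing the right boundary of $F$, of netflow $-(\lambda(\max F)-\lambda(\min F))$, and, for any two consecutive marked elements $a<b$ of its left boundary, a source of netflow $\lambda(b)-\lambda(a)$, the tail of the edges crossing the left boundary between $a$ and $b$. Vertices without incident edges are discarded. The flow polytope $\mathcal F_G$ is the set of $f\in\mathbb R_{\ge0}^{E(G)}$ for which outflow minus inflow at each vertex is its netflow. Let $\Gamma\colon\mathbb R^P\to\mathbb R^{E(G)}$ be the affine map $\Gamma(x)(e)=x_q-x_p$ if $e$ crosses $p\lessdot q$. **Subdivisions.** Let $F_1,\dots,F_m$ be distinct faces with unmarked left boundary (for instance all of them, in any order). *Order side.* For $i=1,\dots,m$, choose a linear extension of the current face $F_i$ (an order of the vertices of its boundary that is compatible with its left and its right boundary chain) and replace $F_i$ in the current diagram by this chain, gluing its left and its right boundary accordingly. Each sequence $\sigma$ of choices yields a poset $P_\sigma$ on the set $P$,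 and the region $\mathcal O(P_\sigma,A)_\lambda\subseteq\mathcal O(P,A)_\lambda$. Let $\Delta$ be the set of these regions. *Flow side.* For $i=1,\dots,m$, perform a compounded reduction at $v_{F_i}$ on the current network: order the incoming and the outgoing edges of $v_{F_i}$ from top to bottom, choose a bipartite noncrossing tree $T$ with the incoming edges as left and the outgoing edges as right vertices, delete $v_{F_i}$ with its edges, and add an edge $r\to s$ for each edge $(r\to v_{F_i},\,v_{F_i}\to s)$ of $T$. Each sequence $\tau$ of choices yields a network $G_\tau$, and the region $\mathcal F_{G_\tau}$, seen as a subset of $\mathcal F_G$ by adding the flow of each edge of $G_\tau$ to all edges of $G$ of which it is formed. Let $\Delta'$ be the set of these regions. **Theorem.** Let $H$ be a bounded strongly planar embedding of the marked poset $(P,A,\lambda)$. Then $\Gamma$ maps $\mathcal O(P,A)_\lambda$ bijectively onto $\mathcal F_G$, and it is an integral equivalence (also a bijection between the lattice points of the affine spans of the two polytopes) if $\lambda$ takes integer values. For all $F_1,\dots,F_m$ as above there is a bijection $\gamma$ from the sequences $\sigma$ of linear extensions to the sequences $\tau$ of bipartite noncrossing trees such that $\Gamma(\mathcal O(P_\sigma,A)_\lambda)=\mathcal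 F_{G_{\gamma(\sigma)}}$ for every $\sigma$; and $R\mapsto\Gamma(R)$ is a bijection from $\Delta$ to $\Delta'$. -/

import Mathlib

open Set Filter Topology

universe u

/-! ### Marked posets, marked order polytopes -/

/-- The bounded poset `P ⊔ {0̂, 1̂}`; `0̂ = ⊥` and `1̂ = ⊤`. -/
abbrev Hat (P : Type u) : Type u := WithBot (WithTop P)

/-- The inclusion of `P` into `P ⊔ {0̂, 1̂}`. -/
def toHat {P : Type u} (p : P) : Hat P := ((p : WithTop P) : WithBot (WithTop P))

/-- Extension of `x ∈ ℝ^P` to `P ⊔ {0̂, 1̂}` by the value `lo` at `0̂` and `hi` at `1̂`. -/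
def hatExtend {P : Type u} (lo hi : ℝ) (x : P → ℝ) : Hat P → ℝ :=
  WithBot.recBotCoe lo fun w => WithTop.recTopCoe hi x w

theorem hatExtend_add {P : Type u} (lo lo' hi hi' : ℝ) (x x' : P → ℝ) (w : Hat P) :
    hatExtend (lo + lo') (hi + hi') (x + x') w = hatExtend lo hi x w + hatExtend lo' hi' x' w := by
  rcases w with _ | _ | p <;> rfl

theorem hatExtend_smul {P : Type u} (c : ℝ) (x : P → ℝ) (w : Hat P) :
    hatExtend 0 0 (c • x) w = c * hatExtend 0 0 x w := by
  rcases w with _ | _ | p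
  · exact (mul_zero c).symm
  · exact (mul_zero c).symm
  · rfl

/-- A marking `(A, mark)` of a poset `P`: the subposet `A` contains all extremal elements and
`mark : A → ℝ` is order preserving. -/
structure MarkedPoset (P : Type u) [PartialOrder P] where
  A : Set P
  mark : A → ℝ
  mono : Monotone mark
  isMin_mem : ∀ p : P, IsMin p → p ∈ A
  isMax_mem : ∀ p : P, IsMax p → p ∈ A

namespace MarkedPoset

variable {P : Type u} [PartialOrder P] (M : MarkedPoset P)

/-- The marked order polytope `{x ∈ ℝ^P | x_p ≤ x_q for r p q, x_a = mark a for a ∈ A}` of the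
strict order relation `r` on the set `P`. -/
def orderPolytope (r : P → P → Prop) : Set (P → ℝ) :=
  {x | (∀ p q, r p q → x p ≤ x q) ∧ ∀ a : M.A, x a = M.mark a}

/-- Extension of `x ∈ ℝ^P` to `P ⊔ {0̂, 1̂}`, by the smallest marking at `0̂` and the largest marking
at `1̂`. -/
noncomputable def extend (x : P → ℝ) : Hat P → ℝ :=
  hatExtend (⨅ a, M.mark a) (⨆ a, M.mark a) x

/-- The marked elements of `P ⊔ {0̂, 1̂}`: those of `A`, and `0̂`, `1̂`. -/
def Marked (w : Hat P) : Prop := w = ⊥ ∨ w = ⊤ ∨ ∃ p ∈ M.A, w = toHat p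

open Classical in
/-- The marking of the marked elements of `P ⊔ {0̂, 1̂}` (and `0` at the unmarked ones). -/
noncomputable def hatMark : Hat P → ℝ :=
  M.extend fun p => if h : p ∈ M.A then M.mark ⟨p, h⟩ else 0

end MarkedPoset

/-! ### Bounded embeddings -/

/-- The edges `p ⋖ q` of the Hasse diagram of `P ⊔ {0̂, 1̂}`. -/
def HasseEdge (P : Type u) [PartialOrder P] : Type u := {e : Hat P × Hat P // e.1 ⋖ e.2}

namespace HasseEdge

variable {P : Type u} [PartialOrder P]

/-- The lower endpoint. -/
def bot (e : HasseEdge P) : Hat P := e.1.1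

/-- The upper endpoint. -/
def top (e : HasseEdge P) : Hat P := e.1.2

instance [Finite P] : Finite (HasseEdge P) :=
  haveI : Finite (Hat P) := inferInstanceAs (Finite (Option (Option P)))
  Subtype.finite

end HasseEdge

/-- The edges of a bounded embedding: those of the Hasse diagram of `P ⊔ {0̂, 1̂}`, and two additional
edges from `0̂` to `1̂`. -/
inductive BoundedEdge (P : Type u) [PartialOrder P] : Type u
  | hasse (e : HasseEdge P) : BoundedEdge P
  | leftmost : BoundedEdge P
  | rightmost : BoundedEdge P

namespace BoundedEdge

variable {P : Type u} [PartialOrder P]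

/-- The lower endpoint. -/
def bot : BoundedEdge P → Hat P
  | hasse e => e.bot
  | _ => ⊥

/-- The upper endpoint. -/
def top : BoundedEdge P → Hat P
  | hasse e => e.top
  | _ => ⊤

end BoundedEdge

/-- A bounded embedding of `P`: a drawing without crossings, in the plane `ℝ × ℝ`, of the Hasse
diagram of `P ⊔ {0̂, 1̂}` and of two additional edges from `0̂` to `1̂`, one to the left and one to the
right of everything else. The heights of the vertices respect the order, and an edge is drawn as an
arc that goes upwards from its lower to its upper endpoint, that is, as the graph
`{(arc e t, t) | t}` of a continuous function of the height `t`. -/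
structure BoundedEmbedding (P : Type u) [PartialOrder P] where
  x : Hat P → ℝ
  y : Hat P → ℝ
  y_strictMono : StrictMono y
  arc : BoundedEdge P → ℝ → ℝ
  arc_continuousOn : ∀ e, ContinuousOn (arc e) (Icc (y e.bot) (y e.top))
  arc_bot : ∀ e, arc e (y e.bot) = x e.bot
  arc_top : ∀ e, arc e (y e.top) = x e.top
  /-- Two edges meet only in common endpoints. -/
  no_crossing : ∀ e e', e ≠ e' → ∀ t ∈ Icc (y e.bot) (y e.top) ∩ Icc (y e'.bot) (y e'.top),
    arc e t = arc e' t → ∃ w, (w = e.bot ∨ w = e.top) ∧ (w = e'.bot ∨ w = e'.top) ∧ t = y w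
  leftmost_lt : ∀ e, e ≠ .leftmost → ∀ t ∈ Ioo (y ⊥) (y ⊤) ∩ Icc (y e.bot) (y e.top),
    arc .leftmost t < arc e t
  lt_rightmost : ∀ e, e ≠ .rightmost → ∀ t ∈ Ioo (y ⊥) (y ⊤) ∩ Icc (y e.bot) (y e.top),
    arc e t < arc .rightmost t

namespace BoundedEmbedding

variable {P : Type u} [PartialOrder P] (H : BoundedEmbedding P)

/-- The complement of the drawing in the plane. -/
def compl : Set (ℝ × ℝ) :=
  {z | ∀ e : BoundedEdge P, z.2 ∈ Icc (H.y e.bot) (H.y e.top) → z.1 ≠ H.arc e z.2}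

/-- The (bounded) faces: the bounded connected components of the complement. -/
def IsFace (F : Set (ℝ × ℝ)) : Prop :=
  (∃ z ∈ H.compl, F = connectedComponentIn H.compl z) ∧ Bornology.IsBounded F

/-- The connected component of the complement that lies immediately to the left of the edge `e`. -/
def leftFace (e : BoundedEdge P) : Set (ℝ × ℝ) :=
  {z | z ∈ H.compl ∧ ∃ t ∈ Ioo (H.y e.bot) (H.y e.top),
    ∀ᶠ s in 𝓝[<] (H.arc e t), (s, t) ∈ connectedComponentIn H.compl z}

/-- The connected component of the complement that lies immediately to the right of the edge `e`. -/
def rightFace (e : BoundedEdge P) : Set (ℝ × ℝ) :=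
  {z | z ∈ H.compl ∧ ∃ t ∈ Ioo (H.y e.bot) (H.y e.top),
    ∀ᶠ s in 𝓝[>] (H.arc e t), (s, t) ∈ connectedComponentIn H.compl z}

/-- The vertices of the left boundary of `F`, the minimum and the maximum of `F` included: the
endpoints of the edges that have `F` on their right. -/
def leftVerts (F : Set (ℝ × ℝ)) : Set (Hat P) :=
  {w | ∃ e, H.rightFace e = F ∧ (w = e.bot ∨ w = e.top)}

/-- The vertices of the right boundary of `F`. -/
def rightVerts (F : Set (ℝ × ℝ)) : Set (Hat P) :=
  {w | ∃ e, H.leftFace e = F ∧ (w = e.bot ∨ w = e.top)}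

/-- The vertices on the boundary of `F`. -/
def verts (F : Set (ℝ × ℝ)) : Set (Hat P) := H.leftVerts F ∪ H.rightVerts F

/-- The left boundary of `F` contains a marked element. -/
def LeftMarked (M : MarkedPoset P) (F : Set (ℝ × ℝ)) : Prop := ∃ w ∈ H.leftVerts F, M.Marked w

/-- `H` is a bounded strongly planar embedding of the marked poset: whenever the left boundary of a
face contains a marked element, the minimum and the maximum of the face are marked. -/
def IsStronglyPlanar (M : MarkedPoset P) : Prop :=
  ∀ F, H.IsFace F → H.LeftMarked M F →
    (∀ w, IsLeast (H.verts F) w → M.Marked w) ∧ ∀ w, IsGreatest (H.verts F) w → M.Marked w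

/-- The minimum of the face `F`. -/
noncomputable def minVert (F : Set (ℝ × ℝ)) : Hat P :=
  Classical.epsilon fun w => IsLeast (H.verts F) w

/-- The maximum of the face `F`. -/
noncomputable def maxVert (F : Set (ℝ × ℝ)) : Hat P :=
  Classical.epsilon fun w => IsGreatest (H.verts F) w

/-- The closest marked element below the edge `e` on the left boundary of `F`. -/
noncomputable def markBelow (M : MarkedPoset P) (F : Set (ℝ × ℝ)) (e : HasseEdge P) : Hat P :=
  Classical.epsilon fun w => IsGreatest {w | w ∈ H.leftVerts F ∧ M.Marked w ∧ w ≤ e.bot} w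

/-- The closest marked element above the edge `e` on the left boundary of `F`. -/
noncomputable def markAbove (M : MarkedPoset P) (F : Set (ℝ × ℝ)) (e : HasseEdge P) : Hat P :=
  Classical.epsilon fun w => IsLeast {w | w ∈ H.leftVerts F ∧ M.Marked w ∧ e.top ≤ w} w

end BoundedEmbedding

/-! ### Flow networks and compounded reductions -/

/-- A flow network with vertices in `V`. The vertices of the network are the elements of `V` that are
incident to an edge. The relations `outAbove` and `inAbove` order the outgoing, respectively the
incoming, edges of each vertex from top to bottom; they only matter for edges with the same tail,
respectively the same head. -/
structure FlowNetwork (V : Type u) where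
  E : Type u
  [fintypeE : Fintype E]
  tail : E → V
  head : E → V
  netflow : V → ℝ
  outAbove : E → E → Prop
  inAbove : E → E → Prop

attribute [instance] FlowNetwork.fintypeE

namespace FlowNetwork

variable {V : Type u} (N : FlowNetwork V)

open Classical in
/-- The flow polytope: nonnegative `f` whose outflow minus inflow at each vertex is the netflow. -/
def flowPolytope : Set (N.E → ℝ) :=
  {f | (∀ e, 0 ≤ f e) ∧ ∀ w, (∃ e, N.tail e = w ∨ N.head e = w) →
    (∑ e with N.tail e = w, f e) - (∑ e with N.head e = w, f e) = N.netflow w}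

/-- The edges incoming to `w`. -/
abbrev In (w : V) : Type u := {e : N.E // N.head e = w}

/-- The edges outgoing from `w`. -/
abbrev Out (w : V) : Type u := {e : N.E // N.tail e = w}

/-- The bipartite graph on the incoming and the outgoing edges of `w` with edge set `T`. -/
def bipartite {w : V} (T : Finset (N.In w × N.Out w)) : SimpleGraph (N.In w ⊕ N.Out w) :=
  SimpleGraph.fromRel fun a b => ∃ i o, (i, o) ∈ T ∧ a = Sum.inl i ∧ b = Sum.inr o

/-- The bipartite noncrossing trees with left vertices the incoming and right vertices the outgoing
edges of `w`, both ordered from top to bottom. -/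
def NoncrossingTree (w : V) : Type u :=
  {T : Finset (N.In w × N.Out w) // (N.bipartite T).IsTree ∧
    ∀ a ∈ T, ∀ b ∈ T, N.inAbove a.1 b.1 → ¬ N.outAbove b.2 a.2}

variable {N} {w : V} (T : N.NoncrossingTree w)

/-- The edges of the network obtained from the tree `T`: the edges of the network that are not
incident to `w`, and one edge for each edge of `T`. -/
abbrev NewEdge : Type u := {e : N.E // N.tail e ≠ w ∧ N.head e ≠ w} ⊕ {a // a ∈ T.1}

/-- The first edge of which a new edge is formed. -/
def first : NewEdge T → N.E := Sum.elim (fun e => e.1) fun a => a.1.1.1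

/-- The last edge of which a new edge is formed. -/
def last : NewEdge T → N.E := Sum.elim (fun e => e.1) fun a => a.1.2.1

open Classical in
/-- The network obtained from the tree `T` in the compounded reduction at `w`: delete `w` with its
incident edges, and add an edge `r → s` for each edge `(r → w, w → s)` of `T`. The edges at each
vertex are ordered from top to bottom: an old edge is replaced, in its place, by the new edges that
contain it, and these are ordered by their other part. -/
noncomputable def reduce : FlowNetwork V where
  E := NewEdge T
  tail e := N.tail (first T e)
  head e := N.head (last T e)
  netflow := N.netflow
  outAbove e e' := N.outAbove (first T e) (first T e') ∨
    first T e = first T e' ∧ N.outAbove (last T e) (last T e')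
  inAbove e e' := N.inAbove (last T e) (last T e') ∨
    last T e = last T e' ∧ N.inAbove (first T e) (first T e')

open Classical in
/-- The inclusion of the flows of the reduced network into those of the given one: the value of each
edge is added to all edges of which it is formed. -/
noncomputable def lift (f : (reduce T).E → ℝ) (e : N.E) : ℝ :=
  ∑ e', if first T e' = e ∨ last T e' = e then f e' else 0

/-- The leaves of the compounded reduction tree for reductions at the vertices of a list: a leaf is a
choice of a bipartite noncrossing tree in each step. -/
def Leaf : List V → FlowNetwork V → Type u
  | [], _ => PUnit
  | w :: ws, N => (T : N.NoncrossingTree w) × Leaf ws (reduce T)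

/-- The flow polytope of the network at a leaf, as a subset of the flow polytope at the root. -/
def region : (ws : List V) → (N : FlowNetwork V) → Leaf ws N → Set (N.E → ℝ)
  | [], N, _ => N.flowPolytope
  | _ :: ws, _, ⟨T, l⟩ => lift T '' region ws (reduce T) l

end FlowNetwork

/-! ### The flow network of a bounded strongly planar embedding -/

/-- The names of the vertices: `inner F` is the vertex of a face `F` with unmarked left boundary,
`sink F` the sink of a face with marked left boundary, and `source F a b` its source for the part of
the left boundary between the consecutive marked elements `a < b`. -/
inductive NetVertex (P : Type u) : Type u
  | inner (F : Set (ℝ × ℝ)) : NetVertex P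
  | sink (F : Set (ℝ × ℝ)) : NetVertex P
  | source (F : Set (ℝ × ℝ)) (a b : Hat P) : NetVertex P

open Classical in
/-- The flow network of the marked poset: each edge of the Hasse diagram of `P ⊔ {0̂, 1̂}` is crossed
by one edge of the network, from the face on its right to the face on its left. -/
noncomputable def BoundedEmbedding.network {P : Type u} [PartialOrder P] [Finite P]
    (H : BoundedEmbedding P) (M : MarkedPoset P) : FlowNetwork (NetVertex P) where
  E := HasseEdge P
  fintypeE := Fintype.ofFinite _
  tail e :=
    if H.LeftMarked M (H.rightFace (.hasse e)) then
      .source (H.rightFace (.hasse e)) (H.markBelow M (H.rightFace (.hasse e)) e)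
        (H.markAbove M (H.rightFace (.hasse e)) e)
    else .inner (H.rightFace (.hasse e))
  head e :=
    if H.LeftMarked M (H.leftFace (.hasse e)) then .sink (H.leftFace (.hasse e))
    else .inner (H.leftFace (.hasse e))
  netflow
    | .inner _ => 0
    | .sink F => -(M.hatMark (H.maxVert F) - M.hatMark (H.minVert F))
    | .source _ a b => M.hatMark b - M.hatMark a
  outAbove e e' := e'.top ≤ e.bot
  inAbove e e' := e'.top ≤ e.bot

/-! ### Replacing faces by linear extensions -/

/-- The Hasse diagram of a poset on the set `V` embedded in the plane, recorded by the endpoints of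
its edges and the faces to the left and to the right of each edge. -/
structure Diagram (V : Type u) where
  E : Type u
  bot : E → V
  top : E → V
  left : E → Set (ℝ × ℝ)
  right : E → Set (ℝ × ℝ)

namespace Diagram

variable {V : Type u} (D : Diagram V)

/-- The strict order generated by the edges. -/
def lt : V → V → Prop := Relation.TransGen fun a b => ∃ e, D.bot e = a ∧ D.top e = b

/-- The edges of the boundary of `F`; the left boundary consists of those with `F` on their right,
and the right boundary of those with `F` on their left. -/
def IsBoundary (F : Set (ℝ × ℝ)) (e : D.E) : Prop := D.right e = F ∨ D.left e = F

/-- The linear extensions of the face `F`: the lists, from top to bottom, of its vertices in which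
the upper endpoint of each edge of `F` stands before the lower one. -/
def LinearExtension (F : Set (ℝ × ℝ)) : Type u :=
  {L : List V // L.Nodup ∧ (∀ w, w ∈ L ↔ ∃ e, D.IsBoundary F e ∧ (w = D.bot e ∨ w = D.top e)) ∧
    ∀ e, D.IsBoundary F e → [D.top e, D.bot e].Sublist L}

variable {D} {F : Set (ℝ × ℝ)} (L : D.LinearExtension F)

/-- In the linear extension, the part from `a` down to `b` lies within the edge `e` of `F`. -/
def Within (a b : V) (e : D.E) : Prop :=
  (D.top e = a ∨ [D.top e, a].Sublist L.1) ∧ (b = D.bot e ∨ [b, D.bot e].Sublist L.1)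

/-- The edges of the chain by which `F` is replaced: pairs of consecutive elements of the linear
extension, with the edges of the left and of the right boundary of `F` that become glued there. -/
structure Segment where
  upper : V
  lower : V
  leftEdge : D.E
  rightEdge : D.E
  consecutive : [upper, lower] <:+: L.1
  right_leftEdge : D.right leftEdge = F
  left_rightEdge : D.left rightEdge = F
  within_left : Within L upper lower leftEdge
  within_right : Within L upper lower rightEdge

/-- The diagram obtained by replacing the face `F` by the linear extension `L`: the boundary of `F`
is replaced by a chain, which has on its left the faces to the left of the left boundary of `F`, and
on its right the faces to the right of the right boundary of `F`. -/
def replace : Diagram V where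
  E := {e : D.E // ¬ D.IsBoundary F e} ⊕ Segment L
  bot := Sum.elim (fun e => D.bot e.1) fun s => s.lower
  top := Sum.elim (fun e => D.top e.1) fun s => s.upper
  left := Sum.elim (fun e => D.left e.1) fun s => D.left s.leftEdge
  right := Sum.elim (fun e => D.right e.1) fun s => D.right s.rightEdge

/-- The iterated choices of linear extensions for the faces of a list. -/
def Leaf : List (Set (ℝ × ℝ)) → Diagram V → Type u
  | [], _ => PUnit
  | F :: Fs, D => (L : D.LinearExtension F) × Leaf Fs (replace L)

/-- The diagram of the poset that results from iterated choices of linear extensions. -/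
def result : (Fs : List (Set (ℝ × ℝ))) → (D : Diagram V) → Leaf Fs D → Diagram V
  | [], D, _ => D
  | _ :: Fs, _, ⟨L, l⟩ => result Fs (replace L) l

end Diagram

namespace BoundedEmbedding

variable {P : Type u} [PartialOrder P] (H : BoundedEmbedding P)

/-- The Hasse diagram of `P ⊔ {0̂, 1̂}` with the faces given by `H`. -/
def diagram : Diagram (Hat P) where
  E := HasseEdge P
  bot := HasseEdge.bot
  top := HasseEdge.top
  left e := H.leftFace (.hasse e)
  right e := H.rightFace (.hasse e)

/-- The combinatorial labels of the regions of the subdivision of the marked order polytope. -/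
abbrev OrderLeaf (Fs : List (Set (ℝ × ℝ))) : Type u := Diagram.Leaf Fs H.diagram

/-- The marked order polytope of the poset that results from the choices `l`. -/
def orderRegion (M : MarkedPoset P) (Fs : List (Set (ℝ × ℝ))) (l : H.OrderLeaf Fs) :
    Set (P → ℝ) :=
  M.orderPolytope fun p q => (Diagram.result Fs H.diagram l).lt (toHat p) (toHat q)

/-- The combinatorial labels of the regions of the subdivision of the flow polytope. -/
abbrev FlowLeaf [Finite P] (M : MarkedPoset P) (Fs : List (Set (ℝ × ℝ))) : Type u :=
  FlowNetwork.Leaf (Fs.map NetVertex.inner) (H.network M)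

/-- The flow polytope at the leaf `l`, as a subset of the flow polytope of the network of `H`. -/
def flowRegion [Finite P] (M : MarkedPoset P) (Fs : List (Set (ℝ × ℝ))) (l : H.FlowLeaf M Fs) :
    Set (HasseEdge P → ℝ) :=
  FlowNetwork.region (Fs.map NetVertex.inner) (H.network M) l

end BoundedEmbedding

/-! ### The integral equivalence -/

/-- The affine map `Γ`, `x ↦ f` with `f e = x_q - x_p` if `e` crosses the edge `p ⋖ q`. -/
noncomputable def MarkedPoset.Gam {P : Type u} [PartialOrder P] (M : MarkedPoset P) :
    (P → ℝ) →ᵃ[ℝ] (HasseEdge P → ℝ) where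
  toFun x e := M.extend x e.top - M.extend x e.bot
  linear :=
    { toFun := fun x e => hatExtend 0 0 x e.top - hatExtend 0 0 x e.bot
      map_add' := by
        intro x x'
        funext e
        have h := hatExtend_add 0 0 0 0 x x'
        simp only [add_zero] at h
        simp only [h, Pi.add_apply]
        ring
      map_smul' := by
        intro c x
        funext e
        simp only [hatExtend_smul, Pi.smul_apply, smul_eq_mul, RingHom.id_apply]
        ring }
  map_vadd' := by
    intro x x'
    funext e
    have h := hatExtend_add 0 (⨅ a, M.mark a) 0 (⨆ a, M.mark a) x' x
    simp only [zero_add] at h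
    simp only [MarkedPoset.extend, vadd_eq_add, h, Pi.add_apply, LinearMap.coe_mk, AddHom.coe_mk]
    ring

/-- The affine map `φ` is an integral equivalence from `Q` to `R`: it maps `Q` bijectively onto `R`,
and the lattice points of the affine span of `Q` bijectively onto those of the affine span of `R`. -/
def IsIntegralEquivalence {ι κ : Type*} (φ : (ι → ℝ) →ᵃ[ℝ] (κ → ℝ)) (Q : Set (ι → ℝ))
    (R : Set (κ → ℝ)) : Prop :=
  BijOn φ Q R ∧
    BijOn φ {x | x ∈ affineSpan ℝ Q ∧ ∀ i, ∃ n : ℤ, x i = n}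
      {x | x ∈ affineSpan ℝ R ∧ ∀ i, ∃ n : ℤ, x i = n}

/-! `Γ` records the increments of a point `x` along the Hasse edges. It is injective, because the
value at `0̂` is fixed and all others are reached by adding increments. The netflow conditions say
that the increments have equal sums along the two boundaries of a face with unmarked left boundary,
and that they add up to differences of marks along the right boundary and along the marked pieces of
the left boundary of any other face. A function on the edges with equal sums along both boundaries
of every face is a gradient (`sum_eq_sum_of_downPath`, `exists_potential`), and strong planarity
forces the potential to take the prescribed marks; so every flow comes from a point
(`exists_Gam_eq`). Integrality passes between values and increments by addition and subtraction.

All this needs a combinatorial description of the faces. The drawing is studied through its monotone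
paths from `0̂` to `1̂`, as functions of the height. They are finite in number and, as edges do not
cross, closed under maximum and minimum. Around a point between the two outer edges, the greatest
path on its left and the least one on its right bound a `Gap`. Gaps are exactly the faces, and each
face has two boundary chains from a common maximum to a common minimum (`IsFace.exists_boundary`).

For one subdivision step, consider a linear extension of a face. Each pair of consecutive elements
is a segment that lies within one edge of each chain. From one segment to the next exactly one of
these two edges changes, since a vertex other than the extreme ones is on one chain only. So the
overlapping pairs of edges form a staircase, and this is what a noncrossing bipartite tree is. The
correspondence is bijective (`eq_of_overlap_iff`, `exists_linearExtension`), and the edges of the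
reduced network are those of the glued diagram (`exists_edge_equiv`). An old edge is a chain of its
parts, so `lift` turns new increments into old ones (`lift_edgeMap`). Since `lift` is injective and
compatible with the netflow conditions, the equality between increments of the order polytope and
flows survives the step (`image_edgePolytope_replace`).

To iterate, the remaining faces must keep two chains that meet only at their ends, with the matching
vertical order of network edges. The invariant is `ChainFamily`: shared edges and vertices are
compatible with a ranking of the faces from left to right, for which `rank` counts the paths to the
left of a face by inclusion. `ChainFamily.exists_replace` and `IsNetwork.reduce` propagate it, and
`IsNetwork.exists_equiv` is the induction. -/

set_option linter.unusedSectionVars false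

/-! ### Descending lists of edges -/

section DownPath

variable {V E : Type*}

/-- The list of edges `l` is a descending path from `a` to `b`. -/
def DownPath (top bot : E → V) : V → List E → V → Prop
  | a, [], b => a = b
  | a, e :: l, b => top e = a ∧ DownPath top bot (bot e) l b

variable {top bot : E → V}

theorem DownPath.append {a b c : V} {l l' : List E} (h : DownPath top bot a l b)
    (h' : DownPath top bot b l' c) : DownPath top bot a (l ++ l') c := by
  induction l generalizing a with
  | nil => cases h; exact h'
  | cons e l ih => exact ⟨h.1, ih h.2⟩

theorem DownPath.flatMap {E' : Type*} {top' bot' : E' → V} {g : E → List E'} {a b : V}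
    {l : List E} (h : DownPath top bot a l b)
    (hg : ∀ e ∈ l, DownPath top' bot' (top e) (g e) (bot e)) :
    DownPath top' bot' a (l.flatMap g) b := by
  induction l generalizing a with
  | nil => exact h
  | cons e l ih =>
    rw [List.flatMap_cons]
    have h1 := hg e (by simp)
    rw [h.1] at h1
    exact h1.append (ih h.2 fun e he => hg e (by simp [he]))

theorem DownPath.of_map {E' : Type*} {top' bot' : E' → V} {g : E → E'} {a b : V} {l : List E}
    (h : DownPath top' bot' a (l.map g) b) : DownPath (top' ∘ g) (bot' ∘ g) a l b := by
  induction l generalizing a with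
  | nil => exact h
  | cons e l ih => exact ⟨h.1, ih h.2⟩

theorem DownPath.sum_sub (X : V → ℝ) {a b : V} {l : List E} (h : DownPath top bot a l b) :
    (l.map fun e => X (top e) - X (bot e)).sum = X a - X b := by
  induction l generalizing a with
  | nil => cases h; simp
  | cons e l ih =>
    rw [List.map_cons, List.sum_cons, ih h.2, h.1]
    ring

theorem DownPath.top_eq_or {a b : V} {l : List E} (h : DownPath top bot a l b) {e : E}
    (he : e ∈ l) : top e = a ∨ ∃ e' ∈ l, bot e' = top e := by
  induction l generalizing a with
  | nil => simp at he
  | cons e' l ih =>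
    rcases List.mem_cons.1 he with rfl | he
    · exact Or.inl h.1
    · rcases ih h.2 he with h' | ⟨e'', h', h''⟩
      · exact Or.inr ⟨e', by simp, h'.symm⟩
      · exact Or.inr ⟨e'', by simp [h'], h''⟩

theorem DownPath.bot_eq_or {a b : V} {l : List E} (h : DownPath top bot a l b) {e : E}
    (he : e ∈ l) : bot e = b ∨ ∃ e' ∈ l, top e' = bot e := by
  induction l generalizing a with
  | nil => simp at he
  | cons e' l ih =>
    rcases List.mem_cons.1 he with rfl | he
    · cases l with
      | nil => exact Or.inl h.2
      | cons e'' l => exact Or.inr ⟨e'', by simp, h.2.1⟩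
    · rcases ih h.2 he with h' | ⟨e'', h', h''⟩
      · exact Or.inl h'
      · exact Or.inr ⟨e'', by simp [h'], h''⟩

theorem DownPath.exists_top {a b : V} {l : List E} (h : DownPath top bot a l b) (hl : l ≠ []) :
    ∃ e ∈ l, top e = a := by
  cases l with
  | nil => exact absurd rfl hl
  | cons e l => exact ⟨e, by simp, h.1⟩

theorem DownPath.exists_bot {a b : V} {l : List E} (h : DownPath top bot a l b) (hl : l ≠ []) :
    ∃ e ∈ l, bot e = b := by
  induction l generalizing a with
  | nil => exact absurd rfl hl
  | cons e l ih =>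
    cases l with
    | nil => exact ⟨e, by simp, h.2⟩
    | cons e' l =>
      obtain ⟨e'', h', h''⟩ := ih h.2 (by simp)
      exact ⟨e'', List.mem_cons_of_mem _ h', h''⟩

section Preorder

variable {α : Type*} [Preorder α] {k : V → α}

/-- The function `k` measures depth. It is used both with the dual order of the poset and with the
position in a linear extension. -/
theorem DownPath.le {a b : V} {l : List E} (h : DownPath top bot a l b)
    (hk : ∀ e ∈ l, k (top e) < k (bot e)) : k a ≤ k b := by
  induction l generalizing a with
  | nil => cases h; rfl
  | cons e l ih =>
    rw [← h.1]
    exact (hk e (by simp)).le.trans (ih h.2 fun e he => hk e (by simp [he]))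

theorem DownPath.le_top_bot_le {a b : V} {l : List E} (h : DownPath top bot a l b)
    (hk : ∀ e ∈ l, k (top e) < k (bot e)) {e : E} (he : e ∈ l) :
    k a ≤ k (top e) ∧ k (bot e) ≤ k b := by
  induction l generalizing a with
  | nil => simp at he
  | cons e' l ih =>
    have hk' : ∀ e ∈ l, k (top e) < k (bot e) := fun e he => hk e (by simp [he])
    rcases List.mem_cons.1 he with rfl | he
    · exact ⟨h.1 ▸ le_rfl, h.2.le hk'⟩
    · obtain ⟨h1, h2⟩ := ih h.2 hk' he
      rw [← h.1]
      exact ⟨(hk e' (by simp)).le.trans h1, h2⟩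

theorem DownPath.pairwise {a b : V} {l : List E} (h : DownPath top bot a l b)
    (hk : ∀ e ∈ l, k (top e) < k (bot e)) : l.Pairwise fun e e' => k (bot e) ≤ k (top e') := by
  induction l generalizing a with
  | nil => exact List.Pairwise.nil
  | cons e l ih =>
    have hk' : ∀ e ∈ l, k (top e) < k (bot e) := fun e he => hk e (by simp [he])
    exact List.Pairwise.cons (fun e' he' => (h.2.le_top_bot_le hk' he').1) (ih h.2 hk')

theorem DownPath.nodup {a b : V} {l : List E} (h : DownPath top bot a l b)
    (hk : ∀ e ∈ l, k (top e) < k (bot e)) : (a :: l.map bot).Nodup := by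
  induction l generalizing a with
  | nil => simp
  | cons e l ih =>
    have hk' : ∀ e ∈ l, k (top e) < k (bot e) := fun e he => hk e (by simp [he])
    refine List.nodup_cons.2 ⟨fun ha => ?_, ih h.2 hk'⟩
    have h0 := hk e (by simp)
    rw [h.1] at h0
    rw [List.map_cons, List.mem_cons] at ha
    rcases ha with ha | ha
    · rw [← ha] at h0; exact h0.false
    · obtain ⟨e', he', rfl⟩ := List.mem_map.1 ha
      exact (h0.trans_le ((h.2.le_top_bot_le hk' he').1.trans (hk' e' he').le)).false

end Preorder

/-- Discrete intermediate value property. It assigns to each level of a linear extension an edge of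
each boundary chain. -/
theorem DownPath.exists_mem_of_le_of_lt {α : Type*} [LinearOrder α] {k : V → α} {a b : V}
    {l : List E} (h : DownPath top bot a l b) {t : α} (ha : k a ≤ t) (hb : t < k b) :
    ∃ e ∈ l, k (top e) ≤ t ∧ t < k (bot e) := by
  induction l generalizing a with
  | nil => cases h; exact absurd (ha.trans_lt hb) (lt_irrefl _)
  | cons e l ih =>
    by_cases h' : t < k (bot e)
    · exact ⟨e, by simp, h.1 ▸ ha, h'⟩
    · obtain ⟨e', h1, h2⟩ := ih h.2 (not_lt.1 h')
      exact ⟨e', by simp [h1], h2⟩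

end DownPath

/-! ### Monotone paths in a bounded embedding -/

instance {P : Type u} [Finite P] : Finite (Hat P) :=
  inferInstanceAs (Finite (Option (Option P)))

namespace BoundedEdge

variable {P : Type u} [PartialOrder P]

instance [Finite P] : Finite (BoundedEdge P) := by
  refine Finite.of_surjective
    (fun o : Option (Option (HasseEdge P)) => match o with
      | none => .leftmost
      | some none => .rightmost
      | some (some e) => .hasse e) fun e => ?_
  rcases e with e | _ | _
  exacts [⟨some (some e), rfl⟩, ⟨none, rfl⟩, ⟨some none, rfl⟩]

theorem bot_lt_top (e : BoundedEdge P) : e.bot < e.top := by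
  rcases e with e | _ | _
  · exact e.2.lt
  · exact WithBot.bot_lt_coe _
  · exact WithBot.bot_lt_coe _

end BoundedEdge

namespace BoundedEmbedding

variable {P : Type u} [PartialOrder P] (H : BoundedEmbedding P)

/-- The heights of the points of the edge `e`. -/
abbrev dom (e : BoundedEdge P) : Set ℝ := Icc (H.y e.bot) (H.y e.top)

/-- The heights of the inner points of the edge `e`. -/
abbrev openDom (e : BoundedEdge P) : Set ℝ := Ioo (H.y e.bot) (H.y e.top)

theorem y_bot_lt_y_top (e : BoundedEdge P) : H.y e.bot < H.y e.top :=
  H.y_strictMono e.bot_lt_top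

theorem y_bot_le (w : Hat P) : H.y ⊥ ≤ H.y w := H.y_strictMono.monotone bot_le

theorem le_y_top (w : Hat P) : H.y w ≤ H.y ⊤ := H.y_strictMono.monotone le_top

theorem dom_subset (e : BoundedEdge P) : H.dom e ⊆ Icc (H.y ⊥) (H.y ⊤) :=
  Icc_subset_Icc (H.y_bot_le _) (H.le_y_top _)

theorem openDom_subset (e : BoundedEdge P) : H.openDom e ⊆ Ioo (H.y ⊥) (H.y ⊤) :=
  Ioo_subset_Ioo (H.y_bot_le _) (H.le_y_top _)

theorem y_bot_lt_top : H.y ⊥ < H.y ⊤ := H.y_strictMono (WithBot.bot_lt_coe _)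

variable {H}

theorem edge_eq_of_meet {e e' : BoundedEdge P} {t : ℝ} (ht : t ∈ H.openDom e)
    (ht' : t ∈ H.dom e') (h : H.arc e t = H.arc e' t) : e = e' := by
  by_contra hne
  obtain ⟨w, hw, -, rfl⟩ := H.no_crossing e e' hne t ⟨Ioo_subset_Icc_self ht, ht'⟩ h
  rcases hw with rfl | rfl
  · exact lt_irrefl _ ht.1
  · exact lt_irrefl _ ht.2

variable (H)

/-- The graph of `g` between the heights `lo` and `hi` is a union of edges. -/
structure PathOn (lo hi : ℝ) (g : ℝ → ℝ) : Prop where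
  cont : ContinuousOn g (Icc lo hi)
  -- Vertex heights are left out, so that `t` is interior to the edge, where no other edge meets it.
  edge : ∀ t ∈ Ioo lo hi, t ∉ range H.y →
    ∃ e, t ∈ H.dom e ∧ H.dom e ⊆ Icc lo hi ∧ EqOn g (H.arc e) (H.dom e)

/-- The graph of `g` is a path of edges from `⊥` to `⊤`. -/
structure IsPath (g : ℝ → ℝ) : Prop extends H.PathOn (H.y ⊥) (H.y ⊤) g where
  -- With a fixed value outside, a path is determined by its edges, and paths can be compared as
  -- functions on `ℝ`.
  zero : ∀ t ∉ Icc (H.y ⊥) (H.y ⊤), g t = 0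

variable {H}

theorem continuousOn_glue {lo c hi : ℝ} {g₁ g₂ : ℝ → ℝ} (h₁ : ContinuousOn g₁ (Icc lo c))
    (h₂ : ContinuousOn g₂ (Icc c hi)) (h : g₁ c = g₂ c) (hlo : lo ≤ c) (hhi : c ≤ hi) :
    ContinuousOn (fun t => if t ≤ c then g₁ t else g₂ t) (Icc lo hi) := by
  rw [← Icc_union_Icc_eq_Icc hlo hhi]
  refine ContinuousOn.union_of_isClosed ?_ ?_ isClosed_Icc isClosed_Icc
  · exact h₁.congr fun t ht => if_pos ht.2
  · refine h₂.congr fun t ht => ?_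
    by_cases htc : t ≤ c
    · rw [le_antisymm htc ht.1]; simp [h]
    · exact if_neg htc

theorem PathOn.glue {lo hi : ℝ} {w : Hat P} {g₁ g₂ : ℝ → ℝ} (h₁ : H.PathOn lo (H.y w) g₁)
    (h₂ : H.PathOn (H.y w) hi g₂) (h : g₁ (H.y w) = g₂ (H.y w)) (hlo : lo ≤ H.y w)
    (hhi : H.y w ≤ hi) : H.PathOn lo hi (fun t => if t ≤ H.y w then g₁ t else g₂ t) := by
  refine ⟨continuousOn_glue h₁.cont h₂.cont h hlo hhi, fun t ht htr => ?_⟩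
  rcases lt_trichotomy t (H.y w) with htw | htw | htw
  · obtain ⟨e, h1, h2, h3⟩ := h₁.edge t ⟨ht.1, htw⟩ htr
    refine ⟨e, h1, h2.trans (Icc_subset_Icc_right hhi), fun s hs => ?_⟩
    simp only [if_pos (h2 hs).2]
    exact h3 hs
  · exact absurd ⟨w, htw.symm⟩ htr
  · obtain ⟨e, h1, h2, h3⟩ := h₂.edge t ⟨htw, ht.2⟩ htr
    refine ⟨e, h1, h2.trans (Icc_subset_Icc_left hlo), fun s hs => ?_⟩
    by_cases hsw : s ≤ H.y w
    · have : s = H.y w := le_antisymm hsw (h2 hs).1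
      subst this
      simp only [le_refl, if_true]
      rw [h, h3 hs]
    · simp only [if_neg hsw]
      exact h3 hs

theorem pathOn_arc (e : BoundedEdge P) : H.PathOn (H.y e.bot) (H.y e.top) (H.arc e) :=
  ⟨H.arc_continuousOn e, fun _ ht _ => ⟨e, Ioo_subset_Icc_self ht, subset_rfl, fun _ _ => rfl⟩⟩

variable [Finite P]

theorem exists_pathOn_up (w : Hat P) : ∃ g, H.PathOn (H.y w) (H.y ⊤) g ∧ g (H.y w) = H.x w := by
  induction w using WellFoundedGT.induction with
  | ind w ih =>
    by_cases hw : w = ⊤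
    · subst hw
      exact ⟨fun _ => H.x ⊤, ⟨continuousOn_const, fun t ht => by simp at ht⟩, rfl⟩
    · obtain ⟨w', hw'⟩ := exists_covBy_of_wellFoundedLT (a := w) (by rwa [isMax_iff_eq_top])
      obtain ⟨g, hg, hgw⟩ := ih w' hw'.lt
      have hlt : H.y w < H.y w' := H.y_strictMono hw'.lt
      let e : BoundedEdge P := .hasse ⟨(w, w'), hw'⟩
      refine ⟨_, (pathOn_arc e).glue (w := w') hg ?_ hlt.le (H.le_y_top _), ?_⟩
      · exact (H.arc_top e).trans hgw.symm
      · simp only [if_pos hlt.le]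
        exact H.arc_bot e

theorem exists_pathOn_down (w : Hat P) :
    ∃ g, H.PathOn (H.y ⊥) (H.y w) g ∧ g (H.y w) = H.x w := by
  induction w using WellFoundedLT.induction with
  | ind w ih =>
    by_cases hw : w = ⊥
    · subst hw
      exact ⟨fun _ => H.x ⊥, ⟨continuousOn_const, fun t ht => by simp at ht⟩, rfl⟩
    · obtain ⟨w', hw'⟩ := exists_covBy_of_wellFoundedGT (a := w) (by rwa [isMin_iff_eq_bot])
      obtain ⟨g, hg, hgw⟩ := ih w' hw'.lt
      have hlt : H.y w' < H.y w := H.y_strictMono hw'.lt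
      let e : BoundedEdge P := .hasse ⟨(w', w), hw'⟩
      refine ⟨_, hg.glue (w := w') (pathOn_arc e) ?_ (H.y_bot_le _) hlt.le, ?_⟩
      · exact hgw.trans (H.arc_bot e).symm
      · simp only [if_neg hlt.not_ge]
        exact H.arc_top e

theorem exists_isPath (e : BoundedEdge P) : ∃ g, H.IsPath g ∧ EqOn g (H.arc e) (H.dom e) := by
  obtain ⟨g₁, h₁, h₁'⟩ := exists_pathOn_down (H := H) e.bot
  obtain ⟨g₂, h₂, h₂'⟩ := exists_pathOn_up (H := H) e.top
  have hlt := H.y_bot_lt_y_top e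
  have h₃ := h₁.glue (pathOn_arc e) (h₁'.trans (H.arc_bot e).symm) (H.y_bot_le _) hlt.le
  have h₄ := h₃.glue h₂ (by simp only [if_neg hlt.not_ge]; rw [H.arc_top, h₂'])
    (H.y_bot_le _) (H.le_y_top _)
  set g := fun t => if t ≤ H.y e.top then (if t ≤ H.y e.bot then g₁ t else H.arc e t) else g₂ t
    with hg
  classical
  have hEq : EqOn (fun t => if t ∈ Icc (H.y ⊥) (H.y ⊤) then g t else 0) g
    (Icc (H.y ⊥) (H.y ⊤)) := fun t ht => if_pos ht
  refine ⟨fun t => if t ∈ Icc (H.y ⊥) (H.y ⊤) then g t else 0,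
    ⟨⟨h₄.cont.congr hEq, fun t ht htr => ?_⟩, fun t ht => if_neg ht⟩, fun t ht => ?_⟩
  · obtain ⟨e', h1, h2, h3⟩ := h₄.edge t ht htr
    exact ⟨e', h1, h2, fun s hs => (hEq (h2 hs)).trans (h3 hs)⟩
  · rw [hEq (H.dom_subset e ht)]
    simp only [hg, if_pos ht.2]
    by_cases hte : t ≤ H.y e.bot
    · rw [if_pos hte, le_antisymm hte ht.1, h₁', H.arc_bot]
    · rw [if_neg hte]

theorem exists_lt_forall_notMem_range (t : ℝ) : ∃ u < t, ∀ s ∈ Ioo u t, s ∉ range H.y := by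
  have h : (range H.y \ {t})ᶜ ∈ 𝓝 t :=
    ((finite_range H.y).subset sdiff_subset).isClosed.isOpen_compl.mem_nhds (by simp)
  obtain ⟨u, hu, h'⟩ := mem_nhdsLT_iff_exists_Ioo_subset.1 (mem_nhdsWithin_of_mem_nhds h)
  exact ⟨u, hu, fun s hs hsr => h' hs ⟨hsr, hs.2.ne⟩⟩

theorem exists_gt_forall_notMem_range (t : ℝ) : ∃ u > t, ∀ s ∈ Ioo t u, s ∉ range H.y := by
  have h : (range H.y \ {t})ᶜ ∈ 𝓝 t :=
    ((finite_range H.y).subset sdiff_subset).isClosed.isOpen_compl.mem_nhds (by simp)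
  obtain ⟨u, hu, h'⟩ := mem_nhdsGT_iff_exists_Ioo_subset.1 (mem_nhdsWithin_of_mem_nhds h)
  exact ⟨u, hu, fun s hs hsr => h' hs ⟨hsr, hs.1.ne'⟩⟩

/-! ### The finite lattice of paths -/

namespace IsPath

variable {g g' : ℝ → ℝ}

/-- At a generic height just below `t` the path follows an edge. The top of this edge is at a vertex
height, and there is none before `t`, so the edge reaches `t`. -/
theorem exists_edge_below (h : H.IsPath g) {t : ℝ} (ht : t ∈ Ioc (H.y ⊥) (H.y ⊤)) :
    ∃ e, H.y e.bot < t ∧ t ≤ H.y e.top ∧ EqOn g (H.arc e) (H.dom e) := by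
  obtain ⟨u, hu, hu'⟩ := exists_lt_forall_notMem_range (H := H) t
  obtain ⟨s, hs, hst⟩ := exists_between (max_lt hu ht.1)
  obtain ⟨hs1, hs2⟩ := max_lt_iff.1 hs
  have hsr := hu' s ⟨hs1, hst⟩
  obtain ⟨e, he, -, heq⟩ := h.edge s ⟨hs2, hst.trans_le ht.2⟩ hsr
  refine ⟨e, he.1.trans_lt hst, not_lt.1 fun hlt => ?_, heq⟩
  exact hu' (H.y e.top) ⟨hs1.trans_le he.2, hlt⟩ ⟨_, rfl⟩

theorem exists_edge_above (h : H.IsPath g) {t : ℝ} (ht : t ∈ Ico (H.y ⊥) (H.y ⊤)) :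
    ∃ e, H.y e.bot ≤ t ∧ t < H.y e.top ∧ EqOn g (H.arc e) (H.dom e) := by
  obtain ⟨u, hu, hu'⟩ := exists_gt_forall_notMem_range (H := H) t
  obtain ⟨s, hst, hs⟩ := exists_between (lt_min hu ht.2)
  obtain ⟨hs1, hs2⟩ := lt_min_iff.1 hs
  have hsr := hu' s ⟨hst, hs1⟩
  obtain ⟨e, he, -, heq⟩ := h.edge s ⟨ht.1.trans_lt hst, hs2⟩ hsr
  refine ⟨e, not_lt.1 fun hlt => ?_, hst.trans_le he.2, heq⟩
  exact hu' (H.y e.bot) ⟨hlt, he.1.trans_lt hs1⟩ ⟨_, rfl⟩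

theorem exists_edge (h : H.IsPath g) {t : ℝ} (ht : t ∈ Icc (H.y ⊥) (H.y ⊤)) :
    ∃ e, t ∈ H.dom e ∧ EqOn g (H.arc e) (H.dom e) := by
  rcases ht.1.eq_or_lt with h0 | h0
  · obtain ⟨e, h1, h2, h3⟩ := h.exists_edge_above ⟨ht.1, h0 ▸ H.y_bot_lt_top⟩
    exact ⟨e, ⟨h1, h2.le⟩, h3⟩
  · obtain ⟨e, h1, h2, h3⟩ := h.exists_edge_below ⟨h0, ht.2⟩
    exact ⟨e, ⟨h1.le, h2⟩, h3⟩

/-- The edge that the path follows at height `t` meets the interior of `e`, so it is `e`. -/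
theorem eqOn_of_eq (h : H.IsPath g) {e : BoundedEdge P} {t : ℝ} (ht : t ∈ H.openDom e)
    (hgt : g t = H.arc e t) : EqOn g (H.arc e) (H.dom e) := by
  obtain ⟨e', h1, h2⟩ := h.exists_edge (Ioo_subset_Icc_self (H.openDom_subset e ht))
  rwa [edge_eq_of_meet ht h1 (by rw [← hgt, h2 h1])]

theorem apply_bot (h : H.IsPath g) : g (H.y ⊥) = H.x ⊥ := by
  obtain ⟨e, h1, -, h3⟩ := h.exists_edge_above ⟨le_rfl, H.y_bot_lt_top⟩
  have he : e.bot = ⊥ := by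
    by_contra hne
    exact (H.y_strictMono (bot_lt_iff_ne_bot.2 hne)).not_ge h1
  rw [h3 ⟨h1, H.y_bot_le _⟩, ← he, H.arc_bot]

theorem apply_top (h : H.IsPath g) : g (H.y ⊤) = H.x ⊤ := by
  obtain ⟨e, -, h1, h3⟩ := h.exists_edge_below ⟨H.y_bot_lt_top, le_rfl⟩
  have he : e.top = ⊤ := by
    by_contra hne
    exact (H.y_strictMono (lt_top_iff_ne_top.2 hne)).not_ge h1
  rw [h3 ⟨H.le_y_top _, h1⟩, ← he, H.arc_top]

theorem exists_eq (h : H.IsPath g) (h' : H.IsPath g') {s t : ℝ}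
    (hs : s ∈ Icc (H.y ⊥) (H.y ⊤)) (ht : t ∈ Icc (H.y ⊥) (H.y ⊤)) (hgs : g s ≤ g' s)
    (hgt : g' t ≤ g t) : ∃ u ∈ uIcc s t, g u = g' u := by
  have hsub : uIcc s t ⊆ Icc (H.y ⊥) (H.y ⊤) := uIcc_subset_Icc hs ht
  exact isPreconnected_uIcc.intermediate_value₂ left_mem_uIcc right_mem_uIcc
    (h.cont.mono hsub) (h'.cont.mono hsub) hgs hgt

theorem exists_openDom_eq (h : H.IsPath g) (h' : H.IsPath g') {e : BoundedEdge P} {s t : ℝ}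
    (ht : t ∈ H.openDom e) (hs : s ∈ H.dom e) (hlt : g' t < g t) (hlt' : g s < g' s) :
    ∃ u ∈ H.openDom e, g u = g' u := by
  obtain ⟨u, hu, hgu⟩ := h.exists_eq h' (H.dom_subset e hs)
    (Ioo_subset_Icc_self (H.openDom_subset e ht)) hlt'.le hlt.le
  have hne : u ≠ s := by rintro rfl; exact hlt'.ne hgu
  refine ⟨u, ?_, hgu⟩
  rcases le_total s t with hst | hst
  · rw [uIcc_of_le hst] at hu
    exact ⟨hs.1.trans_lt (lt_of_le_of_ne hu.1 hne.symm), hu.2.trans_lt ht.2⟩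
  · rw [uIcc_of_ge hst] at hu
    exact ⟨ht.1.trans_le hu.1, (lt_of_le_of_ne hu.2 hne).trans_le hs.2⟩

/-- If the order were reversed somewhere on `e`, the paths would meet inside `e`; then `g'` would
contain `e` and coincide with `g` on it. -/
theorem le_on_dom (h : H.IsPath g) (h' : H.IsPath g') {e : BoundedEdge P}
    (he : EqOn g (H.arc e) (H.dom e)) {t : ℝ} (ht : t ∈ H.openDom e) (hlt : g' t < g t) {s : ℝ}
    (hs : s ∈ H.dom e) : g' s ≤ g s := by
  by_contra! hlt'
  obtain ⟨u, hu, hgu⟩ := h.exists_openDom_eq h' ht hs hlt hlt'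
  have := h'.eqOn_of_eq hu (hgu ▸ he (Ioo_subset_Icc_self hu))
  rw [this (Ioo_subset_Icc_self ht), he (Ioo_subset_Icc_self ht)] at hlt
  exact lt_irrefl _ hlt

theorem ge_on_dom (h : H.IsPath g) (h' : H.IsPath g') {e : BoundedEdge P}
    (he : EqOn g (H.arc e) (H.dom e)) {t : ℝ} (ht : t ∈ H.openDom e) (hlt : g t < g' t) {s : ℝ}
    (hs : s ∈ H.dom e) : g s ≤ g' s := by
  by_contra! hlt'
  obtain ⟨u, hu, hgu⟩ := h'.exists_openDom_eq h ht hs hlt hlt'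
  have := h'.eqOn_of_eq hu (hgu.trans (he (Ioo_subset_Icc_self hu)))
  rw [this (Ioo_subset_Icc_self ht), he (Ioo_subset_Icc_self ht)] at hlt
  exact lt_irrefl _ hlt

theorem mem_openDom {e : BoundedEdge P} {t : ℝ} (ht : t ∈ H.dom e) (htr : t ∉ range H.y) :
    t ∈ H.openDom e :=
  ⟨lt_of_le_of_ne ht.1 fun h => htr ⟨_, h⟩, lt_of_le_of_ne ht.2 fun h => htr ⟨_, h.symm⟩⟩

/-- Along an edge of the larger path the other path stays on its side, so the maximum follows the
whole edge. Paths with equal values at a generic height share the edge there. -/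
theorem sup (h : H.IsPath g) (h' : H.IsPath g') : H.IsPath (g ⊔ g') := by
  refine ⟨⟨h.cont.sup h'.cont, fun t ht htr => ?_⟩, fun t ht => ?_⟩
  · have key : ∀ {g g' : ℝ → ℝ}, H.IsPath g → H.IsPath g' → g' t ≤ g t →
        ∃ e, t ∈ H.dom e ∧ H.dom e ⊆ Icc (H.y ⊥) (H.y ⊤) ∧
          EqOn (g ⊔ g') (H.arc e) (H.dom e) := by
      intro g g' h h' hle
      obtain ⟨e, h1, h2, h3⟩ := h.edge t ht htr
      refine ⟨e, h1, h2, fun s hs => ?_⟩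
      rw [← h3 hs]
      refine sup_eq_left.2 ?_
      rcases hle.lt_or_eq with hlt | heq
      · exact h.le_on_dom h' h3 (mem_openDom h1 htr) hlt hs
      · rw [h3 hs, h'.eqOn_of_eq (mem_openDom h1 htr) (heq.trans (h3 h1)) hs]
    rcases le_total (g' t) (g t) with hle | hle
    · exact key h h' hle
    · rw [sup_comm]; exact key h' h hle
  · simp [h.zero t ht, h'.zero t ht]

theorem inf (h : H.IsPath g) (h' : H.IsPath g') : H.IsPath (g ⊓ g') := by
  refine ⟨⟨h.cont.inf h'.cont, fun t ht htr => ?_⟩, fun t ht => ?_⟩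
  · have key : ∀ {g g' : ℝ → ℝ}, H.IsPath g → H.IsPath g' → g t ≤ g' t →
        ∃ e, t ∈ H.dom e ∧ H.dom e ⊆ Icc (H.y ⊥) (H.y ⊤) ∧
          EqOn (g ⊓ g') (H.arc e) (H.dom e) := by
      intro g g' h h' hle
      obtain ⟨e, h1, h2, h3⟩ := h.edge t ht htr
      refine ⟨e, h1, h2, fun s hs => ?_⟩
      rw [← h3 hs]
      refine inf_eq_left.2 ?_
      rcases hle.lt_or_eq with hlt | heq
      · exact h.ge_on_dom h' h3 (mem_openDom h1 htr) hlt hs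
      · rw [h3 hs, h'.eqOn_of_eq (mem_openDom h1 htr) (heq.symm.trans (h3 h1)) hs]
    rcases le_total (g t) (g' t) with hle | hle
    · exact key h h' hle
    · rw [inf_comm]; exact key h' h hle
  · simp [h.zero t ht, h'.zero t ht]

/-- An edge with the switching point in its interior belongs to both paths, so no edge is cut. -/
theorem swap (h : H.IsPath g) (h' : H.IsPath g') {c : ℝ} (hc : c ∈ Icc (H.y ⊥) (H.y ⊤))
    (hgc : g c = g' c) : H.IsPath (fun t => if t ≤ c then g t else g' t) := by
  refine ⟨⟨continuousOn_glue (h.cont.mono (Icc_subset_Icc_right hc.2))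
    (h'.cont.mono (Icc_subset_Icc_left hc.1)) hgc hc.1 hc.2, fun t ht htr => ?_⟩, fun t ht => ?_⟩
  · have key : ∀ e, EqOn g (H.arc e) (H.dom e) → EqOn g' (H.arc e) (H.dom e) →
        EqOn (fun t => if t ≤ c then g t else g' t) (H.arc e) (H.dom e) := by
      intro e h1 h2 s hs
      simp only
      split_ifs
      · exact h1 hs
      · exact h2 hs
    by_cases htc : t ≤ c
    · obtain ⟨e, h1, h2, h3⟩ := h.edge t ht htr
      refine ⟨e, h1, h2, ?_⟩
      by_cases hce : H.y e.top ≤ c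
      · intro s hs
        simp only [if_pos (hs.2.trans hce)]
        exact h3 hs
      · have hce' : c ∈ H.openDom e :=
          ⟨lt_of_lt_of_le (mem_openDom h1 htr).1 htc, not_le.1 hce⟩
        exact key e h3 (h'.eqOn_of_eq hce' (hgc ▸ h3 (Ioo_subset_Icc_self hce')))
    · obtain ⟨e, h1, h2, h3⟩ := h'.edge t ht htr
      refine ⟨e, h1, h2, ?_⟩
      by_cases hce : c ≤ H.y e.bot
      · intro s hs
        by_cases hsc : s ≤ c
        · have : s = c := le_antisymm hsc (hce.trans hs.1)
          subst this
          simp only [le_refl, if_true]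
          rw [hgc, h3 hs]
        · simp only [if_neg hsc]
          exact h3 hs
      · have hce' : c ∈ H.openDom e :=
          ⟨not_le.1 hce, lt_trans (not_le.1 htc) (mem_openDom h1 htr).2⟩
        exact key e (h.eqOn_of_eq hce' (hgc.trans (h3 (Ioo_subset_Icc_self hce')))) h3
  · simp [h.zero t ht, h'.zero t ht]

end IsPath

variable (H) in
theorem finite_isPath : {g | H.IsPath g}.Finite := by
  refine Set.Finite.of_injOn (f := fun g => {e | EqOn g (H.arc e) (H.dom e)}) (t := univ)
    (fun _ _ => mem_univ _) (fun g hg g' hg' heq => ?_) (toFinite _)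
  funext t
  by_cases ht : t ∈ Icc (H.y ⊥) (H.y ⊤)
  · obtain ⟨e, h1, h2⟩ := IsPath.exists_edge hg ht
    have h3 : e ∈ {e | EqOn g' (H.arc e) (H.dom e)} := (Set.ext_iff.1 heq e).1 h2
    rw [h2 h1, h3 h1]
  · rw [hg.zero t ht, hg'.zero t ht]

end BoundedEmbedding

/-! ### Faces of a bounded embedding -/

namespace BoundedEmbedding

variable {P : Type u} [PartialOrder P] [Finite P] {H : BoundedEmbedding P}

variable (H) in
/-- The paths `U` and `W` are the left and the right boundary of a gap: some point lies between
them, and no path separates them. -/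
structure Gap (U W : ℝ → ℝ) : Prop where
  left : H.IsPath U
  right : H.IsPath W
  exists_lt : ∃ t, U t < W t
  le_or_le : ∀ g, H.IsPath g → g ≤ U ∨ W ≤ g

/-- The points between two graphs. -/
def between (U W : ℝ → ℝ) : Set (ℝ × ℝ) := {z | U z.2 < z.1 ∧ z.1 < W z.2}

theorem IsPath.mem_Ioo_of_lt {g g' : ℝ → ℝ} (h : H.IsPath g) (h' : H.IsPath g') {t : ℝ}
    (hlt : g t < g' t) : t ∈ Ioo (H.y ⊥) (H.y ⊤) := by
  have ht : t ∈ Icc (H.y ⊥) (H.y ⊤) := by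
    by_contra ht
    rw [h.zero t ht, h'.zero t ht] at hlt
    exact lt_irrefl _ hlt
  refine ⟨lt_of_le_of_ne ht.1 ?_, lt_of_le_of_ne ht.2 ?_⟩
  · rintro rfl
    rw [h.apply_bot, h'.apply_bot] at hlt
    exact lt_irrefl _ hlt
  · rintro rfl
    rw [h.apply_top, h'.apply_top] at hlt
    exact lt_irrefl _ hlt

theorem IsPath.ne_of_mem_compl {g : ℝ → ℝ} (h : H.IsPath g) {z : ℝ × ℝ} (hz : z ∈ H.compl)
    (ht : z.2 ∈ Icc (H.y ⊥) (H.y ⊤)) : z.1 ≠ g z.2 := by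
  obtain ⟨e, h1, h2⟩ := h.exists_edge ht
  rw [h2 h1]
  exact hz e h1

/-- A maximal path to the left of `z` is the greatest one, because maxima of paths are paths; dually
on the right. Every path avoids `z`, so it passes on one of its two sides. -/
theorem exists_gap {z : ℝ × ℝ} (hz : z ∈ H.compl) {g₁ g₂ : ℝ → ℝ} (h₁ : H.IsPath g₁)
    (h₂ : H.IsPath g₂) (hlt₁ : g₁ z.2 < z.1) (hlt₂ : z.1 < g₂ z.2) :
    ∃ U W, H.Gap U W ∧ z ∈ between U W ∧ (∀ g, H.IsPath g → g z.2 < z.1 → g ≤ U) ∧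
      ∀ g, H.IsPath g → z.1 < g z.2 → W ≤ g := by
  have ht := h₁.mem_Ioo_of_lt h₂ (hlt₁.trans hlt₂)
  obtain ⟨U, ⟨hU, hUz⟩, hmax⟩ := ((finite_isPath H).subset
    (t := {g | H.IsPath g ∧ g z.2 < z.1}) fun g hg => hg.1).exists_maximal ⟨g₁, h₁, hlt₁⟩
  obtain ⟨W, ⟨hW, hWz⟩, hmin⟩ := ((finite_isPath H).subset
    (t := {g | H.IsPath g ∧ z.1 < g z.2}) fun g hg => hg.1).exists_minimal ⟨g₂, h₂, hlt₂⟩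
  have hU' : ∀ g, H.IsPath g → g z.2 < z.1 → g ≤ U := fun g hg hgz =>
    le_sup_right.trans (hmax (y := U ⊔ g) ⟨hU.sup hg, max_lt hUz hgz⟩ le_sup_left)
  have hW' : ∀ g, H.IsPath g → z.1 < g z.2 → W ≤ g := fun g hg hgz =>
    (hmin (y := W ⊓ g) ⟨hW.inf hg, lt_min hWz hgz⟩ inf_le_left).trans inf_le_right
  refine ⟨U, W, ⟨hU, hW, ⟨z.2, hUz.trans hWz⟩, fun g hg => ?_⟩, ⟨hUz, hWz⟩, hU', hW'⟩
  rcases (hg.ne_of_mem_compl hz (Ioo_subset_Icc_self ht)).lt_or_gt with h | h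
  · exact Or.inr (hW' g hg h)
  · exact Or.inl (hU' g hg h)

/-! ### The region between the two paths of a gap -/

namespace Gap

variable {U W U' W' : ℝ → ℝ}

theorem mem_Ioo (h : H.Gap U W) {t : ℝ} (ht : U t < W t) : t ∈ Ioo (H.y ⊥) (H.y ⊤) :=
  h.left.mem_Ioo_of_lt h.right ht

theorem nonempty (h : H.Gap U W) : (between U W).Nonempty := by
  obtain ⟨t, ht⟩ := h.exists_lt
  obtain ⟨s, hs⟩ := exists_between ht
  exact ⟨(s, t), hs⟩

theorem subset_compl (h : H.Gap U W) : between U W ⊆ H.compl := by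
  rintro ⟨s, t⟩ ⟨h1, h2⟩ e het hst
  dsimp only at h1 h2 het hst
  obtain ⟨g, hg, hge⟩ := exists_isPath e
  have hgt : g t = s := (hge het).trans hst.symm
  rcases h.le_or_le g hg with h' | h'
  · exact ((h' t).trans_lt h1).ne hgt
  · exact (h2.trans_le (h' t)).ne hgt.symm

theorem isOpen (h : H.Gap U W) : IsOpen (between U W) := by
  have heq : between U W = (Prod.snd ⁻¹' Ioo (H.y ⊥) (H.y ⊤)) ∩
      ((fun z : ℝ × ℝ => (z.1 - U z.2, W z.2 - z.1)) ⁻¹' (Ioi 0 ×ˢ Ioi 0)) := by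
    ext z
    simp only [between, mem_ofPred_eq, mem_inter_iff, mem_preimage, mem_prod, mem_Ioi, sub_pos]
    exact ⟨fun hz => ⟨h.mem_Ioo (hz.1.trans hz.2), hz⟩, fun hz => hz.2⟩
  rw [heq]
  have hsnd : ∀ {g : ℝ → ℝ}, H.IsPath g →
      ContinuousOn (fun z : ℝ × ℝ => g z.2) (Prod.snd ⁻¹' Ioo (H.y ⊥) (H.y ⊤)) := fun hg =>
    (hg.cont.mono Ioo_subset_Icc_self).comp continuousOn_snd fun z hz => hz
  exact ((continuousOn_fst.sub (hsnd h.left)).prodMk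
    ((hsnd h.right).sub continuousOn_fst)).isOpen_inter_preimage
    (isOpen_Ioo.preimage continuous_snd) (isOpen_Ioi.prod isOpen_Ioi)

/-- If `U` and `W` met at a height `c` between two heights with `U < W`, the path that follows `U`
up to `c` and `W` above would be neither `≤ U` nor `≥ W`. -/
theorem ordConnected (h : H.Gap U W) : OrdConnected {t | U t < W t} := by
  refine ⟨fun t₁ h₁ t₂ h₂ t ⟨ht₁, ht₂⟩ => ?_⟩
  by_contra hlt
  have hle : W t ≤ U t := not_lt.1 hlt
  have hI : ∀ s ∈ Icc t₁ t₂, s ∈ Icc (H.y ⊥) (H.y ⊤) := fun s hs =>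
    ⟨(h.mem_Ioo h₁).1.le.trans hs.1, hs.2.trans (h.mem_Ioo h₂).2.le⟩
  obtain ⟨c, hc, hUW⟩ := h.left.exists_eq h.right (hI t₁ ⟨le_rfl, ht₁.trans ht₂⟩)
    (hI t ⟨ht₁, ht₂⟩) (le_of_lt h₁) hle
  rw [uIcc_of_le ht₁] at hc
  have hc₁ : t₁ ≤ c := hc.1
  have hc₂ : c < t₂ := by
    refine lt_of_le_of_ne (hc.2.trans ht₂) ?_
    rintro rfl
    exact (ne_of_lt h₂) hUW
  rcases h.le_or_le _ (h.left.swap h.right (hI c ⟨hc₁, hc₂.le⟩) hUW) with h' | h'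
  · have := h' t₂
    simp only [if_neg hc₂.not_ge] at this
    exact this.not_gt h₂
  · have := h' t₁
    simp only [if_pos hc₁] at this
    exact this.not_gt h₁

/-- Linear interpolation between `U` and `W` makes the gap a continuous image of a product of two
intervals. -/
theorem isPreconnected (h : H.Gap U W) : IsPreconnected (between U W) := by
  have hpre : IsPreconnected ({t | U t < W t} ×ˢ Ioo (0 : ℝ) 1) :=
    h.ordConnected.isPreconnected.prod isPreconnected_Ioo
  have hsub : {t | U t < W t} ⊆ Icc (H.y ⊥) (H.y ⊤) := fun t ht =>
    Ioo_subset_Icc_self (h.mem_Ioo ht)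
  have hfst : ∀ {g : ℝ → ℝ}, H.IsPath g →
      ContinuousOn (fun z : ℝ × ℝ => g z.1) ({t | U t < W t} ×ˢ Ioo (0 : ℝ) 1) := fun hg =>
    (hg.cont.mono hsub).comp continuousOn_fst fun z hz => hz.1
  have himg := hpre.image (fun z : ℝ × ℝ => (U z.1 + z.2 * (W z.1 - U z.1), z.1))
    (((hfst h.left).add (continuousOn_snd.mul ((hfst h.right).sub (hfst h.left)))).prodMk
      continuousOn_fst)
  convert himg using 1
  ext ⟨s, t⟩
  simp only [between, mem_ofPred_eq, mem_image, mem_prod, Prod.mk.injEq, Prod.exists]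
  constructor
  · rintro ⟨h1, h2⟩
    have hpos : 0 < W t - U t := by linarith
    refine ⟨t, (s - U t) / (W t - U t), ⟨h1.trans h2, div_pos (by linarith) hpos, ?_⟩, ?_, rfl⟩
    · rw [div_lt_one hpos]; linarith
    · field_simp; ring
  · rintro ⟨t', θ, ⟨h1, h2, h3⟩, h4, rfl⟩
    have hpos : 0 < W t' - U t' := by linarith
    constructor <;> nlinarith

theorem closure_inter_compl_subset (h : H.Gap U W) :
    closure (between U W) ∩ H.compl ⊆ between U W := by
  rintro ⟨s, t⟩ ⟨hcl, hc⟩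
  have hclosed : IsClosed ((Prod.snd ⁻¹' Icc (H.y ⊥) (H.y ⊤)) ∩
      ((fun z : ℝ × ℝ => (z.1 - U z.2, W z.2 - z.1)) ⁻¹' (Ici 0 ×ˢ Ici 0))) := by
    have hsnd : ∀ {g : ℝ → ℝ}, H.IsPath g →
        ContinuousOn (fun z : ℝ × ℝ => g z.2) (Prod.snd ⁻¹' Icc (H.y ⊥) (H.y ⊤)) := fun hg =>
      hg.cont.comp continuousOn_snd fun z hz => hz
    exact ((continuousOn_fst.sub (hsnd h.left)).prodMk
      ((hsnd h.right).sub continuousOn_fst)).preimage_isClosed_of_isClosed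
      (isClosed_Icc.preimage continuous_snd) (isClosed_Ici.prod isClosed_Ici)
  have hmem := closure_minimal (s := between U W) (fun z hz => ?_) hclosed hcl
  · obtain ⟨ht, h1, h2⟩ := hmem
    simp only [mem_preimage, mem_Ici, sub_nonneg] at ht h1 h2
    exact ⟨lt_of_le_of_ne h1 (h.left.ne_of_mem_compl hc ht).symm,
      lt_of_le_of_ne h2 (h.right.ne_of_mem_compl hc ht)⟩
  · refine ⟨Ioo_subset_Icc_self (h.mem_Ioo (hz.1.trans hz.2)), ?_, ?_⟩
    · exact sub_nonneg.2 hz.1.le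
    · exact sub_nonneg.2 hz.2.le

/-- The gap is connected and open, and it is closed relative to the complement of the drawing. -/
theorem component_eq (h : H.Gap U W) {z : ℝ × ℝ} (hz : z ∈ between U W) :
    connectedComponentIn H.compl z = between U W := by
  have hzc := h.subset_compl hz
  refine Subset.antisymm ?_ (h.isPreconnected.subset_connectedComponentIn hz h.subset_compl)
  refine isPreconnected_connectedComponentIn.subset_of_closure_inter_subset h.isOpen
    ⟨z, mem_connectedComponentIn hzc, hz⟩ fun z' hz' => ?_
  exact h.closure_inter_compl_subset ⟨hz'.1, connectedComponentIn_subset _ _ hz'.2⟩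

theorem between_eq (h : H.Gap U W) (h' : H.Gap U' W') {z : ℝ × ℝ} (hz : z ∈ between U W)
    (hz' : z ∈ between U' W') : between U W = between U' W' := by
  rw [← h.component_eq hz, h'.component_eq hz']

theorem isFace (h : H.Gap U W) : H.IsFace (between U W) := by
  obtain ⟨z, hz⟩ := h.nonempty
  refine ⟨⟨z, h.subset_compl hz, (h.component_eq hz).symm⟩, ?_⟩
  obtain ⟨lo, hlo⟩ := (isCompact_Icc.image_of_continuousOn h.left.cont).bddBelow
  obtain ⟨hi, hhi⟩ := (isCompact_Icc.image_of_continuousOn h.right.cont).bddAbove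
  refine (Metric.isBounded_Icc (lo, H.y ⊥) (hi, H.y ⊤)).subset fun z hz => ?_
  have ht := Ioo_subset_Icc_self (h.mem_Ioo (hz.1.trans hz.2))
  exact ⟨⟨(hlo ⟨_, ht, rfl⟩).trans hz.1.le, ht.1⟩, ⟨hz.2.le.trans (hhi ⟨_, ht, rfl⟩), ht.2⟩⟩

/-- Below and above `t₀` the paths next meet at the heights `α` and `β`. These are vertices: an edge
of `U` with the meeting point in its interior would also belong to `W`, and the paths would agree on
the side of the gap. -/
theorem exists_extent (h : H.Gap U W) : ∃ m M : Hat P, U (H.y m) = H.x m ∧ W (H.y m) = H.x m ∧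
    U (H.y M) = H.x M ∧ W (H.y M) = H.x M ∧ ∀ t, U t < W t ↔ t ∈ Ioo (H.y m) (H.y M) := by
  obtain ⟨t₀, ht₀⟩ := h.exists_lt
  have hI := Ioo_subset_Icc_self (h.mem_Ioo ht₀)
  have hsubR : Icc t₀ (H.y ⊤) ⊆ Icc (H.y ⊥) (H.y ⊤) := Icc_subset_Icc_left hI.1
  have hsubL : Icc (H.y ⊥) t₀ ⊆ Icc (H.y ⊥) (H.y ⊤) := Icc_subset_Icc_right hI.2
  have hcR : IsCompact (Icc t₀ (H.y ⊤) ∩ (fun t => U t - W t) ⁻¹' Ici 0) :=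
    (isCompact_Icc.of_isClosed_subset (((h.left.cont.mono hsubR).sub
      (h.right.cont.mono hsubR)).preimage_isClosed_of_isClosed isClosed_Icc isClosed_Ici)
      inter_subset_left)
  have hcL : IsCompact (Icc (H.y ⊥) t₀ ∩ (fun t => U t - W t) ⁻¹' Ici 0) :=
    (isCompact_Icc.of_isClosed_subset (((h.left.cont.mono hsubL).sub
      (h.right.cont.mono hsubL)).preimage_isClosed_of_isClosed isClosed_Icc isClosed_Ici)
      inter_subset_left)
  obtain ⟨β, ⟨hβ, hβ'⟩, hβmin⟩ := hcR.exists_isLeast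
    ⟨H.y ⊤, ⟨hI.2, le_rfl⟩, by simp [h.left.apply_top, h.right.apply_top]⟩
  obtain ⟨α, ⟨hα, hα'⟩, hαmax⟩ := hcL.exists_isGreatest
    ⟨H.y ⊥, ⟨le_rfl, hI.1⟩, by simp [h.left.apply_bot, h.right.apply_bot]⟩
  have hβ'' : W β ≤ U β := by simpa using hβ'
  have hα'' : W α ≤ U α := by simpa using hα'
  have hltβ : ∀ t, t₀ ≤ t → t < β → U t < W t := fun t h1 h2 => by
    by_contra hle
    exact h2.not_ge (hβmin ⟨⟨h1, h2.le.trans hβ.2⟩, by simpa using hle⟩)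
  have hltα : ∀ t, α < t → t ≤ t₀ → U t < W t := fun t h1 h2 => by
    by_contra hle
    exact h1.not_ge (hαmax ⟨⟨hα.1.trans h1.le, h2⟩, by simpa using hle⟩)
  have heqβ : U β = W β := by
    obtain ⟨u, hu, hu'⟩ := h.left.exists_eq h.right hI (hsubR hβ) ht₀.le hβ''
    rw [uIcc_of_le hβ.1] at hu
    have : u = β := le_antisymm hu.2 (hβmin ⟨⟨hu.1, hu.2.trans hβ.2⟩, by simp [hu']⟩)
    rwa [this] at hu'
  have heqα : U α = W α := by
    obtain ⟨u, hu, hu'⟩ := h.left.exists_eq h.right hI (hsubL hα) ht₀.le hα''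
    rw [uIcc_of_ge hα.2] at hu
    have : u = α := le_antisymm (hαmax ⟨⟨hα.1.trans hu.1, hu.2⟩, by simp [hu']⟩) hu.1
    rwa [this] at hu'
  have ht₀β : t₀ < β := lt_of_le_of_ne hβ.1 fun h' => by rw [← h'] at heqβ; exact ht₀.ne heqβ
  have hαt₀ : α < t₀ := lt_of_le_of_ne hα.2 fun h' => by rw [h'] at heqα; exact ht₀.ne heqα
  obtain ⟨e, he1, he2, he3⟩ := h.left.exists_edge_below
    ⟨hI.1.trans_lt ht₀β, hβ.2⟩
  have heβ : H.y e.top = β := by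
    refine le_antisymm (not_lt.1 fun hlt => ?_) he2
    have h1 := h.right.eqOn_of_eq (e := e) ⟨he1, hlt⟩ (heqβ ▸ he3 ⟨he1.le, he2⟩)
    obtain ⟨s, hs, hsβ⟩ := exists_between (max_lt he1 ht₀β)
    obtain ⟨hs1, hs2⟩ := max_lt_iff.1 hs
    have hse : s ∈ H.dom e := ⟨hs1.le, hsβ.le.trans he2⟩
    exact (hltβ s hs2.le hsβ).ne ((he3 hse).trans (h1 hse).symm)
  obtain ⟨e', he1', he2', he3'⟩ := h.left.exists_edge_above
    ⟨hα.1, hαt₀.trans_le hI.2⟩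
  have heα : H.y e'.bot = α := by
    refine le_antisymm he1' (not_lt.1 fun hlt => ?_)
    have h1 := h.right.eqOn_of_eq (e := e') ⟨hlt, he2'⟩ (heqα ▸ he3' ⟨he1', he2'.le⟩)
    obtain ⟨s, hαs, hs⟩ := exists_between (lt_min he2' hαt₀)
    obtain ⟨hs1, hs2⟩ := lt_min_iff.1 hs
    have hse : s ∈ H.dom e' := ⟨he1'.trans hαs.le, hs1.le⟩
    exact (hltα s hαs hs2.le).ne ((he3' hse).trans (h1 hse).symm)
  have hUM : U (H.y e.top) = H.x e.top := by
    rw [he3 ⟨(H.y_bot_lt_y_top e).le, le_rfl⟩, H.arc_top]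
  have hUm : U (H.y e'.bot) = H.x e'.bot := by
    rw [he3' ⟨le_rfl, (H.y_bot_lt_y_top e').le⟩, H.arc_bot]
  refine ⟨e'.bot, e.top, hUm, ?_, hUM, ?_, fun t => ⟨fun ht => ?_, fun ht => ?_⟩⟩
  · rw [← hUm, heα, heqα]
  · rw [← hUM, heβ, heqβ]
  · rw [heα, heβ]
    have hoc := h.ordConnected
    constructor
    · by_contra! hle
      exact (ne_of_lt (hoc.out (x := t) ht ht₀ ⟨hle, hαt₀.le⟩)) heqα
    · by_contra! hle
      exact (ne_of_lt (hoc.out (x := t₀) ht₀ ht ⟨ht₀β.le, hle⟩)) heqβ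
  · rw [heα, heβ] at ht
    rcases le_total t t₀ with h' | h'
    · exact hltα t ht.1 h'
    · exact hltβ t h' ht.2

end Gap

theorem leftmost_le (e : BoundedEdge P) {t : ℝ} (ht : t ∈ H.dom e) :
    H.arc .leftmost t ≤ H.arc e t := by
  by_cases he : e = .leftmost
  · rw [he]
  obtain ⟨g, hg, hge⟩ := exists_isPath (H := H) e
  obtain ⟨l, hl, hle⟩ := exists_isPath (H := H) .leftmost
  have ht' := H.dom_subset e ht
  rcases ht'.1.eq_or_lt with rfl | h1
  · rw [← hge ht, ← hle ht', hg.apply_bot, hl.apply_bot]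
  rcases ht'.2.eq_or_lt with rfl | h2
  · rw [← hge ht, ← hle ht', hg.apply_top, hl.apply_top]
  exact (H.leftmost_lt e he t ⟨⟨h1, h2⟩, ht⟩).le

theorem le_rightmost (e : BoundedEdge P) {t : ℝ} (ht : t ∈ H.dom e) :
    H.arc e t ≤ H.arc .rightmost t := by
  by_cases he : e = .rightmost
  · rw [he]
  obtain ⟨g, hg, hge⟩ := exists_isPath (H := H) e
  obtain ⟨l, hl, hle⟩ := exists_isPath (H := H) .rightmost
  have ht' := H.dom_subset e ht
  rcases ht'.1.eq_or_lt with rfl | h1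
  · rw [← hge ht, ← hle ht', hg.apply_bot, hl.apply_bot]
  rcases ht'.2.eq_or_lt with rfl | h2
  · rw [← hge ht, ← hle ht', hg.apply_top, hl.apply_top]
  exact (H.lt_rightmost e he t ⟨⟨h1, h2⟩, ht⟩).le

theorem IsPath.leftmost_le {g : ℝ → ℝ} (hg : H.IsPath g) {t : ℝ}
    (ht : t ∈ Icc (H.y ⊥) (H.y ⊤)) : H.arc .leftmost t ≤ g t := by
  obtain ⟨e, h1, h2⟩ := hg.exists_edge ht
  rw [h2 h1]
  exact BoundedEmbedding.leftmost_le e h1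

theorem IsPath.le_rightmost {g : ℝ → ℝ} (hg : H.IsPath g) {t : ℝ}
    (ht : t ∈ Icc (H.y ⊥) (H.y ⊤)) : g t ≤ H.arc .rightmost t := by
  obtain ⟨e, h1, h2⟩ := hg.exists_edge ht
  rw [h2 h1]
  exact BoundedEmbedding.le_rightmost e h1

/-- If no edge lies to the left of a point at its height, or none to the right, a horizontal ray
shows that its component is unbounded. So the points of a face lie strictly between the two
additional edges. -/
theorem exists_gap_of_isFace {F : Set (ℝ × ℝ)} (hF : H.IsFace F) :
    ∃ U W, H.Gap U W ∧ F = between U W := by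
  obtain ⟨⟨z, hz, rfl⟩, hb⟩ := hF
  have hleft : ∀ z ∈ H.compl, Bornology.IsBounded (connectedComponentIn H.compl z) →
      ¬ ∀ e, z.2 ∈ H.dom e → z.1 < H.arc e z.2 := by
    intro z hz hb hlt
    have hpre : IsPreconnected ((fun s => (s, z.2)) '' Iic z.1) :=
      isPreconnected_Iic.image _ (by fun_prop)
    have hsub := hpre.subset_connectedComponentIn (x := z) ⟨z.1, self_mem_Iic, rfl⟩
      (F := H.compl) (by
        rintro _ ⟨s, hs, rfl⟩ e he
        exact ((mem_Iic.1 hs).trans_lt (hlt e he)).ne)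
    have hbb := (hb.subset hsub).image_fst.bddBelow
    rw [image_image] at hbb
    simp only [image_id'] at hbb
    exact not_bddBelow_Iic _ hbb
  have hright : ∀ z ∈ H.compl, Bornology.IsBounded (connectedComponentIn H.compl z) →
      ¬ ∀ e, z.2 ∈ H.dom e → H.arc e z.2 < z.1 := by
    intro z hz hb hlt
    have hpre : IsPreconnected ((fun s => (s, z.2)) '' Ici z.1) :=
      isPreconnected_Ici.image _ (by fun_prop)
    have hsub := hpre.subset_connectedComponentIn (x := z) ⟨z.1, self_mem_Ici, rfl⟩
      (F := H.compl) (by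
        rintro _ ⟨s, hs, rfl⟩ e he
        exact ((hlt e he).trans_le (mem_Ici.1 hs)).ne')
    have hbb := (hb.subset hsub).image_fst.bddAbove
    rw [image_image] at hbb
    simp only [image_id'] at hbb
    exact not_bddAbove_Ici _ hbb
  have ht : z.2 ∈ Icc (H.y ⊥) (H.y ⊤) := by
    by_contra ht
    exact hleft z hz hb fun e he => absurd (H.dom_subset e he) ht
  have h1 : H.arc .leftmost z.2 < z.1 := by
    refine lt_of_le_of_ne (not_lt.1 fun hlt => ?_) (hz .leftmost ht).symm
    exact hleft z hz hb fun e he => hlt.trans_le (leftmost_le e he)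
  have h2 : z.1 < H.arc .rightmost z.2 := by
    refine lt_of_le_of_ne (not_lt.1 fun hlt => ?_) (hz .rightmost ht)
    exact hright z hz hb fun e he => (le_rightmost e he).trans_lt hlt
  obtain ⟨l, hl, hle⟩ := exists_isPath (H := H) .leftmost
  obtain ⟨r, hr, hre⟩ := exists_isPath (H := H) .rightmost
  obtain ⟨U, W, hUW, hzUW, -⟩ := exists_gap hz hl hr (by rwa [hle ht]) (by rwa [hre ht])
  exact ⟨U, W, hUW, hUW.component_eq hzUW⟩

/-! ### The faces next to an edge -/

theorem eventually_mem_between_right {U W : ℝ → ℝ} {e : BoundedEdge P} {t : ℝ}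
    (hU : U t = H.arc e t) (hlt : U t < W t) :
    ∀ᶠ s in 𝓝[>] (H.arc e t), (s, t) ∈ between U W := by
  rw [← hU]
  exact (Ioo_mem_nhdsGT hlt : Ioo (U t) (W t) ∈ 𝓝[>] (U t))

theorem eventually_mem_between_left {U W : ℝ → ℝ} {e : BoundedEdge P} {t : ℝ}
    (hW : W t = H.arc e t) (hlt : U t < W t) :
    ∀ᶠ s in 𝓝[<] (H.arc e t), (s, t) ∈ between U W := by
  rw [← hW]
  exact (Ioo_mem_nhdsLT hlt : Ioo (U t) (W t) ∈ 𝓝[<] (W t))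

theorem Gap.rightFace_eq {U W : ℝ → ℝ} (h : H.Gap U W) {e : BoundedEdge P}
    (hU : EqOn U (H.arc e) (H.dom e)) (hlt : ∀ t ∈ H.openDom e, U t < W t) :
    H.rightFace e = between U W := by
  ext z
  constructor
  · rintro ⟨hz, t, ht, hev⟩
    obtain ⟨s, hs1, hs2⟩ := (hev.and (eventually_mem_between_right
      (hU (Ioo_subset_Icc_self ht)) (hlt t ht))).exists
    rw [← h.component_eq hs2, ← connectedComponentIn_eq hs1]
    exact mem_connectedComponentIn hz
  · intro hz
    obtain ⟨t, ht⟩ := nonempty_Ioo.2 (H.y_bot_lt_y_top e)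
    refine ⟨h.subset_compl hz, t, ht, ?_⟩
    rw [h.component_eq hz]
    exact eventually_mem_between_right (hU (Ioo_subset_Icc_self ht)) (hlt t ht)

theorem Gap.leftFace_eq {U W : ℝ → ℝ} (h : H.Gap U W) {e : BoundedEdge P}
    (hW : EqOn W (H.arc e) (H.dom e)) (hlt : ∀ t ∈ H.openDom e, U t < W t) :
    H.leftFace e = between U W := by
  ext z
  constructor
  · rintro ⟨hz, t, ht, hev⟩
    obtain ⟨s, hs1, hs2⟩ := (hev.and (eventually_mem_between_left
      (hW (Ioo_subset_Icc_self ht)) (hlt t ht))).exists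
    rw [← h.component_eq hs2, ← connectedComponentIn_eq hs1]
    exact mem_connectedComponentIn hz
  · intro hz
    obtain ⟨t, ht⟩ := nonempty_Ioo.2 (H.y_bot_lt_y_top e)
    refine ⟨h.subset_compl hz, t, ht, ?_⟩
    rw [h.component_eq hz]
    exact eventually_mem_between_left (hW (Ioo_subset_Icc_self ht)) (hlt t ht)

theorem lt_on_openDom {U W : ℝ → ℝ} (hU : H.IsPath U) (hW : H.IsPath W) {e : BoundedEdge P}
    (he : EqOn U (H.arc e) (H.dom e) ∨ EqOn W (H.arc e) (H.dom e)) {t₀ : ℝ}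
    (ht₀ : t₀ ∈ H.openDom e) (hlt : U t₀ < W t₀) {t : ℝ} (ht : t ∈ H.openDom e) : U t < W t := by
  by_contra! hle
  have hsub : H.openDom e ⊆ Icc (H.y ⊥) (H.y ⊤) :=
    (H.openDom_subset e).trans Ioo_subset_Icc_self
  obtain ⟨u, hu, hUW⟩ := hU.exists_eq hW (hsub ht₀) (hsub ht) hlt.le hle
  have hu' : u ∈ H.openDom e := ordConnected_Ioo.uIcc_subset ht₀ ht hu
  have hu'' := Ioo_subset_Icc_self hu'
  have ht₀' := Ioo_subset_Icc_self ht₀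
  rcases he with he | he
  · have := hW.eqOn_of_eq hu' (hUW ▸ he hu'')
    exact hlt.ne ((he ht₀').trans (this ht₀').symm)
  · have := hU.eqOn_of_eq hu' (hUW.trans (he hu''))
    exact hlt.ne ((this ht₀').trans (he ht₀').symm)

/-- Take the gap around a point next to `e` on the right, with no other edge in between. Its left
path is not to the left of a path through `e`, and it has no edge strictly between `e` and the point
to run on, so it runs on `e`. -/
theorem exists_gap_right {e : BoundedEdge P} (he : e ≠ .rightmost) :
    ∃ U W, H.Gap U W ∧ EqOn U (H.arc e) (H.dom e) ∧ (∀ t ∈ H.openDom e, U t < W t) ∧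
      H.rightFace e = between U W := by
  obtain ⟨t, ht⟩ := nonempty_Ioo.2 (H.y_bot_lt_y_top e)
  have htd := Ioo_subset_Icc_self ht
  have hI := H.dom_subset e htd
  have hA : (range (fun e' => H.arc e' t) \ {H.arc e t})ᶜ ∈ 𝓝[>] (H.arc e t) :=
    mem_nhdsWithin_of_mem_nhds (((finite_range _).subset
      sdiff_subset).isClosed.isOpen_compl.mem_nhds (by simp))
  obtain ⟨u, hu, hu'⟩ := mem_nhdsGT_iff_exists_Ioo_subset.1 hA
  have hr := H.lt_rightmost e he t ⟨H.openDom_subset e ht, htd⟩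
  obtain ⟨s, hs, hs'⟩ := exists_between (lt_min (mem_Ioi.1 hu) hr)
  obtain ⟨hsu, hsr⟩ := lt_min_iff.1 hs'
  have hz : (s, t) ∈ H.compl := fun e' _ heq =>
    hu' ⟨hs, hsu⟩ ⟨⟨e', heq.symm⟩, hs.ne'⟩
  obtain ⟨g, hg, hge⟩ := exists_isPath (H := H) e
  obtain ⟨r, hr, hre⟩ := exists_isPath (H := H) .rightmost
  obtain ⟨U, W, hUW, hzUW, hU, -⟩ := exists_gap hz hg hr (by rwa [hge htd]) (by rwa [hre hI])
  have hUt : U t = H.arc e t := by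
    refine le_antisymm (not_lt.1 fun hlt => ?_) ?_
    · obtain ⟨e', h1, h2⟩ := hUW.left.exists_edge hI
      exact hu' ⟨hlt, hzUW.1.trans hsu⟩ ⟨⟨e', (h2 h1).symm⟩, hlt.ne'⟩
    · rw [← hge htd]
      exact hU g hg (by rwa [hge htd]) t
  have hUe := hUW.left.eqOn_of_eq ht hUt
  have hlt := fun t' ht' => lt_on_openDom hUW.left hUW.right (Or.inl hUe) ht
    (hzUW.1.trans hzUW.2) (t := t') ht'
  exact ⟨U, W, hUW, hUe, hlt, hUW.rightFace_eq hUe hlt⟩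

theorem exists_gap_left {e : BoundedEdge P} (he : e ≠ .leftmost) :
    ∃ U W, H.Gap U W ∧ EqOn W (H.arc e) (H.dom e) ∧ (∀ t ∈ H.openDom e, U t < W t) ∧
      H.leftFace e = between U W := by
  obtain ⟨t, ht⟩ := nonempty_Ioo.2 (H.y_bot_lt_y_top e)
  have htd := Ioo_subset_Icc_self ht
  have hI := H.dom_subset e htd
  have hA : (range (fun e' => H.arc e' t) \ {H.arc e t})ᶜ ∈ 𝓝[<] (H.arc e t) :=
    mem_nhdsWithin_of_mem_nhds (((finite_range _).subset
      sdiff_subset).isClosed.isOpen_compl.mem_nhds (by simp))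
  obtain ⟨u, hu, hu'⟩ := mem_nhdsLT_iff_exists_Ioo_subset.1 hA
  have hl := H.leftmost_lt e he t ⟨H.openDom_subset e ht, htd⟩
  obtain ⟨s, hs', hs⟩ := exists_between (max_lt (mem_Iio.1 hu) hl)
  obtain ⟨hsu, hsl⟩ := max_lt_iff.1 hs'
  have hz : (s, t) ∈ H.compl := fun e' _ heq =>
    hu' ⟨hsu, hs⟩ ⟨⟨e', heq.symm⟩, hs.ne⟩
  obtain ⟨g, hg, hge⟩ := exists_isPath (H := H) e
  obtain ⟨l, hl, hle⟩ := exists_isPath (H := H) .leftmost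
  obtain ⟨U, W, hUW, hzUW, -, hW⟩ := exists_gap hz hl hg (by rwa [hle hI]) (by rwa [hge htd])
  have hWt : W t = H.arc e t := by
    refine le_antisymm ?_ (not_lt.1 fun hlt => ?_)
    · rw [← hge htd]
      exact hW g hg (by rwa [hge htd]) t
    · obtain ⟨e', h1, h2⟩ := hUW.right.exists_edge hI
      exact hu' ⟨hsu.trans hzUW.2, hlt⟩ ⟨⟨e', (h2 h1).symm⟩, hlt.ne⟩
  have hWe := hUW.right.eqOn_of_eq ht hWt
  have hlt := fun t' ht' => lt_on_openDom hUW.left hUW.right (Or.inr hWe) ht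
    (hzUW.1.trans hzUW.2) (t := t') ht'
  exact ⟨U, W, hUW, hWe, hlt, hUW.leftFace_eq hWe hlt⟩

namespace Gap

variable {U W U' W' : ℝ → ℝ}

theorem eq_of_between_eq (heq : between U W = between U' W') {t : ℝ} (ht : U t < W t) :
    U t = U' t ∧ W t = W' t := by
  have h : Ioo (U t) (W t) = Ioo (U' t) (W' t) := by
    ext s
    exact Set.ext_iff.1 heq (s, t)
  have h1 : U' t < W' t := nonempty_Ioo.1 (h ▸ nonempty_Ioo.2 ht)
  obtain ⟨h2, h3⟩ := (Ioo_subset_Ioo_iff ht).1 h.subset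
  obtain ⟨h4, h5⟩ := (Ioo_subset_Ioo_iff h1).1 h.superset
  exact ⟨le_antisymm h4 h2, le_antisymm h3 h5⟩

/-- A face determines its bounding graphs at the heights of its points, so the gap next to `e` can
be compared with the given one. No gap reaches beyond `rightmost`. -/
theorem of_rightFace_eq (h : H.Gap U W) {e : BoundedEdge P} (he : H.rightFace e = between U W) :
    EqOn U (H.arc e) (H.dom e) ∧ ∀ t ∈ H.openDom e, U t < W t := by
  have hne : e ≠ .rightmost := by
    rintro rfl
    obtain ⟨z, hz⟩ := h.nonempty
    have hz' := hz
    rw [← he] at hz'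
    obtain ⟨-, t, ht, hev⟩ := hz'
    rw [h.component_eq hz] at hev
    obtain ⟨s, hs1, hs2⟩ := (hev.and self_mem_nhdsWithin).exists
    exact (hs1.2.trans_le (h.right.le_rightmost (Ioo_subset_Icc_self ht))).not_gt hs2
  obtain ⟨U', W', h', hU', hlt', heq⟩ := exists_gap_right (H := H) hne
  rw [he] at heq
  obtain ⟨t, ht⟩ := nonempty_Ioo.2 (H.y_bot_lt_y_top e)
  obtain ⟨h1, h2⟩ := eq_of_between_eq heq.symm (hlt' t ht)
  have hU := h.left.eqOn_of_eq ht (h1 ▸ hU' (Ioo_subset_Icc_self ht))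
  exact ⟨hU, fun t' ht' => lt_on_openDom h.left h.right (Or.inl hU) ht (h1 ▸ h2 ▸ hlt' t ht) ht'⟩

theorem of_leftFace_eq (h : H.Gap U W) {e : BoundedEdge P} (he : H.leftFace e = between U W) :
    EqOn W (H.arc e) (H.dom e) ∧ ∀ t ∈ H.openDom e, U t < W t := by
  have hne : e ≠ .leftmost := by
    rintro rfl
    obtain ⟨z, hz⟩ := h.nonempty
    have hz' := hz
    rw [← he] at hz'
    obtain ⟨-, t, ht, hev⟩ := hz'
    rw [h.component_eq hz] at hev
    obtain ⟨s, hs1, hs2⟩ := (hev.and self_mem_nhdsWithin).exists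
    exact ((h.left.leftmost_le (Ioo_subset_Icc_self ht)).trans_lt hs1.1).not_gt hs2
  obtain ⟨U', W', h', hW', hlt', heq⟩ := exists_gap_left (H := H) hne
  rw [he] at heq
  obtain ⟨t, ht⟩ := nonempty_Ioo.2 (H.y_bot_lt_y_top e)
  obtain ⟨h1, h2⟩ := eq_of_between_eq heq.symm (hlt' t ht)
  have hW := h.right.eqOn_of_eq ht (h2 ▸ hW' (Ioo_subset_Icc_self ht))
  exact ⟨hW, fun t' ht' => lt_on_openDom h.left h.right (Or.inr hW) ht (h1 ▸ h2 ▸ hlt' t ht) ht'⟩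

end Gap

/-! ### Vertices and edges along a path -/

theorem exists_endpoint (w : Hat P) : ∃ e : BoundedEdge P, w = e.bot ∨ w = e.top := by
  by_cases hw : w = ⊤
  · exact ⟨.leftmost, Or.inr hw⟩
  · obtain ⟨w', hw'⟩ := exists_covBy_of_wellFoundedLT (a := w) (by rwa [isMax_iff_eq_top])
    exact ⟨.hasse ⟨(w, w'), hw'⟩, Or.inl rfl⟩

/-- Some edge `e'` ends at `w`. If `e' ≠ e`, then `no_crossing` makes the common point an endpoint
of both, and the heights of the ends of `e'` identify it as `w`. -/
theorem endpoint_of_arc_eq {e : BoundedEdge P} {w : Hat P} (hw : H.y w ∈ H.dom e)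
    (h : H.arc e (H.y w) = H.x w) : w = e.bot ∨ w = e.top := by
  obtain ⟨e', he'⟩ := exists_endpoint w
  by_cases hne : e = e'
  · rwa [hne]
  have hlt := H.y_bot_lt_y_top e'
  have hw' : H.y w ∈ H.dom e' := by
    rcases he' with rfl | rfl
    exacts [⟨le_rfl, hlt.le⟩, ⟨hlt.le, le_rfl⟩]
  have harc : H.arc e' (H.y w) = H.x w := by
    rcases he' with rfl | rfl
    exacts [H.arc_bot _, H.arc_top _]
  obtain ⟨w', h1, h2, h3⟩ := H.no_crossing e e' hne _ ⟨hw, hw'⟩ (h.trans harc.symm)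
  have : w = w' := by
    rcases he' with rfl | rfl <;> rcases h2 with rfl | rfl
    · rfl
    · exact absurd h3 hlt.ne
    · exact absurd h3 hlt.ne'
    · rfl
  rwa [this]

theorem vertex_injective {w w' : Hat P} (hy : H.y w = H.y w') (hx : H.x w = H.x w') : w = w' := by
  obtain ⟨e, he⟩ := exists_endpoint w
  have hlt := H.y_bot_lt_y_top e
  have hw : H.y w ∈ H.dom e := by
    rcases he with rfl | rfl
    exacts [⟨le_rfl, hlt.le⟩, ⟨hlt.le, le_rfl⟩]
  have harc : H.arc e (H.y w) = H.x w := by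
    rcases he with rfl | rfl
    exacts [H.arc_bot _, H.arc_top _]
  rw [hy] at hw harc
  rcases he with rfl | rfl <;>
    rcases endpoint_of_arc_eq hw (harc.trans hx) with rfl | rfl
  · rfl
  · exact absurd hy hlt.ne
  · exact absurd hy hlt.ne'
  · rfl

theorem IsPath.exists_downPath {g : ℝ → ℝ} (hg : H.IsPath g) {m : Hat P}
    (hm : g (H.y m) = H.x m) (M : Hat P) (hM : g (H.y M) = H.x M) (hle : H.y m ≤ H.y M) :
    ∃ l, DownPath BoundedEdge.top BoundedEdge.bot M l m ∧
      ∀ e, e ∈ l ↔ EqOn g (H.arc e) (H.dom e) ∧ H.dom e ⊆ Icc (H.y m) (H.y M) := by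
  induction M using WellFoundedLT.induction with
  | ind M ih =>
    rcases hle.eq_or_lt with heq | hlt
    · refine ⟨[], (vertex_injective heq (by rw [← hm, ← hM, heq])).symm, fun e => ?_⟩
      simp only [List.not_mem_nil, false_iff, not_and]
      intro _ hsub
      have hlt := H.y_bot_lt_y_top e
      have h1 := (hsub ⟨le_rfl, hlt.le⟩).1
      have h2 := (hsub ⟨hlt.le, le_rfl⟩).2
      exact (h1.trans_lt (hlt.trans_le h2)).ne heq
    · obtain ⟨e, h1, h2, h3⟩ := hg.exists_edge_below ⟨(H.y_bot_le m).trans_lt hlt, H.le_y_top M⟩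
      have hMe : M = e.top := by
        rcases endpoint_of_arc_eq ⟨h1.le, h2⟩ ((h3 ⟨h1.le, h2⟩).symm.trans hM) with rfl | h
        · exact absurd h1 (lt_irrefl _)
        · exact h
      subst hMe
      have hme : H.y m ≤ H.y e.bot := by
        by_contra! hlt'
        have hmd : H.y m ∈ H.dom e := ⟨hlt'.le, hlt.le⟩
        rcases endpoint_of_arc_eq hmd ((h3 hmd).symm.trans hm) with rfl | rfl
        · exact lt_irrefl _ hlt'
        · exact lt_irrefl _ hlt
      obtain ⟨l, hl, hmem⟩ := ih e.bot e.bot_lt_top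
        (by rw [h3 ⟨le_rfl, h1.le⟩, H.arc_bot]) hme
      refine ⟨e :: l, ⟨rfl, hl⟩, fun e' => ?_⟩
      rw [List.mem_cons, hmem]
      constructor
      · rintro (rfl | ⟨h4, h5⟩)
        · exact ⟨h3, Icc_subset_Icc_left hme⟩
        · exact ⟨h4, h5.trans (Icc_subset_Icc_right h1.le)⟩
      · rintro ⟨h4, h5⟩
        have hlt' := H.y_bot_lt_y_top e'
        have h6 := (h5 ⟨le_rfl, hlt'.le⟩).1
        have h7 := (h5 ⟨hlt'.le, le_rfl⟩).2
        by_cases hb : H.y e'.top ≤ H.y e.bot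
        · exact Or.inr ⟨h4, Icc_subset_Icc h6 hb⟩
        · left
          obtain ⟨t, ht, ht'⟩ := exists_between (max_lt (not_le.1 hb) hlt')
          obtain ⟨ht1, ht2⟩ := max_lt_iff.1 ht
          have ht3 : t ∈ H.openDom e := ⟨ht1, ht'.trans_le h7⟩
          have ht4 : t ∈ H.openDom e' := ⟨ht2, ht'⟩
          refine edge_eq_of_meet ht4 (Ioo_subset_Icc_self ht3) ?_
          rw [← h4 (Ioo_subset_Icc_self ht4), h3 (Ioo_subset_Icc_self ht3)]

end BoundedEmbedding

/-! ### The boundary of a face -/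

/-- Nothing lies above `⊤` or below `⊥`. So an additional edge of the drawing is the entire boundary
chain in which it occurs. -/
theorem DownPath.eq_singleton {α E : Type*} [PartialOrder α] [BoundedOrder α] {top bot : E → α}
    (hlt : ∀ e, bot e < top e) {a b : α} {l : List E} (h : DownPath top bot a l b) {e : E}
    (he : e ∈ l) (ht : top e = ⊤) (hb : bot e = ⊥) : l = [e] := by
  induction l generalizing a with
  | nil => simp at he
  | cons e' l ih =>
    rcases List.mem_cons.1 he with rfl | he
    · cases l with
      | nil => rfl
      | cons e'' l =>
        have h1 := hlt e''
        rw [h.2.1, hb] at h1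
        exact absurd h1 not_lt_bot
    · have h1 := ih h.2 he
      subst h1
      have h2 := hlt e'
      rw [← h.2.1, ht] at h2
      exact absurd h2 not_top_lt

namespace BoundedEmbedding

variable {P : Type u} [PartialOrder P] [Finite P] {H : BoundedEmbedding P}

variable (H) in
/-- The boundary of the face `F`: its graphs, its extreme vertices, and its lists of edges. -/
structure FaceBoundary (F : Set (ℝ × ℝ)) where
  U : ℝ → ℝ
  W : ℝ → ℝ
  gap : H.Gap U W
  eq_between : F = between U W
  min : Hat P
  max : Hat P
  U_min : U (H.y min) = H.x min
  W_min : W (H.y min) = H.x min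
  U_max : U (H.y max) = H.x max
  W_max : W (H.y max) = H.x max
  lt_iff : ∀ t, U t < W t ↔ t ∈ Ioo (H.y min) (H.y max)
  left : List (BoundedEdge P)
  right : List (BoundedEdge P)
  path_left : DownPath BoundedEdge.top BoundedEdge.bot max left min
  mem_left : ∀ e, e ∈ left ↔ H.rightFace e = F
  path_right : DownPath BoundedEdge.top BoundedEdge.bot max right min
  mem_right : ∀ e, e ∈ right ↔ H.leftFace e = F

theorem IsFace.exists_boundary {F : Set (ℝ × ℝ)} (hF : H.IsFace F) :
    Nonempty (H.FaceBoundary F) := by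
  obtain ⟨U, W, h, rfl⟩ := exists_gap_of_isFace hF
  obtain ⟨m, M, h1, h2, h3, h4, h5⟩ := h.exists_extent
  have hlt : H.y m < H.y M := by
    obtain ⟨t, ht⟩ := h.exists_lt
    exact ((h5 t).1 ht).1.trans ((h5 t).1 ht).2
  -- For an edge of `U` or `W`, lying between the extreme heights becomes adjacency to the face,
  -- which is how `rightFace` and `leftFace` are recognised.
  have key : ∀ e, H.dom e ⊆ Icc (H.y m) (H.y M) ↔ ∀ t ∈ H.openDom e, U t < W t := by
    intro e
    have he := H.y_bot_lt_y_top e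
    constructor
    · intro hsub t ht
      have h6 := hsub ⟨le_rfl, he.le⟩
      have h7 := hsub ⟨he.le, le_rfl⟩
      exact (h5 t).2 ⟨h6.1.trans_lt ht.1, ht.2.trans_le h7.2⟩
    · intro h6
      obtain ⟨h7, h8⟩ := (Ioo_subset_Ioo_iff he).1 fun t ht => (h5 t).1 (h6 t ht)
      exact Icc_subset_Icc h7 h8
  obtain ⟨l, hl, hl'⟩ := h.left.exists_downPath h1 M h3 hlt.le
  obtain ⟨r, hr, hr'⟩ := h.right.exists_downPath h2 M h4 hlt.le
  refine ⟨⟨U, W, h, rfl, m, M, h1, h2, h3, h4, h5, l, r, hl, fun e => ?_, hr, fun e => ?_⟩⟩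
  · rw [hl', key]
    exact ⟨fun he => h.rightFace_eq he.1 he.2, h.of_rightFace_eq⟩
  · rw [hr', key]
    exact ⟨fun he => h.leftFace_eq he.1 he.2, h.of_leftFace_eq⟩

theorem isFace_rightFace {e : BoundedEdge P} (he : e ≠ .rightmost) : H.IsFace (H.rightFace e) := by
  obtain ⟨U, W, h, -, -, heq⟩ := exists_gap_right (H := H) he
  rw [heq]
  exact h.isFace

theorem isFace_leftFace {e : BoundedEdge P} (he : e ≠ .leftmost) : H.IsFace (H.leftFace e) := by
  obtain ⟨U, W, h, -, -, heq⟩ := exists_gap_left (H := H) he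
  rw [heq]
  exact h.isFace

namespace FaceBoundary

variable {F : Set (ℝ × ℝ)} (B : H.FaceBoundary F)

theorem U_eqOn {e : BoundedEdge P} (he : H.rightFace e = F) : EqOn B.U (H.arc e) (H.dom e) :=
  (B.gap.of_rightFace_eq (he.trans B.eq_between)).1

theorem W_eqOn {e : BoundedEdge P} (he : H.leftFace e = F) : EqOn B.W (H.arc e) (H.dom e) :=
  (B.gap.of_leftFace_eq (he.trans B.eq_between)).1

theorem openDom_subset_of_rightFace {e : BoundedEdge P} (he : H.rightFace e = F) :
    H.openDom e ⊆ Ioo (H.y B.min) (H.y B.max) := fun t ht =>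
  (B.lt_iff t).1 ((B.gap.of_rightFace_eq (he.trans B.eq_between)).2 t ht)

theorem openDom_subset_of_leftFace {e : BoundedEdge P} (he : H.leftFace e = F) :
    H.openDom e ⊆ Ioo (H.y B.min) (H.y B.max) := fun t ht =>
  (B.lt_iff t).1 ((B.gap.of_leftFace_eq (he.trans B.eq_between)).2 t ht)

theorem min_ne_max : B.min ≠ B.max := by
  obtain ⟨t, ht⟩ := B.gap.exists_lt
  intro h
  have h' := (B.lt_iff t).1 ht
  rw [h] at h'
  exact lt_irrefl _ (h'.1.trans h'.2)

theorem left_ne_nil : B.left ≠ [] := by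
  intro h
  have := B.path_left
  rw [h] at this
  exact B.min_ne_max this.symm

theorem right_ne_nil : B.right ≠ [] := by
  intro h
  have := B.path_right
  rw [h] at this
  exact B.min_ne_max this.symm

theorem rightmost_notMem_left : .rightmost ∉ B.left := by
  intro h
  rw [B.mem_left] at h
  obtain ⟨t, ht⟩ := nonempty_Ioo.2 (H.y_bot_lt_y_top (BoundedEdge.rightmost (P := P)))
  have h1 := (B.lt_iff t).2 (B.openDom_subset_of_rightFace h ht)
  rw [B.U_eqOn h (Ioo_subset_Icc_self ht)] at h1
  exact h1.not_ge (B.gap.right.le_rightmost (Ioo_subset_Icc_self ht))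

theorem leftmost_notMem_right : .leftmost ∉ B.right := by
  intro h
  rw [B.mem_right] at h
  obtain ⟨t, ht⟩ := nonempty_Ioo.2 (H.y_bot_lt_y_top (BoundedEdge.leftmost (P := P)))
  have h1 := (B.lt_iff t).2 (B.openDom_subset_of_leftFace h ht)
  rw [B.W_eqOn h (Ioo_subset_Icc_self ht)] at h1
  exact h1.not_ge (B.gap.left.leftmost_le (Ioo_subset_Icc_self ht))

theorem left_eq_of_leftmost_mem (h : .leftmost ∈ B.left) : B.left = [.leftmost] :=
  B.path_left.eq_singleton BoundedEdge.bot_lt_top h rfl rfl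

theorem right_eq_of_rightmost_mem (h : .rightmost ∈ B.right) : B.right = [.rightmost] :=
  B.path_right.eq_singleton BoundedEdge.bot_lt_top h rfl rfl

theorem exists_hasse_list {a b : Hat P} {l : List (BoundedEdge P)}
    (h : DownPath BoundedEdge.top BoundedEdge.bot a l b) (h₁ : .leftmost ∉ l)
    (h₂ : .rightmost ∉ l) : ∃ l' : List (HasseEdge P), l = l'.map .hasse ∧
      DownPath HasseEdge.top HasseEdge.bot a l' b := by
  have : l ∈ range (List.map BoundedEdge.hasse) := by
    rw [Set.range_list_map]
    rintro (e | _ | _) he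
    · exact ⟨e, rfl⟩
    · exact absurd he h₁
    · exact absurd he h₂
  obtain ⟨l', rfl⟩ := this
  exact ⟨l', rfl, h.of_map⟩

theorem mem_of_map_hasse {l : List (HasseEdge P)} {e : HasseEdge P} :
    BoundedEdge.hasse e ∈ l.map BoundedEdge.hasse ↔ e ∈ l := by
  rw [List.mem_map]
  constructor
  · rintro ⟨e', he', heq⟩
    cases heq
    exact he'
  · exact fun he => ⟨e, he, rfl⟩

theorem exists_left (h : .leftmost ∉ B.left) : ∃ l : List (HasseEdge P),
    DownPath HasseEdge.top HasseEdge.bot B.max l B.min ∧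
      ∀ e, e ∈ l ↔ H.rightFace (.hasse e) = F := by
  obtain ⟨l, h1, h2⟩ := exists_hasse_list B.path_left h B.rightmost_notMem_left
  refine ⟨l, h2, fun e => ?_⟩
  rw [← B.mem_left, h1, mem_of_map_hasse]

theorem exists_right (h : .rightmost ∉ B.right) : ∃ l : List (HasseEdge P),
    DownPath HasseEdge.top HasseEdge.bot B.max l B.min ∧
      ∀ e, e ∈ l ↔ H.leftFace (.hasse e) = F := by
  obtain ⟨l, h1, h2⟩ := exists_hasse_list B.path_right B.leftmost_notMem_right h
  refine ⟨l, h2, fun e => ?_⟩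
  rw [← B.mem_right, h1, mem_of_map_hasse]

theorem exists_left_of_rightFace {e : HasseEdge P} (he : H.rightFace (.hasse e) = F) :
    ∃ l : List (HasseEdge P), DownPath HasseEdge.top HasseEdge.bot B.max l B.min ∧
      ∀ e, e ∈ l ↔ H.rightFace (.hasse e) = F := by
  refine B.exists_left fun h => ?_
  have h' := (B.mem_left _).2 he
  rw [B.left_eq_of_leftmost_mem h] at h'
  simp at h'

theorem exists_right_of_leftFace {e : HasseEdge P} (he : H.leftFace (.hasse e) = F) :
    ∃ l : List (HasseEdge P), DownPath HasseEdge.top HasseEdge.bot B.max l B.min ∧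
      ∀ e, e ∈ l ↔ H.leftFace (.hasse e) = F := by
  refine B.exists_right fun h => ?_
  have h' := (B.mem_right _).2 he
  rw [B.right_eq_of_rightmost_mem h] at h'
  simp at h'

theorem bounds {l : List (BoundedEdge P)} {a b : Hat P}
    (h : DownPath BoundedEdge.top BoundedEdge.bot a l b) {e : BoundedEdge P} (he : e ∈ l) :
    e.top ≤ a ∧ b ≤ e.bot :=
  h.le_top_bot_le (k := OrderDual.toDual) (fun e _ => e.bot_lt_top) he

theorem mem_leftVerts {w : Hat P} : w ∈ H.leftVerts F ↔ ∃ e ∈ B.left, w = e.bot ∨ w = e.top := by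
  simp only [leftVerts, mem_ofPred_eq, B.mem_left]

theorem mem_rightVerts {w : Hat P} :
    w ∈ H.rightVerts F ↔ ∃ e ∈ B.right, w = e.bot ∨ w = e.top := by
  simp only [rightVerts, mem_ofPred_eq, B.mem_right]

theorem min_mem_leftVerts : B.min ∈ H.leftVerts F := by
  obtain ⟨e, he, heq⟩ := B.path_left.exists_bot B.left_ne_nil
  exact B.mem_leftVerts.2 ⟨e, he, Or.inl heq.symm⟩

theorem max_mem_leftVerts : B.max ∈ H.leftVerts F := by
  obtain ⟨e, he, heq⟩ := B.path_left.exists_top B.left_ne_nil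
  exact B.mem_leftVerts.2 ⟨e, he, Or.inr heq.symm⟩

theorem min_le_and_le_max {w : Hat P} (hw : w ∈ H.verts F) : B.min ≤ w ∧ w ≤ B.max := by
  rcases hw with hw | hw
  · obtain ⟨e, he, h⟩ := B.mem_leftVerts.1 hw
    obtain ⟨h1, h2⟩ := bounds B.path_left he
    have h3 := e.bot_lt_top.le
    rcases h with rfl | rfl
    exacts [⟨h2, h3.trans h1⟩, ⟨h2.trans h3, h1⟩]
  · obtain ⟨e, he, h⟩ := B.mem_rightVerts.1 hw
    obtain ⟨h1, h2⟩ := bounds B.path_right he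
    have h3 := e.bot_lt_top.le
    rcases h with rfl | rfl
    exacts [⟨h2, h3.trans h1⟩, ⟨h2.trans h3, h1⟩]

theorem isLeast_min : IsLeast (H.verts F) B.min :=
  ⟨Or.inl B.min_mem_leftVerts, fun _ hw => (B.min_le_and_le_max hw).1⟩

theorem isGreatest_max : IsGreatest (H.verts F) B.max :=
  ⟨Or.inl B.max_mem_leftVerts, fun _ hw => (B.min_le_and_le_max hw).2⟩

theorem minVert_eq : H.minVert F = B.min :=
  (Classical.epsilon_spec (p := fun w => IsLeast (H.verts F) w) ⟨_, B.isLeast_min⟩).unique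
    B.isLeast_min

theorem maxVert_eq : H.maxVert F = B.max :=
  (Classical.epsilon_spec (p := fun w => IsGreatest (H.verts F) w) ⟨_, B.isGreatest_max⟩).unique
    B.isGreatest_max

theorem leftmost_notMem_left {M : MarkedPoset P} (h : ¬ H.LeftMarked M F) :
    .leftmost ∉ B.left := fun h' =>
  h ⟨⊥, B.mem_leftVerts.2 ⟨_, h', Or.inl rfl⟩, Or.inl rfl⟩

theorem rightmost_notMem_right {M : MarkedPoset P} (h : ¬ H.LeftMarked M F) :
    .rightmost ∉ B.right := fun h' => by
  have h1 := B.path_right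
  rw [B.right_eq_of_rightmost_mem h'] at h1
  exact h ⟨⊥, (show B.min = ⊥ from h1.2.symm) ▸ B.min_mem_leftVerts, Or.inl rfl⟩

end FaceBoundary

/-- Between two edges with the same upper endpoint `w`, the face to the right of the first one has
maximum `w`, and the uppermost edge of its right boundary ends at `w`, too. -/
theorem exists_next_edge {e e' : HasseEdge P} (htop : e.top = e'.top) {t : ℝ}
    (ht : t ∈ H.openDom (.hasse e)) (ht' : t ∈ H.openDom (.hasse e'))
    (hlt : H.arc (.hasse e) t < H.arc (.hasse e') t)
    (B : H.FaceBoundary (H.rightFace (.hasse e))) : B.max = e.top ∧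
    ∃ e'' : HasseEdge P, H.leftFace (.hasse e'') = H.rightFace (.hasse e) ∧ e''.top = e.top ∧
      (t ∈ H.openDom (.hasse e'') → H.arc (.hasse e) t < H.arc (.hasse e'') t) := by
  have hdom := Ioo_subset_Icc_self ht
  have hU := B.U_eqOn rfl
  have hsub := B.openDom_subset_of_rightFace rfl
  obtain ⟨g, hg, hge⟩ := exists_isPath (H := H) (.hasse e')
  -- At height `t` the path through `e'` is to the right of `e`. So the right boundary of the face
  -- is squeezed between `e` and `e'` and has to close at their common top.
  have hWg : B.W ≤ g := by
    refine (B.gap.le_or_le g hg).resolve_left fun h => ?_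
    have h1 := h t
    rw [hge (Ioo_subset_Icc_self ht'), hU hdom] at h1
    exact h1.not_gt hlt
  have hedge := H.y_bot_lt_y_top (.hasse e)
  have htopmem : H.y e.top ∈ H.dom (.hasse e) := ⟨hedge.le, le_rfl⟩
  have hUw : B.U (H.y e.top) = H.x e.top := (hU htopmem).trans (H.arc_top (.hasse e))
  have hWw : B.W (H.y e.top) ≤ H.x e.top := by
    have h1 : g (H.y e'.top) = H.x e'.top :=
      (hge ⟨(H.y_bot_lt_y_top (.hasse e')).le, le_rfl⟩).trans (H.arc_top (.hasse e'))
    rw [htop, ← h1]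
    exact hWg _
  have hmax : B.max = e.top := by
    obtain ⟨h1, h2⟩ := (Ioo_subset_Ioo_iff hedge).1 hsub
    refine vertex_injective (le_antisymm (not_lt.1 fun h3 => ?_) h2) ?_
    · have := (B.lt_iff _).2 ⟨h1.trans_lt hedge, h3⟩
      rw [show (BoundedEdge.hasse e).top = e.top from rfl, hUw] at this
      exact this.not_ge hWw
    · have h3 : H.y B.max ≤ H.y e.top := by
        by_contra! h3
        have := (B.lt_iff _).2 ⟨h1.trans_lt hedge, h3⟩
        rw [show (BoundedEdge.hasse e).top = e.top from rfl, hUw] at this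
        exact this.not_ge hWw
      rw [← B.U_max, ← hUw, le_antisymm h3 h2]
  refine ⟨hmax, ?_⟩
  have hltUW := (B.lt_iff t).2 (hsub ht)
  obtain ⟨e'', he'', htop''⟩ := B.path_right.exists_top B.right_ne_nil
  rcases e'' with e'' | _ | _
  · have h1 := (B.mem_right _).1 he''
    refine ⟨e'', h1, htop''.trans hmax, fun ht'' => ?_⟩
    rwa [hU hdom, B.W_eqOn h1 (Ioo_subset_Icc_self ht'')] at hltUW
  · exact absurd he'' B.leftmost_notMem_right
  · exfalso
    have h1 := B.W_eqOn ((B.mem_right _).1 he'')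
    have hI := H.openDom_subset _ ht
    have h2 := hWg t
    rw [h1 (Ioo_subset_Icc_self hI), hge (Ioo_subset_Icc_self ht')] at h2
    exact h2.not_gt (H.lt_rightmost (.hasse e') (by simp) t ⟨hI, Ioo_subset_Icc_self ht'⟩)

/-! ### Potentials -/

theorem exists_downPath_of_le {a b : Hat P} (hab : a ≤ b) :
    ∃ l : List (HasseEdge P), DownPath HasseEdge.top HasseEdge.bot b l a := by
  induction b using WellFoundedLT.induction with
  | ind b ih =>
    rcases hab.eq_or_lt with rfl | hlt
    · exact ⟨[], rfl⟩
    · obtain ⟨c, hac, hcb⟩ := exists_le_covBy_of_lt hlt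
      obtain ⟨l, hl⟩ := ih c hcb.lt hac
      exact ⟨⟨(c, b), hcb⟩ :: l, rfl, hl⟩

/-- By induction, `v e` is the sum along every path to `⊥` that begins with the edge `e` below `w`.
Among the edges with a given `v`, the rightmost one just below `w` is the rightmost of all edges:
otherwise the face on its right yields, by `exists_next_edge` and the equality of the boundary sums,
an edge further right with the same `v`. Hence `v` is constant. -/
theorem sum_eq_sum_of_downPath {f : HasseEdge P → ℝ}
    (hf : ∀ F (B : H.FaceBoundary F) (l r : List (HasseEdge P)),
      DownPath HasseEdge.top HasseEdge.bot B.max l B.min →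
      (∀ e, e ∈ l ↔ H.rightFace (.hasse e) = F) →
      DownPath HasseEdge.top HasseEdge.bot B.max r B.min →
      (∀ e, e ∈ r ↔ H.leftFace (.hasse e) = F) → (l.map f).sum = (r.map f).sum) (w : Hat P) :
    ∀ l l' : List (HasseEdge P), DownPath HasseEdge.top HasseEdge.bot w l ⊥ →
      DownPath HasseEdge.top HasseEdge.bot w l' ⊥ → (l.map f).sum = (l'.map f).sum := by
  induction w using WellFoundedLT.induction with
  | ind w ih =>
    choose p hp using fun v : Hat P => exists_downPath_of_le (bot_le (a := v))
    set v : HasseEdge P → ℝ := fun e => f e + ((p e.bot).map f).sum with hv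
    have hvl : ∀ e l, e.top = w → DownPath HasseEdge.top HasseEdge.bot e.bot l ⊥ →
        f e + (l.map f).sum = v e := by
      intro e l he hl
      rw [hv]
      simp only
      rw [ih e.bot (he ▸ e.2.lt) l _ hl (hp _)]
    -- A height `t` that all edges with top `w` pass, so that they can be compared from left to
    -- right.
    obtain ⟨t, ht, htw⟩ : ∃ t, (∀ e : HasseEdge P, e.top = w → H.y e.bot < t) ∧ t < H.y w := by
      have h1 : ∀ᶠ t in 𝓝[<] (H.y w), ∀ e : HasseEdge P, e.top = w → H.y e.bot < t := by
        rw [eventually_all]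
        intro e
        by_cases he : e.top = w
        · have : H.y e.bot < H.y w := he ▸ H.y_strictMono e.2.lt
          filter_upwards [Ioo_mem_nhdsLT this] with t ht _ using ht.1
        · exact Eventually.of_forall fun t h => absurd h he
      exact (h1.and self_mem_nhdsWithin).exists
    have hdom : ∀ e : HasseEdge P, e.top = w → t ∈ H.openDom (.hasse e) := fun e he =>
      ⟨ht e he, (show (BoundedEdge.hasse e).top = w from he) ▸ htw⟩
    have hmax : ∀ e : HasseEdge P, e.top = w → ∃ e₁ : HasseEdge P, e₁.top = w ∧ v e₁ = v e ∧
        ∀ e₂ : HasseEdge P, e₂.top = w → H.arc (.hasse e₂) t ≤ H.arc (.hasse e₁) t := by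
      intro e he
      obtain ⟨e₁, ⟨h1, h2⟩, h3⟩ := Set.exists_max_image {e₁ : HasseEdge P | e₁.top = w ∧ v e₁ = v e}
        (fun e₁ => H.arc (.hasse e₁) t) (toFinite _) ⟨e, he, rfl⟩
      refine ⟨e₁, h1, h2, fun e₂ he₂ => not_lt.1 fun hlt => ?_⟩
      obtain ⟨B⟩ := (isFace_rightFace (H := H) (e := .hasse e₁) (by simp)).exists_boundary
      obtain ⟨hM, e₃, h4, h5, h6⟩ :=
        exists_next_edge (h1.trans he₂.symm) (hdom _ h1) (hdom _ he₂) hlt B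
      obtain ⟨l, hl, hl'⟩ := B.exists_left_of_rightFace rfl
      obtain ⟨r, hr, hr'⟩ := B.exists_right_of_leftFace h4
      have hsum := hf _ B l r hl hl' hr hr'
      -- The maximum of the face is `w`, so a boundary chain that contains an edge with top `w`
      -- begins with it. Prolonged below the face, the chain computes `v`.
      have key : ∀ (e₄ : HasseEdge P) (l : List (HasseEdge P)), e₄.top = w → e₄ ∈ l →
          DownPath HasseEdge.top HasseEdge.bot B.max l B.min →
          v e₄ = (l.map f).sum + ((p B.min).map f).sum := by
        intro e₄ l he₄ hmem hl
        cases l with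
        | nil => simp at hmem
        | cons e₅ l =>
          have h7 : e₄ = e₅ := by
            rcases List.mem_cons.1 hmem with h7 | h7
            · exact h7
            · have h8 := (hl.2.le_top_bot_le (k := OrderDual.toDual) (fun e _ => e.2.lt) h7).1
              have h9 : e₅.bot < e₅.top := e₅.2.lt
              rw [hl.1, hM, h1, ← he₄] at h9
              exact absurd h9 (not_lt_of_ge h8)
          subst h7
          rw [← hvl e₄ _ he₄ (hl.2.append (hp B.min)), List.map_append, List.sum_append,
            List.map_cons, List.sum_cons, add_assoc]
      have h7 : v e₃ = v e₁ := by
        rw [key e₁ l h1 ((hl' _).2 rfl) hl, key e₃ r (h5.trans h1) ((hr' _).2 h4) hr, hsum]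
      have h8 := h3 e₃ ⟨h5.trans h1, h7.trans h2⟩
      exact h8.not_gt (h6 (hdom _ (h5.trans h1)))
    intro l l' hl hl'
    cases l with
    | nil =>
      cases l' with
      | nil => rfl
      | cons e' l' =>
        have h1 : e'.bot < e'.top := e'.2.lt
        rw [hl'.1, show w = ⊥ from hl] at h1
        exact absurd h1 not_lt_bot
    | cons e l =>
      cases l' with
      | nil =>
        have h1 : e.bot < e.top := e.2.lt
        rw [hl.1, show w = ⊥ from hl'] at h1
        exact absurd h1 not_lt_bot
      | cons e' l' =>
        obtain ⟨e₁, h1, h2, h3⟩ := hmax e hl.1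
        obtain ⟨e₂, h4, h5, h6⟩ := hmax e' hl'.1
        have h7 : BoundedEdge.hasse e₁ = .hasse e₂ := edge_eq_of_meet (hdom e₁ h1)
          (Ioo_subset_Icc_self (hdom e₂ h4)) (le_antisymm (h6 e₁ h1) (h3 e₂ h4))
        cases h7
        rw [List.map_cons, List.map_cons, List.sum_cons, List.sum_cons, hvl e l hl.1 hl.2,
          hvl e' l' hl'.1 hl'.2, ← h2, ← h5]

theorem exists_potential {f : HasseEdge P → ℝ}
    (hf : ∀ F (B : H.FaceBoundary F) (l r : List (HasseEdge P)),
      DownPath HasseEdge.top HasseEdge.bot B.max l B.min →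
      (∀ e, e ∈ l ↔ H.rightFace (.hasse e) = F) →
      DownPath HasseEdge.top HasseEdge.bot B.max r B.min →
      (∀ e, e ∈ r ↔ H.leftFace (.hasse e) = F) → (l.map f).sum = (r.map f).sum) (lo : ℝ) :
    ∃ X : Hat P → ℝ, X ⊥ = lo ∧ ∀ e : HasseEdge P, X e.top - X e.bot = f e := by
  choose p hp using fun v : Hat P => exists_downPath_of_le (bot_le (a := v))
  refine ⟨fun w => lo + ((p w).map f).sum, ?_, fun e => ?_⟩
  · simp only
    rw [sum_eq_sum_of_downPath hf ⊥ _ [] (hp ⊥) rfl]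
    simp
  · simp only
    rw [sum_eq_sum_of_downPath hf e.top _ (e :: p e.bot) (hp _) ⟨rfl, hp _⟩, List.map_cons,
      List.sum_cons]
    ring

end BoundedEmbedding

/-! ### Blocks of a path between consecutive marked vertices -/

section Block

variable {V E : Type*} {top bot : E → V} {Mk : V → Prop}

/-- Cut after the first edge whose lower end is marked. -/
theorem DownPath.exists_first_block {a m : V} {l : List E} (h : DownPath top bot a l m)
    (hm : Mk m) (hl : l ≠ []) : ∃ l₁ l₂ v, l = l₁ ++ l₂ ∧ l₁ ≠ [] ∧ DownPath top bot a l₁ v ∧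
      DownPath top bot v l₂ m ∧ Mk v ∧ ∀ e ∈ l₁, bot e = v ∨ ¬ Mk (bot e) := by
  induction l generalizing a with
  | nil => exact absurd rfl hl
  | cons e l ih =>
    by_cases he : Mk (bot e)
    · exact ⟨[e], l, bot e, rfl, by simp, ⟨h.1, rfl⟩, h.2, he, by simp⟩
    · have hl : l ≠ [] := by
        rintro rfl
        exact he ((show bot e = m from h.2) ▸ hm)
      obtain ⟨l₁, l₂, v, rfl, -, h1, h2, h3, h4⟩ := ih h.2 hl
      refine ⟨e :: l₁, l₂, v, rfl, by simp, ⟨h.1, h1⟩, h2, h3, fun e' he' => ?_⟩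
      rcases List.mem_cons.1 he' with rfl | he'
      · exact Or.inr he
      · exact h4 e' he'

theorem DownPath.exists_block {a m : V} {l : List E} (h : DownPath top bot a l m)
    (ha : Mk a) (hm : Mk m) {e : E} (he : e ∈ l) : ∃ l₀ l₁ l₂ u v, l = l₀ ++ l₁ ++ l₂ ∧
      DownPath top bot a l₀ u ∧ DownPath top bot u l₁ v ∧ DownPath top bot v l₂ m ∧ e ∈ l₁ ∧
      Mk u ∧ Mk v ∧ ∀ e ∈ l₁, bot e = v ∨ ¬ Mk (bot e) := by
  induction hn : l.length using Nat.strong_induction_on generalizing l a with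
  | _ n ih =>
    obtain ⟨l₁, l₂, v, rfl, h0, h1, h2, h3, h4⟩ :=
      h.exists_first_block hm (List.ne_nil_of_mem he)
    rcases List.mem_append.1 he with he | he
    · exact ⟨[], l₁, l₂, a, v, rfl, rfl, h1, h2, he, ha, h3, h4⟩
    · have hlt : l₂.length < n := by
        have := List.length_pos_iff.2 h0
        rw [← hn, List.length_append]
        omega
      obtain ⟨l₃, l₄, l₅, u, w, rfl, h5, h6⟩ := ih _ hlt h2 h3 he rfl
      exact ⟨l₁ ++ l₃, l₄, l₅, u, w, by simp, h1.append h5, h6⟩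

end Block

/-! ### The map `Γ` -/

namespace MarkedPoset

variable {P : Type u} [PartialOrder P] (M : MarkedPoset P)

/-- The points of `ℝ^P` with the given marking that increase along a family of edges of
`P ⊔ {0̂, 1̂}`. -/
def edgePolytope {E : Type*} (top bot : E → Hat P) : Set (P → ℝ) :=
  {x | (∀ e, M.extend x (bot e) ≤ M.extend x (top e)) ∧ ∀ a : M.A, x a = M.mark a}

/-- The differences along a family of edges of `P ⊔ {0̂, 1̂}`. -/
noncomputable def edgeMap {E : Type*} (top bot : E → Hat P) (x : P → ℝ) (e : E) : ℝ :=
  M.extend x (top e) - M.extend x (bot e)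

variable {M}

theorem hatMark_toHat (a : M.A) : M.hatMark (toHat a) = M.mark a := by
  classical
  change (if h : (a : P) ∈ M.A then M.mark ⟨a, h⟩ else 0) = M.mark a
  rw [dif_pos a.2]

theorem extend_eq_hatMark {x : P → ℝ} (hx : ∀ a : M.A, x a = M.mark a) {w : Hat P}
    (hw : M.Marked w) : M.extend x w = M.hatMark w := by
  rcases hw with rfl | rfl | ⟨p, hp, rfl⟩
  · rfl
  · rfl
  · exact (hx ⟨p, hp⟩).trans (hatMark_toHat ⟨p, hp⟩).symm

variable [Finite P]

theorem iInf_le_apply {x : P → ℝ} (hx : x ∈ M.orderPolytope (· < ·)) (p : P) :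
    ⨅ a, M.mark a ≤ x p := by
  obtain ⟨q, hqp, hq⟩ := exists_minimal_le_of_wellFoundedLT (fun _ : P => True) p trivial
  have hqA : q ∈ M.A := M.isMin_mem q fun r hr => hq.2 trivial hr
  have h1 : ⨅ a, M.mark a ≤ x q := by
    rw [hx.2 ⟨q, hqA⟩]
    exact ciInf_le (Set.finite_range _).bddBelow _
  rcases hqp.eq_or_lt with rfl | h
  · exact h1
  · exact h1.trans (hx.1 _ _ h)

theorem apply_le_iSup {x : P → ℝ} (hx : x ∈ M.orderPolytope (· < ·)) (p : P) :
    x p ≤ ⨆ a, M.mark a := by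
  obtain ⟨q, hqp, hq⟩ := exists_maximal_ge_of_wellFoundedGT (fun _ : P => True) p trivial
  have hqA : q ∈ M.A := M.isMax_mem q fun r hr => hq.2 trivial hr
  have h1 : x q ≤ ⨆ a, M.mark a := by
    rw [hx.2 ⟨q, hqA⟩]
    exact le_ciSup (Set.finite_range _).bddAbove _
  rcases hqp.eq_or_lt with rfl | h
  · exact h1
  · exact (hx.1 _ _ h).trans h1

theorem iInf_le_iSup [Nonempty P] : ⨅ a, M.mark a ≤ ⨆ a, M.mark a := by
  obtain ⟨p⟩ := ‹Nonempty P›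
  obtain ⟨q, -, hq⟩ := exists_minimal_le_of_wellFoundedLT (fun _ : P => True) p trivial
  have hqA : q ∈ M.A := M.isMin_mem q fun r hr => hq.2 trivial hr
  exact (ciInf_le (Set.finite_range _).bddBelow ⟨q, hqA⟩).trans
    (le_ciSup (Set.finite_range _).bddAbove _)

/-- If the order generated by some edges of `P ⊔ {0̂, 1̂}` refines the order of `P`, then it suffices
to compare the coordinates along these edges. -/
theorem edgePolytope_eq_orderPolytope [Nonempty P] {E : Type*} {top bot : E → Hat P}
    (hne : ∀ e, bot e ≠ ⊤ ∧ top e ≠ ⊥)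
    (hlt : ∀ p q : P, p < q →
      Relation.TransGen (fun a b => ∃ e, bot e = a ∧ top e = b) (toHat p) (toHat q)) :
    M.edgePolytope top bot = M.orderPolytope fun p q =>
      Relation.TransGen (fun a b => ∃ e, bot e = a ∧ top e = b) (toHat p) (toHat q) := by
  ext x
  refine and_congr_left fun hx => ⟨fun h p q hpq => ?_, fun h e => ?_⟩
  · have key : ∀ v w, Relation.TransGen (fun a b => ∃ e, bot e = a ∧ top e = b) v w →
        M.extend x v ≤ M.extend x w := by
      intro v w hvw
      induction hvw with
      | single h' => obtain ⟨e, rfl, rfl⟩ := h'; exact h e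
      | tail _ h' ih => obtain ⟨e, rfl, rfl⟩ := h'; exact ih.trans (h e)
    exact key _ _ hpq
  · have hx' : x ∈ M.orderPolytope (· < ·) := ⟨fun p q hpq => h p q (hlt p q hpq), hx⟩
    obtain ⟨h1, h2⟩ := hne e
    have h3 := fun p q (hp : bot e = toHat p) (hq : top e = toHat q) =>
      h p q (Relation.TransGen.single ⟨e, hp, hq⟩)
    generalize bot e = v at *
    generalize top e = w at *
    rcases v with _ | _ | p <;> rcases w with _ | _ | q
    · exact absurd rfl h2
    · exact iInf_le_iSup
    · exact iInf_le_apply hx' q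
    · exact absurd rfl h1
    · exact absurd rfl h1
    · exact absurd rfl h1
    · exact absurd rfl h2
    · exact apply_le_iSup hx' p
    · exact h3 p q rfl rfl

/-- Increments along a path from `⊥` add up to the value at its upper end, and the value at `⊥`
depends on the marking only. -/
theorem Gam_injective : Function.Injective M.Gam := by
  intro x x' h
  have key : ∀ w, M.extend x w = M.extend x' w := by
    intro w
    obtain ⟨l, hl⟩ := BoundedEmbedding.exists_downPath_of_le (bot_le (a := w))
    have h1 := hl.sum_sub (M.extend x)
    have h2 := hl.sum_sub (M.extend x')
    have h3 : (l.map fun e => M.extend x e.top - M.extend x e.bot) =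
        l.map fun e => M.extend x' e.top - M.extend x' e.bot :=
      List.map_congr_left fun e _ => congrFun h e
    rw [h3, h2] at h1
    have h4 : M.extend x ⊥ = M.extend x' ⊥ := rfl
    linarith
  exact funext fun p => key (toHat p)

end MarkedPoset

/-! ### Flows -/

theorem sum_filter_eq_sum_list {E : Type*} [Fintype E] {p : E → Prop} [DecidablePred p]
    {l : List E} (hl : l.Nodup) (h : ∀ e, e ∈ l ↔ p e) (f : E → ℝ) :
    ∑ e with p e, f e = (l.map f).sum := by
  classical
  rw [← List.sum_toFinset f hl]
  exact Finset.sum_congr (by ext e; simp [h]) fun _ _ => rfl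

namespace FlowNetwork

variable {V : Type u} {N : FlowNetwork V} {f : N.E → ℝ}

theorem sum_list_of_mem_flowPolytope (hf : f ∈ N.flowPolytope) {w : V} {o i : List N.E}
    (ho : o.Nodup) (ho' : ∀ e, e ∈ o ↔ N.tail e = w) (hi : i.Nodup)
    (hi' : ∀ e, e ∈ i ↔ N.head e = w) (hw : ∃ e, N.tail e = w ∨ N.head e = w) :
    (o.map f).sum - (i.map f).sum = N.netflow w := by
  classical
  rw [← hf.2 w hw, sum_filter_eq_sum_list ho ho', sum_filter_eq_sum_list hi hi']

theorem mem_flowPolytope_of_sum_list (h₀ : ∀ e, 0 ≤ f e)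
    (h : ∀ w, (∃ e, N.tail e = w ∨ N.head e = w) → ∃ o i : List N.E, o.Nodup ∧
      (∀ e, e ∈ o ↔ N.tail e = w) ∧ i.Nodup ∧ (∀ e, e ∈ i ↔ N.head e = w) ∧
      (o.map f).sum - (i.map f).sum = N.netflow w) : f ∈ N.flowPolytope := by
  classical
  refine ⟨h₀, fun w hw => ?_⟩
  obtain ⟨o, i, ho, ho', hi, hi', heq⟩ := h w hw
  rw [← heq, sum_filter_eq_sum_list ho ho', sum_filter_eq_sum_list hi hi']

end FlowNetwork

/-! ### The image of `Γ` is the flow polytope -/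

namespace BoundedEmbedding

variable {P : Type u} [PartialOrder P] [Finite P] {H : BoundedEmbedding P} {M : MarkedPoset P}
  {F : Set (ℝ × ℝ)}

theorem hasse_nodup {a b : Hat P} {l : List (HasseEdge P)}
    (h : DownPath HasseEdge.top HasseEdge.bot a l b) : l.Nodup :=
  (List.nodup_cons.1 (h.nodup (k := OrderDual.toDual) fun e _ => e.2.lt)).2.of_map

theorem hasse_bounds {a b : Hat P} {l : List (HasseEdge P)}
    (h : DownPath HasseEdge.top HasseEdge.bot a l b) {e : HasseEdge P} (he : e ∈ l) :
    e.top ≤ a ∧ b ≤ e.bot :=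
  h.le_top_bot_le (k := OrderDual.toDual) (fun e _ => e.2.lt) he

theorem hasse_le {a b : Hat P} {l : List (HasseEdge P)}
    (h : DownPath HasseEdge.top HasseEdge.bot a l b) : b ≤ a :=
  h.le (k := OrderDual.toDual) (fun e _ => e.2.lt)

theorem tail_eq_inner_iff {e : HasseEdge P} (hF : ¬ H.LeftMarked M F) :
    (H.network M).tail e = .inner F ↔ H.rightFace (.hasse e) = F := by
  simp only [network]
  split_ifs with h
  · simp only [false_iff]
    rintro rfl
    exact hF h
  · simp

theorem head_eq_inner_iff {e : HasseEdge P} (hF : ¬ H.LeftMarked M F) :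
    (H.network M).head e = .inner F ↔ H.leftFace (.hasse e) = F := by
  simp only [network]
  split_ifs with h
  · simp only [false_iff]
    rintro rfl
    exact hF h
  · simp

theorem head_eq_sink_iff {e : HasseEdge P} (hF : H.LeftMarked M F) :
    (H.network M).head e = .sink F ↔ H.leftFace (.hasse e) = F := by
  simp only [network]
  split_ifs with h
  · simp
  · simp only [false_iff]
    rintro rfl
    exact h hF

theorem tail_ne_sink (e : HasseEdge P) : (H.network M).tail e ≠ .sink F := by
  simp only [network]
  split_ifs <;> simp

theorem head_ne_source (e : HasseEdge P) (a b : Hat P) :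
    (H.network M).head e ≠ .source F a b := by
  simp only [network]
  split_ifs <;> simp

theorem tail_eq_source_iff {e : HasseEdge P} {a b : Hat P} :
    (H.network M).tail e = .source F a b ↔ H.rightFace (.hasse e) = F ∧ H.LeftMarked M F ∧
      H.markBelow M F e = a ∧ H.markAbove M F e = b := by
  simp only [network]
  split_ifs with h
  · simp only [NetVertex.source.injEq]
    constructor
    · rintro ⟨rfl, h1, h2⟩
      exact ⟨rfl, h, h1, h2⟩
    · rintro ⟨rfl, -, h1, h2⟩
      exact ⟨rfl, h1, h2⟩
  · simp only [false_iff, not_and]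
    rintro rfl h'
    exact absurd h' h

namespace FaceBoundary

variable (B : H.FaceBoundary F) {l : List (HasseEdge P)}

theorem mem_leftVerts_iff (hl : DownPath HasseEdge.top HasseEdge.bot B.max l B.min)
    (hl' : ∀ e, e ∈ l ↔ H.rightFace (.hasse e) = F) {e : HasseEdge P} (he : e ∈ l) {w : Hat P} :
    w ∈ H.leftVerts F ↔ w = B.max ∨ ∃ e ∈ l, w = e.bot := by
  constructor
  · rintro ⟨e' | _ | _, h1, h2⟩
    · have h3 := (hl' _).2 h1
      rcases h2 with rfl | rfl
      · exact Or.inr ⟨e', h3, rfl⟩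
      · rcases hl.top_eq_or h3 with h4 | ⟨e'', h4, h5⟩
        · exact Or.inl h4
        · exact Or.inr ⟨e'', h4, h5.symm⟩
    · have h3 := B.left_eq_of_leftmost_mem ((B.mem_left _).2 h1)
      have h4 := (B.mem_left _).2 ((hl' e).1 he)
      rw [h3] at h4
      simp at h4
    · exact absurd ((B.mem_left _).2 h1) B.rightmost_notMem_left
  · rintro (rfl | ⟨e', h1, rfl⟩)
    · exact B.max_mem_leftVerts
    · exact ⟨_, (hl' _).1 h1, Or.inl rfl⟩

/-- The edges on the left boundary of a face between two consecutive marked elements. -/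
theorem exists_fiber (hmk : H.LeftMarked M F) (hmin : M.Marked B.min) (hmax : M.Marked B.max)
    (hl : DownPath HasseEdge.top HasseEdge.bot B.max l B.min)
    (hl' : ∀ e, e ∈ l ↔ H.rightFace (.hasse e) = F) {e : HasseEdge P} (he : e ∈ l) :
    ∃ l₁, DownPath HasseEdge.top HasseEdge.bot (H.markAbove M F e) l₁ (H.markBelow M F e) ∧
      (∀ e', e' ∈ l₁ ↔ (H.network M).tail e' = (H.network M).tail e) ∧
      M.Marked (H.markBelow M F e) ∧ M.Marked (H.markAbove M F e) ∧
      H.markBelow M F e ≤ e.bot ∧ e.top ≤ H.markAbove M F e ∧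
      ∀ w ∈ H.leftVerts F, M.Marked w → e.top ≤ w → H.markAbove M F e ≤ w := by
  -- All edges of one block between marked vertices have the same nearest marked vertices `v` below
  -- and `u` above.
  have spec : ∀ e ∈ l, ∃ l₀ l₁ l₂ u v, l = l₀ ++ l₁ ++ l₂ ∧
      DownPath HasseEdge.top HasseEdge.bot B.max l₀ u ∧
      DownPath HasseEdge.top HasseEdge.bot u l₁ v ∧
      DownPath HasseEdge.top HasseEdge.bot v l₂ B.min ∧ e ∈ l₁ ∧
      ∀ e ∈ l₁, IsGreatest {w | w ∈ H.leftVerts F ∧ M.Marked w ∧ w ≤ e.bot} v ∧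
        IsLeast {w | w ∈ H.leftVerts F ∧ M.Marked w ∧ e.top ≤ w} u := by
    intro e he
    obtain ⟨l₀, l₁, l₂, u, v, rfl, h1, h2, h3, h4, h5, h6, h7⟩ := hl.exists_block hmax hmin he
    refine ⟨l₀, l₁, l₂, u, v, rfl, h1, h2, h3, h4, fun e he => ?_⟩
    have hle : e.top ≤ u := (hasse_bounds h2 he).1
    have hle' : v ≤ e.bot := (hasse_bounds h2 he).2
    have hlt : e.bot < e.top := e.2.lt
    have hmem : ∀ w, w ∈ H.leftVerts F → M.Marked w → u ≤ w ∨ w ≤ v := by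
      intro w hw hMw
      rcases (B.mem_leftVerts_iff hl hl' ‹_›).1 hw with rfl | ⟨e', he', rfl⟩
      · exact Or.inl (hasse_le h1)
      · rcases List.mem_append.1 he' with he' | he'
        · rcases List.mem_append.1 he' with he' | he'
          · exact Or.inl (hasse_bounds h1 he').2
          · exact Or.inr ((h7 e' he').resolve_right fun h => h hMw).le
        · have h8 : e'.bot < e'.top := e'.2.lt
          exact Or.inr (h8.le.trans (hasse_bounds h3 he').1)
    have hu : u ∈ H.leftVerts F := by
      rw [B.mem_leftVerts_iff hl hl' ‹_›]
      by_cases hnil : l₀ = []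
      · subst hnil
        exact Or.inl (show B.max = u from h1).symm
      · obtain ⟨e', he', rfl⟩ := h1.exists_bot hnil
        exact Or.inr ⟨e', by simp [he'], rfl⟩
    have hv : v ∈ H.leftVerts F := by
      rw [B.mem_leftVerts_iff hl hl' ‹_›]
      obtain ⟨e', he', rfl⟩ := h2.exists_bot (List.ne_nil_of_mem he)
      exact Or.inr ⟨e', by simp [he'], rfl⟩
    refine ⟨⟨⟨hv, h6, hle'⟩, fun w hw => ?_⟩, ⟨⟨hu, h5, hle⟩, fun w hw => ?_⟩⟩
    · exact (hmem w hw.1 hw.2.1).resolve_left fun h =>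
        ((hle.trans h).trans hw.2.2).not_gt hlt
    · exact (hmem w hw.1 hw.2.1).resolve_right fun h =>
        ((hw.2.2.trans h).trans hle').not_gt hlt
  have spec' : ∀ e ∈ l, ∀ v, IsGreatest {w | w ∈ H.leftVerts F ∧ M.Marked w ∧ w ≤ e.bot} v →
      H.markBelow M F e = v := fun e _ v hv =>
    (Classical.epsilon_spec (p := fun w => IsGreatest
      {w | w ∈ H.leftVerts F ∧ M.Marked w ∧ w ≤ e.bot} w) ⟨v, hv⟩).unique hv
  have spec'' : ∀ e ∈ l, ∀ v, IsLeast {w | w ∈ H.leftVerts F ∧ M.Marked w ∧ e.top ≤ w} v →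
      H.markAbove M F e = v := fun e _ v hv =>
    (Classical.epsilon_spec (p := fun w => IsLeast
      {w | w ∈ H.leftVerts F ∧ M.Marked w ∧ e.top ≤ w} w) ⟨v, hv⟩).unique hv
  obtain ⟨l₀, l₁, l₂, u, v, heq, h1, h2, h3, h4, h5⟩ := spec e he
  have hmem₁ : ∀ e ∈ l₁, e ∈ l := fun e he => by simp [heq, he]
  have hv := spec' e he v (h5 e h4).1
  have hu := spec'' e he u (h5 e h4).2
  refine ⟨l₁, by rwa [hu, hv], fun e' => ?_, ?_⟩
  · have htail : (H.network M).tail e = .source F v u :=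
      tail_eq_source_iff.2 ⟨(hl' e).1 he, hmk, hv, hu⟩
    rw [htail, tail_eq_source_iff]
    constructor
    · intro he'
      exact ⟨(hl' _).1 (hmem₁ e' he'), hmk, spec' e' (hmem₁ e' he') v (h5 e' he').1,
        spec'' e' (hmem₁ e' he') u (h5 e' he').2⟩
    -- Conversely, an edge with the same nearest marked vertices lies between `v` and `u`, so it is
    -- in neither of the outer lists.
    · rintro ⟨h6, -, h7, h8⟩
      have he' := (hl' _).2 h6
      obtain ⟨l₀', l₁', l₂', u', v', -, -, -, -, h9, h10⟩ := spec e' he'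
      have h11 := spec' e' he' v' (h10 e' h9).1
      have h12 := spec'' e' he' u' (h10 e' h9).2
      rw [h7] at h11
      rw [h8] at h12
      have h13 : v ≤ e'.bot := h11 ▸ (h10 e' h9).1.1.2.2
      have h14 : e'.top ≤ u := h12 ▸ (h10 e' h9).2.1.2.2
      have h15 : e'.bot < e'.top := e'.2.lt
      have h16 := he'
      rw [heq] at h16
      rcases List.mem_append.1 h16 with h16 | h16
      · rcases List.mem_append.1 h16 with h16 | h16
        · exact absurd (h14.trans (hasse_bounds h1 h16).2) h15.not_ge
        · exact h16
      · exact absurd ((hasse_bounds h3 h16).1.trans h13) h15.not_ge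
  · rw [hu, hv]
    obtain ⟨h6, h7⟩ := h5 e h4
    exact ⟨h6.1.2.1, h7.1.2.1, h6.1.2.2, h7.1.2.2, fun w hw hMw hle => h7.2 ⟨hw, hMw, hle⟩⟩

end FaceBoundary

theorem FaceBoundary.marked (B : H.FaceBoundary F) (hH : H.IsStronglyPlanar M)
    (hF : H.LeftMarked M F) : M.Marked B.min ∧ M.Marked B.max := by
  have h := hH F (B.eq_between ▸ B.gap.isFace) hF
  exact ⟨h.1 _ B.isLeast_min, h.2 _ B.isGreatest_max⟩

/-- Increments telescope along each boundary list. Both boundaries of a face give the same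
difference; at sinks and sources the ends of the lists are marked, by strong planarity and by the
choice of the blocks. -/
theorem Gam_mem_flowPolytope (hH : H.IsStronglyPlanar M) {x : P → ℝ}
    (hx : x ∈ M.edgePolytope HasseEdge.top HasseEdge.bot) :
    M.Gam x ∈ (H.network M).flowPolytope := by
  refine FlowNetwork.mem_flowPolytope_of_sum_list (fun e => sub_nonneg.2 (hx.1 e)) fun w hw => ?_
  have hsum : ∀ {l : List (HasseEdge P)} {a b : Hat P},
      DownPath HasseEdge.top HasseEdge.bot a l b →
      (l.map (M.Gam x)).sum = M.extend x a - M.extend x b := fun hl => hl.sum_sub (M.extend x)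
  rcases w with F | F | ⟨F, a, b⟩
  · have hF : ¬ H.LeftMarked M F ∧ H.IsFace F := by
      obtain ⟨e, he | he⟩ := hw
      · simp only [network] at he
        split_ifs at he with h
        cases he
        exact ⟨h, isFace_rightFace (by simp)⟩
      · simp only [network] at he
        split_ifs at he with h
        cases he
        exact ⟨h, isFace_leftFace (by simp)⟩
    obtain ⟨B⟩ := hF.2.exists_boundary
    obtain ⟨l, hl, hl'⟩ := B.exists_left (B.leftmost_notMem_left hF.1)
    obtain ⟨r, hr, hr'⟩ := B.exists_right (B.rightmost_notMem_right hF.1)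
    refine ⟨l, r, hasse_nodup hl, fun e => (hl' e).trans (tail_eq_inner_iff hF.1).symm,
      hasse_nodup hr, fun e => (hr' e).trans (head_eq_inner_iff hF.1).symm, ?_⟩
    exact ((congrArg₂ _ (hsum hl) (hsum hr)).trans (sub_self _))
  · obtain ⟨e, he⟩ : ∃ e, (H.network M).head e = .sink F := by
      obtain ⟨e, he | he⟩ := hw
      · exact absurd he (tail_ne_sink e)
      · exact ⟨e, he⟩
    have hF : H.LeftMarked M F ∧ H.leftFace (.hasse e) = F := by
      simp only [network] at he
      split_ifs at he with h
      cases he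
      exact ⟨h, rfl⟩
    obtain ⟨B⟩ := (isFace_leftFace (H := H) (e := .hasse e) (by simp)).exists_boundary
    rw [hF.2] at B
    obtain ⟨r, hr, hr'⟩ := B.exists_right_of_leftFace hF.2
    obtain ⟨hmin, hmax⟩ := B.marked hH hF.1
    refine ⟨[], r, List.nodup_nil, fun e => iff_of_false List.not_mem_nil (tail_ne_sink e),
      hasse_nodup hr, fun e => (hr' e).trans (head_eq_sink_iff hF.1).symm, ?_⟩
    refine (congrArg _ (hsum hr)).trans ?_
    rw [MarkedPoset.extend_eq_hatMark hx.2 hmin, MarkedPoset.extend_eq_hatMark hx.2 hmax]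
    simp only [network, B.minVert_eq, B.maxVert_eq, List.map_nil, List.sum_nil, zero_sub]
  · obtain ⟨e, he⟩ : ∃ e, (H.network M).tail e = .source F a b := by
      obtain ⟨e, he | he⟩ := hw
      · exact ⟨e, he⟩
      · exact absurd he (head_ne_source e a b)
    obtain ⟨hF, hmk, rfl, rfl⟩ := tail_eq_source_iff.1 he
    obtain ⟨B⟩ := (isFace_rightFace (H := H) (e := .hasse e) (by simp)).exists_boundary
    rw [hF] at B
    obtain ⟨l, hl, hl'⟩ := B.exists_left_of_rightFace hF
    obtain ⟨hmin, hmax⟩ := B.marked hH hmk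
    obtain ⟨l₁, h1, h2, h3, h4, -⟩ := B.exists_fiber hmk hmin hmax hl hl' ((hl' e).2 hF)
    refine ⟨l₁, [], hasse_nodup h1, fun e' => (h2 e').trans (by rw [he]), List.nodup_nil,
      fun e' => iff_of_false List.not_mem_nil (head_ne_source e' _ _), ?_⟩
    refine (congrArg (· - _) (hsum h1)).trans ?_
    rw [MarkedPoset.extend_eq_hatMark hx.2 h3, MarkedPoset.extend_eq_hatMark hx.2 h4]
    exact sub_zero _

theorem sum_fiber_eq {f : HasseEdge P → ℝ} (hf : f ∈ (H.network M).flowPolytope)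
    {l : List (HasseEdge P)} (hl' : ∀ e, e ∈ l ↔ H.rightFace (.hasse e) = F)
    (hmk : H.LeftMarked M F) {e : HasseEdge P} (he : e ∈ l) {l₁ : List (HasseEdge P)}
    (h₁ : DownPath HasseEdge.top HasseEdge.bot (H.markAbove M F e) l₁ (H.markBelow M F e))
    (h₂ : ∀ e', e' ∈ l₁ ↔ (H.network M).tail e' = (H.network M).tail e) :
    (l₁.map f).sum = M.hatMark (H.markAbove M F e) - M.hatMark (H.markBelow M F e) := by
  have htail : (H.network M).tail e = .source F (H.markBelow M F e) (H.markAbove M F e) :=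
    tail_eq_source_iff.2 ⟨(hl' e).1 he, hmk, rfl, rfl⟩
  rw [htail] at h₂
  have h3 := FlowNetwork.sum_list_of_mem_flowPolytope hf (o := l₁) (i := []) (hasse_nodup h₁) h₂
    List.nodup_nil (fun e' => iff_of_false List.not_mem_nil (head_ne_source e' _ _))
    ⟨e, Or.inl htail⟩
  exact (sub_zero _).symm.trans h3

/-- If the left boundary is marked, both sums are the difference of the extreme marks: on the right
by the netflow of the sink, on the left by adding up the sources. Otherwise this is conservation at
the vertex of the face. -/
theorem sum_left_eq_sum_right (hH : H.IsStronglyPlanar M) {f : HasseEdge P → ℝ}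
    (hf : f ∈ (H.network M).flowPolytope) (F : Set (ℝ × ℝ)) (B : H.FaceBoundary F)
    (l r : List (HasseEdge P)) (hl : DownPath HasseEdge.top HasseEdge.bot B.max l B.min)
    (hl' : ∀ e, e ∈ l ↔ H.rightFace (.hasse e) = F)
    (hr : DownPath HasseEdge.top HasseEdge.bot B.max r B.min)
    (hr' : ∀ e, e ∈ r ↔ H.leftFace (.hasse e) = F) : (l.map f).sum = (r.map f).sum := by
  classical
  have hrne : ∃ e, e ∈ r := by
    refine List.exists_mem_of_ne_nil _ ?_
    rintro rfl
    exact B.min_ne_max (show B.max = B.min from hr).symm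
  obtain ⟨e₀, he₀⟩ := hrne
  by_cases hF : H.LeftMarked M F
  · obtain ⟨hmin, hmax⟩ := B.marked hH hF
    have h1 : 0 - (r.map f).sum = -(M.hatMark (H.maxVert F) - M.hatMark (H.minVert F)) :=
      FlowNetwork.sum_list_of_mem_flowPolytope hf (o := []) (i := r) List.nodup_nil
        (fun e => iff_of_false List.not_mem_nil (tail_ne_sink e)) (hasse_nodup hr)
        (fun e => (hr' e).trans (head_eq_sink_iff hF).symm)
        ⟨e₀, Or.inr ((head_eq_sink_iff hF).2 ((hr' _).1 he₀))⟩
    rw [B.minVert_eq, B.maxVert_eq] at h1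
    have h3 : (l.map f).sum = M.hatMark B.max - M.hatMark B.min := by
      let tail : HasseEdge P → NetVertex P := (H.network M).tail
      have key : ∀ f : HasseEdge P → ℝ, ∑ e ∈ l.toFinset, f e =
          ∑ v ∈ l.toFinset.image tail, ∑ e ∈ l.toFinset with tail e = v, f e := fun f =>
        (Finset.sum_fiberwise_of_maps_to (fun e => Finset.mem_image_of_mem tail) f).symm
      -- The difference of the marks is expanded into increments of `hatMark` along `l`, so that
      -- both sides can be grouped by the tails of the edges and compared source by source.
      rw [← hl.sum_sub, ← List.sum_toFinset _ (hasse_nodup hl),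
        ← List.sum_toFinset _ (hasse_nodup hl), key, key]
      refine Finset.sum_congr rfl fun v hv => ?_
      obtain ⟨e, he, rfl⟩ := Finset.mem_image.1 hv
      rw [List.mem_toFinset] at he
      obtain ⟨l₁, h4, h5, -⟩ := B.exists_fiber hF hmin hmax hl hl' he
      have h6 : (l.toFinset.filter fun e' => tail e' = tail e) = l₁.toFinset := by
        ext e'
        rw [Finset.mem_filter, List.mem_toFinset, List.mem_toFinset, h5]
        refine and_iff_right_of_imp fun h7 => (hl' _).2 ?_
        have htail := tail_eq_source_iff.2 ⟨(hl' e).1 he, hF, rfl, rfl⟩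
        exact (tail_eq_source_iff.1 (h7.trans htail)).1
      rw [h6, List.sum_toFinset _ (hasse_nodup h4), List.sum_toFinset _ (hasse_nodup h4),
        h4.sum_sub, sum_fiber_eq hf hl' hF he h4 h5]
    linarith
  · exact sub_eq_zero.1 (FlowNetwork.sum_list_of_mem_flowPolytope hf (o := l) (i := r)
      (hasse_nodup hl) (fun e => (hl' e).trans (tail_eq_inner_iff hF).symm) (hasse_nodup hr)
      (fun e => (hr' e).trans (head_eq_inner_iff hF).symm)
      ⟨e₀, Or.inr ((head_eq_inner_iff hF).2 ((hr' _).1 he₀))⟩)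

theorem exists_Gam_eq (hH : H.IsStronglyPlanar M) {f : HasseEdge P → ℝ}
    (hf : f ∈ (H.network M).flowPolytope) :
    ∃ x ∈ M.edgePolytope HasseEdge.top HasseEdge.bot, M.Gam x = f := by
  obtain ⟨X, hX⟩ := exists_potential (sum_left_eq_sum_right hH hf) (M.hatMark ⊥)
  -- For a marked `w ≠ ⊥`, the face to the right of an edge with top `w` has a marked left boundary.
  -- The netflow of the source just below `w` ties `X w` to the value at a lower marked vertex,
  -- which is known by induction.
  have hmark : ∀ w, M.Marked w → X w = M.hatMark w := by
    intro w
    induction w using WellFoundedLT.induction with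
    | ind w ih =>
      intro hw
      by_cases hbot : w = ⊥
      · rw [hbot, hX.1]
      · obtain ⟨v, hv⟩ := exists_covBy_of_wellFoundedGT (a := w) (by rwa [isMin_iff_eq_bot])
        let e : HasseEdge P := ⟨(v, w), hv⟩
        obtain ⟨B⟩ := (isFace_rightFace (H := H) (e := .hasse e) (by simp)).exists_boundary
        obtain ⟨l, hl, hl'⟩ := B.exists_left_of_rightFace rfl
        have hwF : w ∈ H.leftVerts (H.rightFace (.hasse e)) := ⟨.hasse e, rfl, Or.inr rfl⟩
        have hmk : H.LeftMarked M (H.rightFace (.hasse e)) := ⟨w, hwF, hw⟩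
        obtain ⟨hmin, hmax⟩ := B.marked hH hmk
        have he := (hl' e).2 rfl
        obtain ⟨l₁, h1, h2, h3, h4, h5, h6, h7⟩ := B.exists_fiber hmk hmin hmax hl hl' he
        have h8 := sum_fiber_eq hf hl' hmk he h1 h2
        have h9 : l₁.map f = l₁.map fun e => X e.top - X e.bot :=
          List.map_congr_left fun e _ => (hX.2 e).symm
        have h10 : H.markAbove M (H.rightFace (.hasse e)) e = w :=
          le_antisymm (h7 w hwF hw le_rfl) h6
        rw [h9, h1.sum_sub, h10, ih _ (h5.trans_lt hv.lt) h3] at h8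
        linarith
  have hext : M.extend (fun p => X (toHat p)) = X := by
    funext w
    rcases w with _ | _ | p
    · exact (hmark ⊥ (Or.inl rfl)).symm
    · exact (hmark ⊤ (Or.inr (Or.inl rfl))).symm
    · rfl
  have hGam : ∀ e : HasseEdge P, M.extend (fun p => X (toHat p)) e.top -
      M.extend (fun p => X (toHat p)) e.bot = f e := by rw [hext]; exact hX.2
  refine ⟨fun p => X (toHat p), ⟨fun e => ?_, fun a => ?_⟩, funext hGam⟩
  · rw [← sub_nonneg, hGam]
    exact hf.1 e
  · exact (hmark _ (Or.inr (Or.inr ⟨a, a.2, rfl⟩))).trans (MarkedPoset.hatMark_toHat a)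

theorem transGen_covBy_iff {a b : Hat P} :
    Relation.TransGen (fun a b => ∃ e : HasseEdge P, e.bot = a ∧ e.top = b) a b ↔ a < b := by
  constructor
  · intro h
    induction h with
    | single h => obtain ⟨e, rfl, rfl⟩ := h; exact e.2.lt
    | tail _ h ih => obtain ⟨e, rfl, rfl⟩ := h; exact ih.trans e.2.lt
  · intro h
    obtain ⟨l, hl⟩ := exists_downPath_of_le h.le
    induction l generalizing b with
    | nil => exact absurd (show b = a from hl) h.ne'
    | cons e l ih =>
      obtain ⟨rfl, hl⟩ := hl
      rcases (hasse_le hl).eq_or_lt with h' | h'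
      · exact .single ⟨e, h'.symm, rfl⟩
      · exact .tail (ih h' hl) ⟨e, rfl, rfl⟩

theorem toHat_lt_toHat {p q : P} : toHat p < toHat q ↔ p < q :=
  WithBot.coe_lt_coe.trans WithTop.coe_lt_coe

theorem hasse_ne (e : HasseEdge P) : e.bot ≠ ⊤ ∧ e.top ≠ ⊥ := by
  have h : e.bot < e.top := e.2.lt
  exact ⟨h.ne_top, h.ne_bot⟩

theorem edgePolytope_hasse [Nonempty P] :
    M.edgePolytope HasseEdge.top HasseEdge.bot = M.orderPolytope (· < ·) := by
  rw [MarkedPoset.edgePolytope_eq_orderPolytope hasse_ne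
    fun p q h => transGen_covBy_iff.2 (toHat_lt_toHat.2 h)]
  simp only [transGen_covBy_iff, toHat_lt_toHat]

theorem image_Gam_eq (hH : H.IsStronglyPlanar M) :
    M.Gam '' M.edgePolytope HasseEdge.top HasseEdge.bot = (H.network M).flowPolytope := by
  refine Subset.antisymm ?_ fun f hf => ?_
  · rintro _ ⟨x, hx, rfl⟩
    exact Gam_mem_flowPolytope hH hx
  · obtain ⟨x, hx, rfl⟩ := exists_Gam_eq hH hf
    exact ⟨x, hx, rfl⟩

end BoundedEmbedding

/-! ### Integrality of `Γ` -/

namespace MarkedPoset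

variable {P : Type u} [PartialOrder P] [Finite P] [Nonempty P] {M : MarkedPoset P}

instance : Nonempty M.A := by
  obtain ⟨p⟩ := ‹Nonempty P›
  obtain ⟨q, -, hq⟩ := exists_minimal_le_of_wellFoundedLT (fun _ : P => True) p trivial
  exact ⟨⟨q, M.isMin_mem q fun r hr => hq.2 trivial hr⟩⟩

theorem extend_isInt (hM : ∀ a, ∃ n : ℤ, M.mark a = n) {x : P → ℝ}
    (hx : ∀ p, ∃ n : ℤ, x p = n) (w : Hat P) : ∃ n : ℤ, M.extend x w = n := by
  rcases w with _ | _ | p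
  · obtain ⟨a, ha⟩ := exists_eq_ciInf_of_finite (f := M.mark)
    obtain ⟨n, hn⟩ := hM a
    exact ⟨n, ha.symm.trans hn⟩
  · obtain ⟨a, ha⟩ := exists_eq_ciSup_of_finite (f := M.mark)
    obtain ⟨n, hn⟩ := hM a
    exact ⟨n, ha.symm.trans hn⟩
  · exact hx p

/-- The value at `⊥` is a mark, because the infimum over a finite set is attained; the others arise
from it by adding increments. -/
theorem Gam_isInt_iff (hM : ∀ a, ∃ n : ℤ, M.mark a = n) {x : P → ℝ} :
    (∀ e, ∃ n : ℤ, M.Gam x e = n) ↔ ∀ p, ∃ n : ℤ, x p = n := by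
  constructor
  · intro h
    have key : ∀ w, ∃ n : ℤ, M.extend x w = n := by
      intro w
      induction w using WellFoundedLT.induction with
      | ind w ih =>
        by_cases hbot : w = ⊥
        · obtain ⟨a, ha⟩ := exists_eq_ciInf_of_finite (f := M.mark)
          obtain ⟨n, hn⟩ := hM a
          rw [hbot]
          exact ⟨n, ha.symm.trans hn⟩
        · obtain ⟨v, hv⟩ := exists_covBy_of_wellFoundedGT (a := w) (by rwa [isMin_iff_eq_bot])
          obtain ⟨n, hn⟩ := h ⟨(v, w), hv⟩
          obtain ⟨m, hm⟩ := ih v hv.lt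
          have h1 : M.extend x w - M.extend x v = n := hn
          refine ⟨n + m, ?_⟩
          push_cast
          linarith
    exact fun p => key (toHat p)
  · intro h e
    obtain ⟨n, hn⟩ := extend_isInt hM h e.top
    obtain ⟨m, hm⟩ := extend_isInt hM h e.bot
    refine ⟨n - m, ?_⟩
    push_cast
    rw [← hn, ← hm]
    rfl

/-- An affine map carries the affine span of `Q` onto that of its image, so only the integrality of
single points has to be compared. -/
theorem isIntegralEquivalence_Gam (hM : ∀ a, ∃ n : ℤ, M.mark a = n) {Q : Set (P → ℝ)}
    {R : Set (HasseEdge P → ℝ)} (h : M.Gam '' Q = R) : IsIntegralEquivalence M.Gam Q R := by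
  subst h
  refine ⟨Gam_injective.injOn.bijOn_image, fun x hx => ⟨?_, (Gam_isInt_iff hM).2 hx.2⟩,
    Gam_injective.injOn, fun f hf => ?_⟩
  · rw [← AffineSubspace.map_span]
    exact AffineSubspace.mem_map_of_mem _ hx.1
  · have h1 := hf.1
    rw [← AffineSubspace.map_span] at h1
    obtain ⟨x, hx, rfl⟩ := (AffineSubspace.mem_map).1 h1
    exact ⟨x, ⟨hx, (Gam_isInt_iff hM).1 hf.2⟩, rfl⟩

end MarkedPoset

/-! ### Positions in lists -/

section ListPos

variable {α : Type*} [DecidableEq α] {l : List α} {a b : α}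

theorem List.Nodup.pair_sublist_iff (hl : l.Nodup) :
    [a, b].Sublist l ↔ a ∈ l ∧ b ∈ l ∧ l.idxOf a < l.idxOf b := by
  induction l with
  | nil => simp
  | cons c l ih =>
    obtain ⟨hc, hl⟩ := List.nodup_cons.1 hl
    by_cases hac : a = c
    · subst hac
      rw [List.cons_sublist_cons, List.singleton_sublist]
      constructor
      · intro hb
        refine ⟨by simp, by simp [hb], ?_⟩
        rw [List.idxOf_cons_self, List.idxOf_cons_ne _ (by rintro rfl; exact hc hb)]
        omega
      · rintro ⟨-, hb, hlt⟩
        rcases List.mem_cons.1 hb with rfl | hb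
        · exact absurd hlt (lt_irrefl _)
        · exact hb
    · have h1 : [a, b].Sublist (c :: l) ↔ [a, b].Sublist l := by
        constructor
        · intro h
          cases h with
          | cons _ h => exact h
          | cons_cons _ h => exact absurd rfl hac
        · exact fun h => h.cons _
      rw [h1, ih hl, List.idxOf_cons_ne _ (Ne.symm hac)]
      by_cases hbc : b = c
      · subst hbc
        simp [hc]
      · rw [List.idxOf_cons_ne _ (Ne.symm hbc)]
        simp [hac, hbc]

theorem List.Nodup.pair_infix_iff (hl : l.Nodup) :
    [a, b] <:+: l ↔ a ∈ l ∧ b ∈ l ∧ l.idxOf b = l.idxOf a + 1 := by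
  constructor
  · rintro ⟨s, t, rfl⟩
    have ha : a ∉ s := fun h => by simp [List.nodup_append] at hl; exact (hl.2.2 a h).1 rfl
    have hb : b ∉ s := fun h => by simp [List.nodup_append] at hl; exact (hl.2.2 b h).2.1 rfl
    have hab : a ≠ b := by rintro rfl; simp [List.nodup_append] at hl
    refine ⟨by simp, by simp, ?_⟩
    rw [List.append_assoc, List.idxOf_append_of_notMem ha, List.idxOf_append_of_notMem hb,
      List.cons_append, List.idxOf_cons_self, List.idxOf_cons_ne _ hab, List.cons_append,
      List.idxOf_cons_self]
  · rintro ⟨ha, hb, h⟩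
    have ha' := List.idxOf_lt_length_of_mem ha
    have hb' := List.idxOf_lt_length_of_mem hb
    refine ⟨l.take (l.idxOf a), l.drop (l.idxOf a + 2), ?_⟩
    have h1 : l.drop (l.idxOf a) = a :: b :: l.drop (l.idxOf a + 2) := by
      rw [List.drop_eq_getElem_cons ha', List.drop_eq_getElem_cons (h ▸ hb')]
      simp only [← h, List.getElem_idxOf]
      rw [h]
    rw [List.append_assoc, List.cons_append, List.cons_append, List.nil_append, ← h1,
      List.take_append_drop]

theorem List.Pairwise.idxOf_lt {R : α → α → Prop} (h : l.Pairwise R) (ha : a ∈ l) (hb : b ∈ l)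
    (hab : l.idxOf a < l.idxOf b) : R a b := by
  have h1 := List.pairwise_iff_getElem.1 h _ _ (List.idxOf_lt_length_of_mem ha)
    (List.idxOf_lt_length_of_mem hb) hab
  simpa using h1

end ListPos

/-! ### Noncrossing bipartite graphs -/

section PairGraph

variable {I O : Type*}

/-- The bipartite graph with edge set `T`. -/
def pairGraph (T : Finset (I × O)) : SimpleGraph (I ⊕ O) :=
  SimpleGraph.fromRel fun a b => ∃ i o, (i, o) ∈ T ∧ a = Sum.inl i ∧ b = Sum.inr o

variable {T : Finset (I × O)}

theorem pairGraph_adj {i : I} {o : O} :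
    (pairGraph T).Adj (Sum.inl i) (Sum.inr o) ↔ (i, o) ∈ T := by
  simp [pairGraph, SimpleGraph.fromRel_adj]

theorem not_pairGraph_adj_inl {i i' : I} : ¬ (pairGraph T).Adj (Sum.inl i) (Sum.inl i') := by
  simp [pairGraph, SimpleGraph.fromRel_adj]

theorem not_pairGraph_adj_inr {o o' : O} : ¬ (pairGraph T).Adj (Sum.inr o) (Sum.inr o') := by
  simp [pairGraph, SimpleGraph.fromRel_adj]

theorem card_edgeSet_pairGraph : Nat.card (pairGraph T).edgeSet = T.card := by
  have hinj : Function.Injective fun a : I × O => (s(Sum.inl a.1, Sum.inr a.2) : Sym2 (I ⊕ O)) := by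
    rintro ⟨i, o⟩ ⟨i', o'⟩ h
    simpa using h
  have h : (pairGraph T).edgeSet =
      (fun a : I × O => (s(Sum.inl a.1, Sum.inr a.2) : Sym2 (I ⊕ O))) '' (T : Set (I × O)) := by
    ext e
    induction e using Sym2.ind with
    | _ x y =>
      rw [SimpleGraph.mem_edgeSet]
      rcases x with i | o <;> rcases y with i' | o'
      · simp [not_pairGraph_adj_inl]
      · simp [pairGraph_adj]
      · rw [SimpleGraph.adj_comm]
        simp [pairGraph_adj]
      · simp [not_pairGraph_adj_inr]
  rw [h, Nat.card_image_of_injective hinj]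
  exact (Nat.card_coe_set_eq _).trans (Set.ncard_coe_finset T)

variable {r : I → ℕ} {s : O → ℕ} {p q : ℕ}

/-- Noncrossing pairs form a chain in the product order, on which the sum of the ranks is strictly
increasing. -/
theorem rank_injOn (hr : Function.Injective r) (hs : Function.Injective s)
    (hT : ∀ a ∈ T, ∀ b ∈ T, r a.1 < r b.1 → ¬ s b.2 < s a.2) :
    Set.InjOn (fun a : I × O => r a.1 + s a.2) T := by
  intro a ha b hb hab
  simp only at hab
  rcases lt_trichotomy (r a.1) (r b.1) with h | h | h
  · have := hT a ha b hb h
    omega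
  · exact Prod.ext (hr h) (hs (by omega))
  · have := hT b hb a ha h
    omega

theorem rank_mem_range (hr' : ∀ i, r i < p) (hs' : ∀ o, s o < q) (a : I × O) :
    r a.1 + s a.2 < p + q - 1 := by
  have h1 := hr' a.1
  have h2 := hs' a.2
  omega

variable [Finite I] [Finite O] [Nonempty I] [Nonempty O]

/-- The rank sums are distinct and lie in `{0, …, p + q - 2}`. -/
theorem card_add_one_le (hr : Function.Injective r) (hs : Function.Injective s)
    (hr' : ∀ i, r i < p) (hs' : ∀ o, s o < q)
    (hT : ∀ a ∈ T, ∀ b ∈ T, r a.1 < r b.1 → ¬ s b.2 < s a.2) : T.card + 1 ≤ p + q := by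
  have h1 := Finset.card_le_card_of_injOn (t := Finset.range (p + q - 1)) _
    (fun a _ => Finset.mem_coe.2 (Finset.mem_range.2 (rank_mem_range hr' hs' a)))
    (rank_injOn hr hs hT)
  rw [Finset.card_range] at h1
  obtain ⟨i⟩ := ‹Nonempty I›
  have h2 := hr' i
  omega

/-- A connected graph has at least one edge fewer than vertices, and a noncrossing one has no more.
So acyclicity need not be checked. -/
theorem isTree_pairGraph (hr : Function.Injective r) (hs : Function.Injective s)
    (hr' : ∀ i, r i < Nat.card I) (hs' : ∀ o, s o < Nat.card O)
    (hT : ∀ a ∈ T, ∀ b ∈ T, r a.1 < r b.1 → ¬ s b.2 < s a.2) (hc : (pairGraph T).Connected) :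
    (pairGraph T).IsTree := by
  rw [SimpleGraph.isTree_iff_connected_and_card]
  refine ⟨hc, le_antisymm ?_ ?_⟩
  · rw [card_edgeSet_pairGraph, Nat.card_sum]
    exact card_add_one_le hr hs hr' hs' hT
  · exact hc.card_vert_le_card_edgeSet_add_one

theorem card_of_isTree (h : (pairGraph T).IsTree) : T.card + 1 = Nat.card I + Nat.card O := by
  have h1 := (SimpleGraph.isTree_iff_connected_and_card.1 h).2
  rwa [card_edgeSet_pairGraph, Nat.card_sum] at h1

theorem exists_mem_left (h : (pairGraph T).Connected) (i : I) : ∃ o, (i, o) ∈ T := by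
  obtain ⟨o⟩ := ‹Nonempty O›
  have : Nontrivial (I ⊕ O) := ⟨Sum.inl i, Sum.inr o, by simp⟩
  obtain ⟨x, hx⟩ := h.preconnected.exists_adj_of_nontrivial (Sum.inl i)
  rcases x with i' | o'
  · exact absurd hx not_pairGraph_adj_inl
  · exact ⟨o', pairGraph_adj.1 hx⟩

theorem exists_mem_right (h : (pairGraph T).Connected) (o : O) : ∃ i, (i, o) ∈ T := by
  obtain ⟨i⟩ := ‹Nonempty I›
  have : Nontrivial (I ⊕ O) := ⟨Sum.inl i, Sum.inr o, by simp⟩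
  obtain ⟨x, hx⟩ := h.preconnected.exists_adj_of_nontrivial (Sum.inr o)
  rcases x with i' | o'
  · exact ⟨i', pairGraph_adj.1 hx.symm⟩
  · exact absurd hx not_pairGraph_adj_inr

end PairGraph

/-! ### Positions in lists, and sorting -/

section ListPos

variable {α : Type*} {l : List α} {a b : α}

open Classical in
/-- The position of the first occurrence of `a` in `l`. -/
noncomputable def List.pos (l : List α) (a : α) : ℕ := l.idxOf a

theorem List.pos_lt_length (h : a ∈ l) : l.pos a < l.length := by
  classical exact List.idxOf_lt_length_of_mem h

theorem List.eq_of_pos_eq (ha : a ∈ l) (h : l.pos a = l.pos b) : a = b := by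
  classical exact (List.idxOf_inj ha).1 h

theorem List.Nodup.exists_pos_eq (hl : l.Nodup) {k : ℕ} (hk : k < l.length) :
    ∃ a ∈ l, l.pos a = k := by
  classical exact ⟨l[k], List.getElem_mem hk, hl.idxOf_getElem k hk⟩

theorem List.Nodup.pair_sublist_iff_pos (hl : l.Nodup) :
    [a, b].Sublist l ↔ a ∈ l ∧ b ∈ l ∧ l.pos a < l.pos b := by
  classical exact hl.pair_sublist_iff

theorem List.Nodup.pair_infix_iff_pos (hl : l.Nodup) :
    [a, b] <:+: l ↔ a ∈ l ∧ b ∈ l ∧ l.pos b = l.pos a + 1 := by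
  classical exact hl.pair_infix_iff

theorem List.Pairwise.of_pos_lt {R : α → α → Prop} (h : l.Pairwise R) (ha : a ∈ l) (hb : b ∈ l)
    (hab : l.pos a < l.pos b) : R a b := by
  classical exact h.idxOf_lt ha hb hab

theorem List.Nodup.pairwise_pos (hl : l.Nodup) : l.Pairwise fun a b => l.pos a < l.pos b := by
  classical
  refine List.pairwise_iff_getElem.2 fun i j hi hj hij => ?_
  have h1 : l.pos l[i] = i := hl.idxOf_getElem i hi
  have h2 : l.pos l[j] = j := hl.idxOf_getElem j hj
  omega

theorem List.pos_cons_self : (a :: l).pos a = 0 := by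
  classical exact List.idxOf_cons_self

theorem List.pos_cons_ne (h : b ≠ a) : (b :: l).pos a = l.pos a + 1 := by
  classical exact List.idxOf_cons_ne _ h

theorem exists_sorted_list (s : Finset α) (k : α → ℕ) :
    ∃ l : List α, l.Nodup ∧ (∀ a, a ∈ l ↔ a ∈ s) ∧ l.Pairwise fun a b => k a ≤ k b := by
  classical
  have : Std.Total (fun a b => k a ≤ k b) := ⟨fun a b => le_total _ _⟩
  have : IsTrans α (fun a b => k a ≤ k b) := ⟨fun a b c => le_trans⟩
  refine ⟨s.toList.insertionSort fun a b => k a ≤ k b, ?_, fun a => ?_,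
    List.pairwise_insertionSort _ _⟩
  · exact (List.perm_insertionSort _ _).nodup_iff.2 s.nodup_toList
  · rw [(List.perm_insertionSort _ _).mem_iff, Finset.mem_toList]

/-- With the vertices listed from the top, edge number `n` joins the vertices number `n` and `n +
1`. -/
theorem DownPath.pos_eq {V E : Type*} {top bot : E → V} {a b : V} {c : List E}
    (h : DownPath top bot a c b) (hc : (a :: c.map bot).Nodup) {e : E} (he : e ∈ c) :
    (a :: c.map bot).pos (top e) = c.pos e ∧ (a :: c.map bot).pos (bot e) = c.pos e + 1 := by
  induction c generalizing a with
  | nil => simp at he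
  | cons e₀ c ih =>
    obtain ⟨ha, hc⟩ := List.nodup_cons.1 hc
    rw [List.map_cons] at *
    by_cases heq : e = e₀
    · subst heq
      have hne : a ≠ bot e := by rintro rfl; simp at ha
      rw [h.1, List.pos_cons_self, List.pos_cons_self, List.pos_cons_ne hne, List.pos_cons_self]
      exact ⟨rfl, rfl⟩
    · have he' := (List.mem_cons.1 he).resolve_left heq
      obtain ⟨h1, h2⟩ := ih h.2 hc he'
      have h3 : top e ∈ bot e₀ :: c.map bot := by
        rcases h.2.top_eq_or he' with h3 | ⟨e', h3, h4⟩
        · simp [h3]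
        · exact List.mem_cons_of_mem _ (List.mem_map.2 ⟨e', h3, h4⟩)
      have h4 : bot e ∈ bot e₀ :: c.map bot :=
        List.mem_cons_of_mem _ (List.mem_map.2 ⟨e, he', rfl⟩)
      refine ⟨?_, ?_⟩
      · rw [List.pos_cons_ne (by rintro rfl; exact ha h3), h1, List.pos_cons_ne (Ne.symm heq)]
      · rw [List.pos_cons_ne (l := bot e₀ :: c.map bot) (by rintro rfl; exact ha h4), h2,
          List.pos_cons_ne (Ne.symm heq)]

end ListPos

/-! ### Linear extensions of a face and noncrossing trees -/

namespace Diagram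

variable {V : Type u} {D : Diagram V} {F : Set (ℝ × ℝ)}

/-- The left and the right boundary chain of a face. -/
structure FaceChains (D : Diagram V) (F : Set (ℝ × ℝ)) where
  max : V
  min : V
  left : List D.E
  right : List D.E
  mem_left : ∀ e, e ∈ left ↔ D.right e = F
  mem_right : ∀ e, e ∈ right ↔ D.left e = F
  path_left : DownPath D.top D.bot max left min
  path_right : DownPath D.top D.bot max right min
  nodup_left : (max :: left.map D.bot).Nodup
  nodup_right : (max :: right.map D.bot).Nodup
  max_ne_min : max ≠ min
  -- Lower ends never include the maximum, so this says that the chains meet only in their two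
  -- extreme vertices.
  eq_min : ∀ v ∈ left.map D.bot, v ∈ right.map D.bot → v = min

namespace FaceChains

variable (C : D.FaceChains F)

/-- The list `c` is one of the two boundary chains. -/
def IsSide (c : List D.E) : Prop := c = C.left ∨ c = C.right

theorem isSide_left : C.IsSide C.left := Or.inl rfl

theorem isSide_right : C.IsSide C.right := Or.inr rfl

namespace IsSide

variable {C} {c : List D.E} (hc : C.IsSide c)
include hc

theorem path : DownPath D.top D.bot C.max c C.min := by
  rcases hc with rfl | rfl
  exacts [C.path_left, C.path_right]

theorem nodup_verts : (C.max :: c.map D.bot).Nodup := by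
  rcases hc with rfl | rfl
  exacts [C.nodup_left, C.nodup_right]

theorem nodup : c.Nodup := (List.nodup_cons.1 hc.nodup_verts).2.of_map

theorem isBoundary {e : D.E} (he : e ∈ c) : D.IsBoundary F e := by
  rcases hc with rfl | rfl
  exacts [Or.inl ((C.mem_left e).1 he), Or.inr ((C.mem_right e).1 he)]

theorem ne_nil : c ≠ [] := by
  rintro rfl
  exact C.max_ne_min hc.path

theorem pos_top_lt {e : D.E} (he : e ∈ c) :
    (C.max :: c.map D.bot).pos (D.top e) < (C.max :: c.map D.bot).pos (D.bot e) := by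
  obtain ⟨h1, h2⟩ := hc.path.pos_eq hc.nodup_verts he
  omega

theorem top_ne_min {e : D.E} (he : e ∈ c) : D.top e ≠ C.min := by
  intro h
  have h1 := (hc.path.le_top_bot_le (k := (C.max :: c.map D.bot).pos)
    (fun e he => hc.pos_top_lt he) he).2
  exact (hc.pos_top_lt he).not_ge (h ▸ h1)

theorem bot_ne_max {e : D.E} (he : e ∈ c) : D.bot e ≠ C.max := fun h =>
  (List.nodup_cons.1 hc.nodup_verts).1 (h ▸ List.mem_map.2 ⟨e, he, rfl⟩)

theorem top_mem {e : D.E} (he : e ∈ c) : D.top e = C.max ∨ D.top e ∈ c.map D.bot := by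
  rcases hc.path.top_eq_or he with h | ⟨e', h1, h2⟩
  · exact Or.inl h
  · exact Or.inr (List.mem_map.2 ⟨e', h1, h2⟩)

end IsSide

theorem min_mem_left : C.min ∈ C.left.map D.bot := by
  obtain ⟨e, he, h⟩ := C.path_left.exists_bot C.isSide_left.ne_nil
  exact List.mem_map.2 ⟨e, he, h⟩

variable {C} in
/-- A vertex on both boundary chains is the maximum or the minimum. -/
theorem IsSide.eq_max_or_eq_min {c c' : List D.E} (hc : C.IsSide c) (hc' : C.IsSide c')
    (hne : c ≠ c') {v : V} (h : v = C.max ∨ v ∈ c.map D.bot) (h' : v = C.max ∨ v ∈ c'.map D.bot) :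
    v = C.max ∨ v = C.min := by
  rcases h with h | h
  · exact Or.inl h
  rcases h' with h' | h'
  · exact Or.inl h'
  right
  rcases hc with rfl | rfl <;> rcases hc' with rfl | rfl
  · exact absurd rfl hne
  · exact C.eq_min v h h'
  · exact C.eq_min v h' h
  · exact absurd rfl hne

theorem isBoundary_iff {e : D.E} : D.IsBoundary F e ↔ e ∈ C.left ∨ e ∈ C.right := by
  rw [C.mem_left, C.mem_right]
  rfl

theorem exists_isSide {e : D.E} (he : D.IsBoundary F e) : ∃ c, C.IsSide c ∧ e ∈ c := by
  rcases C.isBoundary_iff.1 he with h | h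
  exacts [⟨_, C.isSide_left, h⟩, ⟨_, C.isSide_right, h⟩]

theorem vert_iff {v : V} : (∃ e, D.IsBoundary F e ∧ (v = D.bot e ∨ v = D.top e)) ↔
    v = C.max ∨ v ∈ C.left.map D.bot ∨ v ∈ C.right.map D.bot := by
  constructor
  · rintro ⟨e, he, h⟩
    rcases C.isBoundary_iff.1 he with he | he
    · rcases h with rfl | rfl
      · exact Or.inr (Or.inl (List.mem_map.2 ⟨e, he, rfl⟩))
      · exact (C.isSide_left.top_mem he).imp_right Or.inl
    · rcases h with rfl | rfl
      · exact Or.inr (Or.inr (List.mem_map.2 ⟨e, he, rfl⟩))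
      · exact (C.isSide_right.top_mem he).imp_right Or.inr
  · rintro (rfl | h | h)
    · obtain ⟨e, he, h⟩ := C.path_left.exists_top C.isSide_left.ne_nil
      exact ⟨e, C.isSide_left.isBoundary he, Or.inr h.symm⟩
    · obtain ⟨e, he, rfl⟩ := List.mem_map.1 h
      exact ⟨e, C.isSide_left.isBoundary he, Or.inl rfl⟩
    · obtain ⟨e, he, rfl⟩ := List.mem_map.1 h
      exact ⟨e, C.isSide_right.isBoundary he, Or.inl rfl⟩

end FaceChains

variable (C : D.FaceChains F) (L : D.LinearExtension F)

namespace LinearExtension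

theorem top_mem {e : D.E} (he : D.IsBoundary F e) : D.top e ∈ L.1 :=
  (L.2.2.1 _).2 ⟨e, he, Or.inr rfl⟩

theorem bot_mem {e : D.E} (he : D.IsBoundary F e) : D.bot e ∈ L.1 :=
  (L.2.2.1 _).2 ⟨e, he, Or.inl rfl⟩

theorem pos_lt {e : D.E} (he : D.IsBoundary F e) : L.1.pos (D.top e) < L.1.pos (D.bot e) :=
  (L.2.1.pair_sublist_iff_pos.1 (L.2.2.2 e he)).2.2

theorem mem_iff {v : V} :
    v ∈ L.1 ↔ v = C.max ∨ v ∈ C.left.map D.bot ∨ v ∈ C.right.map D.bot :=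
  (L.2.2.1 v).trans C.vert_iff

variable {C L} in
theorem bounds {c : List D.E} (hc : C.IsSide c) {e : D.E} (he : e ∈ c) :
    L.1.pos C.max ≤ L.1.pos (D.top e) ∧ L.1.pos (D.bot e) ≤ L.1.pos C.min :=
  hc.path.le_top_bot_le (fun _ he => L.pos_lt (hc.isBoundary he)) he

variable {L} in
theorem pos_max_le_and_le_min {v : V} (hv : v ∈ L.1) :
    L.1.pos C.max ≤ L.1.pos v ∧ L.1.pos v ≤ L.1.pos C.min := by
  obtain ⟨e, he, h⟩ := (L.2.2.1 v).1 hv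
  obtain ⟨c, hc, hec⟩ := C.exists_isSide he
  obtain ⟨h1, h2⟩ := bounds (L := L) hc hec
  have h3 := L.pos_lt he
  rcases h with rfl | rfl <;> omega

theorem max_mem : C.max ∈ L.1 := (L.mem_iff C).2 (Or.inl rfl)

theorem min_mem : C.min ∈ L.1 := (L.mem_iff C).2 (Or.inr (Or.inl C.min_mem_left))

theorem pos_max : L.1.pos C.max = 0 := by
  obtain ⟨v, hv, h⟩ := L.2.1.exists_pos_eq
    ((Nat.zero_le _).trans_lt (List.pos_lt_length (L.max_mem C)))
  have := (pos_max_le_and_le_min C hv).1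
  omega

theorem pos_min : L.1.pos C.min + 1 = L.1.length := by
  have h1 := List.pos_lt_length (L.min_mem C)
  obtain ⟨v, hv, h⟩ := L.2.1.exists_pos_eq (k := L.1.length - 1) (by omega)
  have := (pos_max_le_and_le_min C hv).2
  omega

variable {C L} {c : List D.E} (hc : C.IsSide c)
include hc

/-- Each step from position `k` to `k + 1` lies within an edge of each chain, and by `cover_unique`
within only one. -/
theorem exists_cover {k : ℕ} (hk : k + 1 < L.1.length) :
    ∃ e ∈ c, L.1.pos (D.top e) ≤ k ∧ k < L.1.pos (D.bot e) := by
  have h1 := L.pos_max C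
  have h2 := L.pos_min C
  exact hc.path.exists_mem_of_le_of_lt (by omega) (by omega)

theorem pos_bot_le_pos_top {e e' : D.E} (he : e ∈ c) (he' : e' ∈ c) (h : c.pos e < c.pos e') :
    L.1.pos (D.bot e) ≤ L.1.pos (D.top e') :=
  (hc.path.pairwise (k := L.1.pos) fun _ he => L.pos_lt (hc.isBoundary he)).of_pos_lt he he' h

theorem pos_bot_le_pos_bot {e e' : D.E} (he : e ∈ c) (he' : e' ∈ c) (h : c.pos e ≤ c.pos e') :
    L.1.pos (D.bot e) ≤ L.1.pos (D.bot e') := by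
  rcases h.eq_or_lt with h | h
  · rw [List.eq_of_pos_eq he h]
  · exact (pos_bot_le_pos_top hc he he' h).trans (L.pos_lt (hc.isBoundary he')).le

theorem cover_unique {e e' : D.E} (he : e ∈ c) (he' : e' ∈ c) {k : ℕ}
    (h₁ : L.1.pos (D.top e) ≤ k) (h₂ : k < L.1.pos (D.bot e)) (h₁' : L.1.pos (D.top e') ≤ k)
    (h₂' : k < L.1.pos (D.bot e')) : e = e' := by
  rcases lt_trichotomy (c.pos e) (c.pos e') with h | h | h
  · have := pos_bot_le_pos_top (L := L) hc he he' h
    omega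
  · exact List.eq_of_pos_eq he h
  · have := pos_bot_le_pos_top (L := L) hc he' he h
    omega

theorem not_between {v : V} (hv : v = C.max ∨ v ∈ c.map D.bot) {e : D.E} (he : e ∈ c) :
    L.1.pos v ≤ L.1.pos (D.top e) ∨ L.1.pos (D.bot e) ≤ L.1.pos v := by
  rcases hv with rfl | hv
  · exact Or.inl (bounds hc he).1
  · obtain ⟨e', he', rfl⟩ := List.mem_map.1 hv
    rcases lt_trichotomy (c.pos e) (c.pos e') with h | h | h
    · exact Or.inr ((pos_bot_le_pos_top hc he he' h).trans (L.pos_lt (hc.isBoundary he')).le)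
    · rw [List.eq_of_pos_eq he h]
      exact Or.inr le_rfl
    · exact Or.inl (pos_bot_le_pos_top hc he' he h)

end LinearExtension

/-- In the linear extension, the edges `e` and `e'` have a common part. -/
def Overlap (e e' : D.E) : Prop :=
  L.1.pos (D.top e) < L.1.pos (D.bot e') ∧ L.1.pos (D.top e') < L.1.pos (D.bot e)

namespace LinearExtension

variable {C L}

/-- The right-hand side uses only the chains and the overlaps. The step that begins at `u` lies
within overlapping edges `e` and `f`, one of which starts at `u`; every later element is the lower
end of an edge not before `e` or `f` on its chain. -/
theorem pos_lt_pos_iff {u v : V} (hu : u ∈ L.1) (hv : v ∈ L.1) : L.1.pos u < L.1.pos v ↔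
    ∃ e ∈ C.left, ∃ f ∈ C.right, Overlap L f e ∧ (u = D.top f ∨ u = D.top e) ∧
      ((∃ f' ∈ C.right, C.right.pos f ≤ C.right.pos f' ∧ v = D.bot f') ∨
        ∃ e' ∈ C.left, C.left.pos e ≤ C.left.pos e' ∧ v = D.bot e') := by
  constructor
  · intro h
    have hk : L.1.pos u + 1 < L.1.length := by
      have := List.pos_lt_length hv
      omega
    obtain ⟨e, he, h1, h2⟩ := exists_cover C.isSide_left hk
    obtain ⟨f, hf, h3, h4⟩ := exists_cover C.isSide_right hk
    have htop : ∀ {c e}, C.IsSide c → e ∈ c → L.1.pos (D.top e) ≤ L.1.pos u →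
        L.1.pos u < L.1.pos (D.bot e) → (u = C.max ∨ u ∈ c.map D.bot) → u = D.top e := by
      intro c e hc he h1 h2 hu'
      rcases not_between (L := L) hc hu' he with h3 | h3
      · exact List.eq_of_pos_eq hu (le_antisymm h3 h1)
      · omega
    have hbot : ∀ {c e}, C.IsSide c → e ∈ c → L.1.pos (D.top e) ≤ L.1.pos u → v ∈ c.map D.bot →
        ∃ e' ∈ c, c.pos e ≤ c.pos e' ∧ v = D.bot e' := by
      intro c e hc he h1 hv'
      obtain ⟨e', he', rfl⟩ := List.mem_map.1 hv'
      refine ⟨e', he', not_lt.1 fun h2 => ?_, rfl⟩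
      have := pos_bot_le_pos_top (L := L) hc he' he h2
      omega
    refine ⟨e, he, f, hf, ⟨by omega, by omega⟩, ?_, ?_⟩
    · rcases (L.mem_iff C).1 hu with h5 | h5 | h5
      · exact Or.inr (htop C.isSide_left he h1 h2 (Or.inl h5))
      · exact Or.inr (htop C.isSide_left he h1 h2 (Or.inr h5))
      · exact Or.inl (htop C.isSide_right hf h3 h4 (Or.inr h5))
    · rcases (L.mem_iff C).1 hv with h5 | h5 | h5
      · rw [h5, L.pos_max C] at h
        exact absurd h (Nat.not_lt_zero _)
      · exact Or.inr (hbot C.isSide_left he h1 h5)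
      · exact Or.inl (hbot C.isSide_right hf h3 h5)
  · rintro ⟨e, he, f, hf, ⟨h1, h2⟩, h3, h4⟩
    have h5 := L.pos_lt (C.isSide_left.isBoundary he)
    have h6 := L.pos_lt (C.isSide_right.isBoundary hf)
    have h7 : L.1.pos u < L.1.pos (D.bot e) ∧ L.1.pos u < L.1.pos (D.bot f) := by
      rcases h3 with rfl | rfl <;> constructor <;> assumption
    rcases h4 with ⟨f', hf', h8, rfl⟩ | ⟨e', he', h8, rfl⟩
    · exact h7.2.trans_le (pos_bot_le_pos_bot C.isSide_right hf hf' h8)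
    · exact h7.1.trans_le (pos_bot_le_pos_bot C.isSide_left he he' h8)

theorem eq_of_overlap_iff {L' : D.LinearExtension F}
    (h : ∀ f ∈ C.right, ∀ e ∈ C.left, Overlap L f e ↔ Overlap L' f e) : L = L' := by
  have hmem : ∀ v, v ∈ L.1 ↔ v ∈ L'.1 := fun v => (L.mem_iff C).trans (L'.mem_iff C).symm
  have hpos : ∀ u ∈ L.1, ∀ v ∈ L.1, L'.1.pos u < L'.1.pos v → L.1.pos u < L.1.pos v := by
    intro u hu v hv huv
    rw [pos_lt_pos_iff (C := C) ((hmem u).1 hu) ((hmem v).1 hv)] at huv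
    rw [pos_lt_pos_iff (C := C) hu hv]
    obtain ⟨e, he, f, hf, h1, h2⟩ := huv
    exact ⟨e, he, f, hf, (h f hf e he).2 h1, h2⟩
  refine Subtype.ext (List.Perm.eq_of_pairwise (le := fun a b => L.1.pos a < L.1.pos b) ?_
    L.2.1.pairwise_pos ?_ ((List.perm_ext_iff_of_nodup L.2.1 L'.2.1).2 hmem))
  · intro a b _ _ h1 h2
    omega
  · refine L'.2.1.pairwise_pos.imp_of_mem fun {a b} ha hb hab => ?_
    exact hpos a ((hmem a).2 ha) b ((hmem b).2 hb) hab

end LinearExtension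

end Diagram

theorem List.Nodup.natCard_eq {α β : Type*} {l : List α} (hl : l.Nodup) {f : β → α}
    (hf : Function.Injective f) (hfl : ∀ a, a ∈ l ↔ ∃ b, f b = a) : Nat.card β = l.length := by
  classical
  have e : β ≃ {a // a ∈ l} := Equiv.ofBijective (fun b => ⟨f b, (hfl _).2 ⟨b, rfl⟩⟩)
    ⟨fun b b' h => hf (congrArg Subtype.val h), fun a => by
      obtain ⟨b, h⟩ := (hfl a.1).1 a.2
      exact ⟨b, Subtype.ext h⟩⟩
  rw [Nat.card_congr e, ← Nat.card_congr hl.getEquiv, Nat.card_fin]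

/-! ### The tree of overlaps -/

namespace Diagram

variable {V : Type u} {D : Diagram V} {F : Set (ℝ × ℝ)}

/-- A labelling of the edges of the right and of the left boundary chain. -/
structure FaceChains.Labelling (C : D.FaceChains F) {I O : Type*} (f : I → D.E) (g : O → D.E) :
    Prop where
  injective_right : Function.Injective f
  injective_left : Function.Injective g
  mem_right : ∀ e, e ∈ C.right ↔ ∃ i, f i = e
  mem_left : ∀ e, e ∈ C.left ↔ ∃ o, g o = e

namespace FaceChains.Labelling

variable {C : D.FaceChains F} {L : D.LinearExtension F} {I O : Type*} {f : I → D.E} {g : O → D.E}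
  (hfg : C.Labelling f g)
include hfg

theorem right_mem (i : I) : f i ∈ C.right := (hfg.mem_right _).2 ⟨i, rfl⟩

theorem left_mem (o : O) : g o ∈ C.left := (hfg.mem_left _).2 ⟨o, rfl⟩

theorem right_isBoundary (i : I) : D.IsBoundary F (f i) :=
  C.isSide_right.isBoundary (hfg.right_mem i)

theorem left_isBoundary (o : O) : D.IsBoundary F (g o) :=
  C.isSide_left.isBoundary (hfg.left_mem o)

theorem card_right : Nat.card I = C.right.length :=
  C.isSide_right.nodup.natCard_eq hfg.injective_right hfg.mem_right

theorem card_left : Nat.card O = C.left.length :=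
  C.isSide_left.nodup.natCard_eq hfg.injective_left hfg.mem_left

theorem nonempty_right : Nonempty I := by
  obtain ⟨e, he⟩ := List.exists_mem_of_ne_nil _ C.isSide_right.ne_nil
  exact ⟨((hfg.mem_right e).1 he).choose⟩

theorem nonempty_left : Nonempty O := by
  obtain ⟨e, he⟩ := List.exists_mem_of_ne_nil _ C.isSide_left.ne_nil
  exact ⟨((hfg.mem_left e).1 he).choose⟩

theorem finite_right : Finite I := by
  have := hfg.nonempty_right
  refine Nat.finite_of_card_ne_zero ?_
  rw [hfg.card_right]
  exact fun h => C.isSide_right.ne_nil (List.length_eq_zero_iff.1 h)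

theorem finite_left : Finite O := by
  have := hfg.nonempty_left
  refine Nat.finite_of_card_ne_zero ?_
  rw [hfg.card_left]
  exact fun h => C.isSide_left.ne_nil (List.length_eq_zero_iff.1 h)

theorem rank_right_lt (i : I) : C.right.pos (f i) < Nat.card I := by
  rw [hfg.card_right]
  exact List.pos_lt_length (hfg.right_mem i)

theorem rank_left_lt (o : O) : C.left.pos (g o) < Nat.card O := by
  rw [hfg.card_left]
  exact List.pos_lt_length (hfg.left_mem o)

theorem rank_right_injective : Function.Injective fun i => C.right.pos (f i) := fun i _ h =>
  hfg.injective_right (List.eq_of_pos_eq (hfg.right_mem i) h)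

theorem rank_left_injective : Function.Injective fun o => C.left.pos (g o) := fun o _ h =>
  hfg.injective_left (List.eq_of_pos_eq (hfg.left_mem o) h)

/-- A crossing would give a cycle of positions: the bottom of `f i`, the top of `f i'`, the bottom
of `g o'`, the top of `g o`, and the bottom of `f i` again. -/
theorem noncrossing_of_overlap {i i' : I} {o o' : O} (h : Overlap L (f i) (g o))
    (h' : Overlap L (f i') (g o')) (hi : C.right.pos (f i) < C.right.pos (f i')) :
    ¬ C.left.pos (g o') < C.left.pos (g o) := by
  intro ho
  have h1 := LinearExtension.pos_bot_le_pos_top (L := L) C.isSide_right (hfg.right_mem i)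
    (hfg.right_mem i') hi
  have h2 := LinearExtension.pos_bot_le_pos_top (L := L) C.isSide_left (hfg.left_mem o')
    (hfg.left_mem o) ho
  have h3 := h.2
  have h4 := h'.1
  omega

/-- Consecutive steps of the linear extension are covered by connected edges: if the right edge ends
between them, the left one does not, because a vertex at which both end is the minimum, and no step
follows it. -/
theorem connected_of_overlap {T : Finset (I × O)}
    (hT : ∀ i o, (i, o) ∈ T ↔ Overlap L (f i) (g o)) : (pairGraph T).Connected := by
  have hcr : ∀ k, k + 1 < L.1.length →
      ∃ i, L.1.pos (D.top (f i)) ≤ k ∧ k < L.1.pos (D.bot (f i)) := by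
    intro k hk
    obtain ⟨e, he, h⟩ := LinearExtension.exists_cover C.isSide_right hk
    obtain ⟨i, rfl⟩ := (hfg.mem_right e).1 he
    exact ⟨i, h⟩
  have hcl : ∀ k, k + 1 < L.1.length →
      ∃ o, L.1.pos (D.top (g o)) ≤ k ∧ k < L.1.pos (D.bot (g o)) := by
    intro k hk
    obtain ⟨e, he, h⟩ := LinearExtension.exists_cover C.isSide_left hk
    obtain ⟨o, rfl⟩ := (hfg.mem_left e).1 he
    exact ⟨o, h⟩
  have hadj : ∀ {k i o}, L.1.pos (D.top (f i)) ≤ k ∧ k < L.1.pos (D.bot (f i)) →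
      L.1.pos (D.top (g o)) ≤ k ∧ k < L.1.pos (D.bot (g o)) →
      (pairGraph T).Reachable (Sum.inl i) (Sum.inr o) := fun h h' =>
    (pairGraph_adj.2 ((hT _ _).2 ⟨by omega, by omega⟩)).reachable
  have hlen : ∀ {e}, D.IsBoundary F e → L.1.pos (D.top e) + 1 < L.1.length := fun he => by
    have h1 := L.pos_lt he
    have h2 := List.pos_lt_length (L.bot_mem he)
    omega
  obtain ⟨i₁⟩ := hfg.nonempty_right
  have hl0 : 0 + 1 < L.1.length := (Nat.succ_le_succ (Nat.zero_le _)).trans_lt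
    (hlen (hfg.right_isBoundary i₁))
  obtain ⟨i₀, hi₀⟩ := hcr 0 hl0
  have key : ∀ k, k + 1 < L.1.length → ∀ i,
      L.1.pos (D.top (f i)) ≤ k ∧ k < L.1.pos (D.bot (f i)) →
      (pairGraph T).Reachable (Sum.inl i₀) (Sum.inl i) := by
    intro k
    induction k with
    | zero =>
      intro hk i hi
      rw [hfg.injective_right (LinearExtension.cover_unique C.isSide_right (hfg.right_mem i₀)
        (hfg.right_mem i) hi₀.1 hi₀.2 hi.1 hi.2)]
    | succ k ih =>
      intro hk i' hi'
      obtain ⟨i, hi⟩ := hcr k (by omega)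
      obtain ⟨o, ho⟩ := hcl k (by omega)
      have h1 := ih (by omega) i hi
      by_cases h2 : k + 1 < L.1.pos (D.bot (f i))
      · rwa [hfg.injective_right (LinearExtension.cover_unique C.isSide_right (hfg.right_mem i')
          (hfg.right_mem i) hi'.1 hi'.2 (by omega) h2)]
      · have h3 : k + 1 < L.1.pos (D.bot (g o)) := by
          refine lt_of_le_of_ne ho.2 fun h3 => ?_
          have h4 : D.bot (g o) = D.bot (f i) := List.eq_of_pos_eq
            (L.bot_mem (hfg.left_isBoundary o)) (by omega)
          have h5 := C.eq_min _ (List.mem_map.2 ⟨_, hfg.left_mem o, rfl⟩)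
            (List.mem_map.2 ⟨_, hfg.right_mem i, h4.symm⟩)
          have h6 := L.pos_min C
          rw [← h5] at h6
          omega
        exact (h1.trans (hadj hi ho)).trans (hadj hi' ⟨by omega, h3⟩).symm
  refine SimpleGraph.connected_iff_exists_forall_reachable _ |>.2 ⟨Sum.inl i₀, ?_⟩
  rintro (i | o)
  · exact key _ (hlen (hfg.right_isBoundary i)) i ⟨le_rfl, L.pos_lt (hfg.right_isBoundary i)⟩
  · obtain ⟨i, hi⟩ := hcr _ (hlen (hfg.left_isBoundary o))
    exact (key _ (hlen (hfg.left_isBoundary o)) i hi).trans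
      (hadj hi ⟨le_rfl, L.pos_lt (hfg.left_isBoundary o)⟩)

theorem isTree_of_overlap {T : Finset (I × O)}
    (hT : ∀ i o, (i, o) ∈ T ↔ Overlap L (f i) (g o)) : (pairGraph T).IsTree := by
  have := hfg.finite_right
  have := hfg.finite_left
  have := hfg.nonempty_right
  have := hfg.nonempty_left
  exact isTree_pairGraph hfg.rank_right_injective hfg.rank_left_injective hfg.rank_right_lt
    hfg.rank_left_lt (fun a ha b hb => hfg.noncrossing_of_overlap ((hT _ _).1 ha) ((hT _ _).1 hb))
    (hfg.connected_of_overlap hT)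

end FaceChains.Labelling

end Diagram

/-! ### The linear extension of a noncrossing tree -/

namespace Diagram

variable {V : Type u} {D : Diagram V} {F : Set (ℝ × ℝ)}

namespace FaceChains

variable {C : D.FaceChains F}

theorem IsSide.pos_eq_of_top_eq_bot {c : List D.E} (hc : C.IsSide c) {e e' : D.E} (he : e ∈ c)
    (he' : e' ∈ c) (h : D.top e' = D.bot e) : c.pos e' = c.pos e + 1 := by
  rw [← (hc.path.pos_eq hc.nodup_verts he).2, ← h, (hc.path.pos_eq hc.nodup_verts he').1]

theorem exists_top_eq {v : V} (hv : v = C.max ∨ v ∈ C.left.map D.bot ∨ v ∈ C.right.map D.bot)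
    (hmin : v ≠ C.min) : ∃ e, (e ∈ C.left ∨ e ∈ C.right) ∧ D.top e = v := by
  have key : ∀ c, C.IsSide c → v ∈ c.map D.bot → ∃ e ∈ c, D.top e = v := by
    intro c hc hv
    obtain ⟨e, he, rfl⟩ := List.mem_map.1 hv
    exact (hc.path.bot_eq_or he).resolve_left hmin
  rcases hv with rfl | hv | hv
  · obtain ⟨e, he, h⟩ := C.path_left.exists_top C.isSide_left.ne_nil
    exact ⟨e, Or.inl he, h⟩
  · obtain ⟨e, he, h⟩ := key _ C.isSide_left hv
    exact ⟨e, Or.inl he, h⟩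
  · obtain ⟨e, he, h⟩ := key _ C.isSide_right hv
    exact ⟨e, Or.inr he, h⟩

end FaceChains

namespace FaceChains.Labelling

variable {C : D.FaceChains F} {I O : Type*} {f : I → D.E} {g : O → D.E}
  (hfg : C.Labelling f g) {T : Finset (I × O)}

open Classical in
/-- The key by which the vertices of a face are sorted in the linear extension that corresponds to a
noncrossing tree. -/
noncomputable def key (C : D.FaceChains F) (f : I → D.E) (g : O → D.E) (T : Finset (I × O))
    (v : V) : ℕ :=
  -- This exceeds all rank sums, so the minimum comes last. Any other vertex gets the least rank sum
  -- of a tree edge with a component that starts there.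
  if v = C.min then C.right.length + C.left.length
  else sInf {k | ∃ a ∈ T, k = C.right.pos (f a.1) + C.left.pos (g a.2) ∧
    (D.top (f a.1) = v ∨ D.top (g a.2) = v)}

include hfg

theorem rank_lt (a : I × O) : C.right.pos (f a.1) + C.left.pos (g a.2) <
    C.right.length + C.left.length :=
  add_lt_add (List.pos_lt_length (hfg.right_mem a.1)) (List.pos_lt_length (hfg.left_mem a.2))

theorem key_le {a : I × O} (ha : a ∈ T) {v : V} (h : D.top (f a.1) = v ∨ D.top (g a.2) = v) :
    key C f g T v ≤ C.right.pos (f a.1) + C.left.pos (g a.2) := by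
  have hv : v ≠ C.min := by
    rcases h with rfl | rfl
    exacts [C.isSide_right.top_ne_min (hfg.right_mem _), C.isSide_left.top_ne_min (hfg.left_mem _)]
  rw [key, if_neg hv]
  exact Nat.sInf_le ⟨a, ha, rfl, h⟩

variable (hT : (pairGraph T).IsTree)
include hT

theorem exists_key_eq {v : V}
    (hv : v = C.max ∨ v ∈ C.left.map D.bot ∨ v ∈ C.right.map D.bot) (hmin : v ≠ C.min) :
    ∃ a ∈ T, key C f g T v = C.right.pos (f a.1) + C.left.pos (g a.2) ∧
      (D.top (f a.1) = v ∨ D.top (g a.2) = v) := by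
  have := hfg.nonempty_right
  have := hfg.nonempty_left
  have := hfg.finite_right
  have := hfg.finite_left
  rw [key, if_neg hmin]
  refine Nat.sInf_mem (s := {k | ∃ a ∈ T, k = C.right.pos (f a.1) + C.left.pos (g a.2) ∧
    (D.top (f a.1) = v ∨ D.top (g a.2) = v)}) ?_
  obtain ⟨e, he | he, h⟩ := C.exists_top_eq hv hmin
  · obtain ⟨o, rfl⟩ := (hfg.mem_left e).1 he
    obtain ⟨i, hi⟩ := exists_mem_right hT.connected o
    exact ⟨_, (i, o), hi, rfl, Or.inr h⟩
  · obtain ⟨i, rfl⟩ := (hfg.mem_right e).1 he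
    obtain ⟨o, ho⟩ := exists_mem_left hT.connected i
    exact ⟨_, (i, o), ho, rfl, Or.inl h⟩

variable (hTn : ∀ a ∈ T, ∀ b ∈ T, C.right.pos (f a.1) < C.right.pos (f b.1) →
  ¬ C.left.pos (g b.2) < C.left.pos (g a.2))
include hTn

/-- Let `b` attain the key of `v`. Away from the extremes `v` is on one chain only, where the edge
of `a` ending at `v` and the edge of `b` starting at `v` are consecutive; noncrossing keeps the
other rank from decreasing. -/
theorem rank_lt_key {a : I × O} (ha : a ∈ T) {v : V} (h : D.bot (f a.1) = v ∨ D.bot (g a.2) = v) :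
    C.right.pos (f a.1) + C.left.pos (g a.2) < key C f g T v := by
  by_cases hmin : v = C.min
  · rw [key, if_pos hmin]
    exact hfg.rank_lt a
  have hr := hfg.right_mem
  have hl := hfg.left_mem
  have hmv : v ∈ C.left.map D.bot ∨ v ∈ C.right.map D.bot := by
    rcases h with rfl | rfl
    exacts [Or.inr (List.mem_map.2 ⟨_, hr _, rfl⟩), Or.inl (List.mem_map.2 ⟨_, hl _, rfl⟩)]
  have hmax : v ≠ C.max := by
    rcases h with rfl | rfl
    exacts [C.isSide_right.bot_ne_max (hr _), C.isSide_left.bot_ne_max (hl _)]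
  obtain ⟨b, hb, hbk, hbv⟩ := hfg.exists_key_eq hT (Or.inr hmv) hmin
  rw [hbk]
  have h1 := hTn a ha b hb
  have h2 := hTn b hb a ha
  have hside : ∀ {c c' : List D.E} {e e' : D.E}, C.IsSide c → C.IsSide c' → e ∈ c → e' ∈ c' →
      D.bot e = v → D.top e' = v → c = c' := by
    intro c c' e e' hc hc' he he' h h'
    by_contra hne
    rcases hc.eq_max_or_eq_min hc' hne (Or.inr (List.mem_map.2 ⟨e, he, h⟩))
      (h' ▸ hc'.top_mem he') with h3 | h3
    exacts [hmax h3, hmin h3]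
  by_cases hlr : C.left = C.right
  · exact absurd (C.eq_min v (hmv.elim id fun h => hlr ▸ h) (hmv.elim (fun h => hlr ▸ h) id)) hmin
  rcases h with h | h <;> rcases hbv with h' | h'
  · have h3 := C.isSide_right.pos_eq_of_top_eq_bot (hr a.1) (hr b.1) (h'.trans h.symm)
    omega
  · exact absurd (hside C.isSide_right C.isSide_left (hr a.1) (hl b.2) h h').symm hlr
  · exact absurd (hside C.isSide_left C.isSide_right (hl a.2) (hr b.1) h h') hlr
  · have h3 := C.isSide_left.pos_eq_of_top_eq_bot (hl a.2) (hl b.2) (h'.trans h.symm)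
    omega

/-- Sort the vertices by their keys. By `key_le` and `rank_lt_key`, the pairs of `T` overlap in the
resulting list. All overlapping pairs form a tree, too, and trees on the same vertices have equally
many edges. -/
theorem exists_linearExtension :
    ∃ L : D.LinearExtension F, ∀ i o, (i, o) ∈ T ↔ Overlap L (f i) (g o) := by
  classical
  have := hfg.nonempty_right
  have := hfg.nonempty_left
  have := hfg.finite_right
  have := hfg.finite_left
  obtain ⟨l, hl, hmem, hpw⟩ := exists_sorted_list
    (insert C.max ((C.left.map D.bot).toFinset ∪ (C.right.map D.bot).toFinset)) (key C f g T)
  simp only [Finset.mem_insert, Finset.mem_union, List.mem_toFinset] at hmem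
  have hpos : ∀ u ∈ l, ∀ v ∈ l, key C f g T u < key C f g T v → l.pos u < l.pos v := by
    intro u hu v hv h
    by_contra h1
    rcases (not_lt.1 h1).eq_or_lt with h2 | h2
    · rw [List.eq_of_pos_eq hv h2] at h
      exact h.false
    · exact (hpw.of_pos_lt hv hu h2).not_gt h
  have hvl : ∀ {e v}, D.IsBoundary F e → (v = D.bot e ∨ v = D.top e) → v ∈ l := fun he hv =>
    (hmem _).2 (C.vert_iff.1 ⟨_, he, hv⟩)
  have hsub : ∀ e, D.IsBoundary F e → [D.top e, D.bot e].Sublist l := by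
    intro e he
    rw [hl.pair_sublist_iff_pos]
    refine ⟨hvl he (Or.inr rfl), hvl he (Or.inl rfl),
      hpos _ (hvl he (Or.inr rfl)) _ (hvl he (Or.inl rfl)) ?_⟩
    rcases C.isBoundary_iff.1 he with he | he
    · obtain ⟨o, rfl⟩ := (hfg.mem_left e).1 he
      obtain ⟨i, hi⟩ := exists_mem_right hT.connected o
      exact (hfg.key_le hi (Or.inr rfl)).trans_lt (hfg.rank_lt_key hT hTn hi (Or.inr rfl))
    · obtain ⟨i, rfl⟩ := (hfg.mem_right e).1 he
      obtain ⟨o, ho⟩ := exists_mem_left hT.connected i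
      exact (hfg.key_le ho (Or.inl rfl)).trans_lt (hfg.rank_lt_key hT hTn ho (Or.inl rfl))
  set L : D.LinearExtension F := ⟨l, hl, fun v => (hmem v).trans C.vert_iff.symm, hsub⟩
  have := Fintype.ofFinite I
  have := Fintype.ofFinite O
  set T' : Finset (I × O) := {a | Overlap L (f a.1) (g a.2)} with hT'
  have hT'm : ∀ i o, (i, o) ∈ T' ↔ Overlap L (f i) (g o) := fun i o => by
    rw [hT', Finset.mem_filter]
    exact and_iff_right (Finset.mem_univ _)
  have hTT' : T ⊆ T' := by
    rintro ⟨i, o⟩ ha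
    rw [hT'm]
    have hi := hfg.right_isBoundary i
    have ho := hfg.left_isBoundary o
    constructor
    · exact hpos _ (hvl hi (Or.inr rfl)) _ (hvl ho (Or.inl rfl))
        ((hfg.key_le ha (Or.inl rfl)).trans_lt (hfg.rank_lt_key hT hTn ha (Or.inr rfl)))
    · exact hpos _ (hvl ho (Or.inr rfl)) _ (hvl hi (Or.inl rfl))
        ((hfg.key_le ha (Or.inr rfl)).trans_lt (hfg.rank_lt_key hT hTn ha (Or.inl rfl)))
  have h1 := card_of_isTree hT
  have h2 := card_of_isTree (hfg.isTree_of_overlap hT'm)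
  refine ⟨L, fun i o => ?_⟩
  rw [Finset.eq_of_subset_of_card_le hTT' (by omega), hT'm]

end FaceChains.Labelling

/-! ### The segments of a linear extension -/

/-- The face on the right (`true`) or on the left (`false`) of an edge. -/
def face (D : Diagram V) : Bool → D.E → Set (ℝ × ℝ)
  | true => D.right
  | false => D.left

/-- The left (`true`) or the right (`false`) boundary chain. -/
def FaceChains.chain (C : D.FaceChains F) : Bool → List D.E
  | true => C.left
  | false => C.right

/-- The edge of the left (`true`) or of the right (`false`) boundary that is glued at a segment. -/
def Segment.edge {L : D.LinearExtension F} (s : Segment L) : Bool → D.E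
  | true => s.leftEdge
  | false => s.rightEdge

namespace FaceChains

variable (C : D.FaceChains F)

theorem mem_chain {b : Bool} {e : D.E} : e ∈ C.chain b ↔ D.face b e = F := by
  cases b
  exacts [C.mem_right e, C.mem_left e]

theorem isSide_chain (b : Bool) : C.IsSide (C.chain b) := by
  cases b
  exacts [C.isSide_right, C.isSide_left]

end FaceChains

namespace Segment

variable {C : D.FaceChains F} {L : D.LinearExtension F}

theorem face_edge (s : Segment L) (b : Bool) : D.face b (s.edge b) = F := by
  cases b
  exacts [s.left_rightEdge, s.right_leftEdge]

theorem edge_mem (C : D.FaceChains F) (s : Segment L) (b : Bool) : s.edge b ∈ C.chain b :=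
  C.mem_chain.2 (s.face_edge b)

theorem edge_isBoundary (s : Segment L) (b : Bool) : D.IsBoundary F (s.edge b) := by
  cases b
  exacts [Or.inr s.left_rightEdge, Or.inl s.right_leftEdge]

theorem upper_mem (s : Segment L) : s.upper ∈ L.1 :=
  (L.2.1.pair_infix_iff_pos.1 s.consecutive).1

theorem lower_mem (s : Segment L) : s.lower ∈ L.1 :=
  (L.2.1.pair_infix_iff_pos.1 s.consecutive).2.1

theorem pos_lower (s : Segment L) : L.1.pos s.lower = L.1.pos s.upper + 1 :=
  (L.2.1.pair_infix_iff_pos.1 s.consecutive).2.2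

theorem within_iff {a b : V} (ha : a ∈ L.1) (hb : b ∈ L.1) {e : D.E} (he : D.IsBoundary F e) :
    Within L a b e ↔ L.1.pos (D.top e) ≤ L.1.pos a ∧ L.1.pos b ≤ L.1.pos (D.bot e) := by
  have ht := L.top_mem he
  have hbt := L.bot_mem he
  rw [Within, L.2.1.pair_sublist_iff_pos, L.2.1.pair_sublist_iff_pos]
  refine and_congr ⟨?_, fun h => ?_⟩ ⟨?_, fun h => ?_⟩
  · rintro (rfl | h)
    exacts [le_rfl, h.2.2.le]
  · rcases h.eq_or_lt with h | h
    exacts [Or.inl (List.eq_of_pos_eq ht h), Or.inr ⟨ht, ha, h⟩]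
  · rintro (rfl | h)
    exacts [le_rfl, h.2.2.le]
  · rcases h.eq_or_lt with h | h
    exacts [Or.inl (List.eq_of_pos_eq hb h), Or.inr ⟨hb, hbt, h⟩]

theorem pos_le (s : Segment L) (b : Bool) : L.1.pos (D.top (s.edge b)) ≤ L.1.pos s.upper ∧
    L.1.pos s.upper < L.1.pos (D.bot (s.edge b)) := by
  have h : Within L s.upper s.lower (s.edge b) := by
    cases b
    exacts [s.within_right, s.within_left]
  have h1 := (within_iff s.upper_mem s.lower_mem (s.edge_isBoundary b)).1 h
  have h2 := s.pos_lower
  omega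

include C in
theorem edge_eq_iff {s : Segment L} {b : Bool} {e : D.E} (he : e ∈ C.chain b) :
    s.edge b = e ↔ L.1.pos (D.top e) ≤ L.1.pos s.upper ∧ L.1.pos s.upper < L.1.pos (D.bot e) := by
  constructor
  · rintro rfl
    exact s.pos_le b
  · rintro ⟨h1, h2⟩
    exact LinearExtension.cover_unique (C.isSide_chain b) (s.edge_mem C b) he (s.pos_le b).1
      (s.pos_le b).2 h1 h2

include C in
theorem eq_of_pos_upper_eq {s s' : Segment L} (h : L.1.pos s.upper = L.1.pos s'.upper) :
    s = s' := by
  have h1 : s.upper = s'.upper := List.eq_of_pos_eq s.upper_mem h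
  have h2 : s.lower = s'.lower := List.eq_of_pos_eq s.lower_mem (by rw [pos_lower, pos_lower, h])
  have h3 : ∀ b, s.edge b = s'.edge b := fun b =>
    (edge_eq_iff (s'.edge_mem C b)).2 (h ▸ s'.pos_le b)
  have h4 : s.leftEdge = s'.leftEdge := h3 true
  have h5 : s.rightEdge = s'.rightEdge := h3 false
  cases s
  cases s'
  simp only at h1 h2 h4 h5
  subst h1 h2 h4 h5
  rfl

include C in
theorem exists_pos_upper_eq {k : ℕ} (hk : k + 1 < L.1.length) :
    ∃ s : Segment L, L.1.pos s.upper = k := by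
  obtain ⟨a, ha, hak⟩ := L.2.1.exists_pos_eq (k := k) (by omega)
  obtain ⟨b, hb, hbk⟩ := L.2.1.exists_pos_eq hk
  obtain ⟨e, he, he1, he2⟩ := LinearExtension.exists_cover C.isSide_left hk
  obtain ⟨f, hf, hf1, hf2⟩ := LinearExtension.exists_cover C.isSide_right hk
  exact ⟨⟨a, b, e, f, L.2.1.pair_infix_iff_pos.2 ⟨ha, hb, by omega⟩, (C.mem_left e).1 he,
    (C.mem_right f).1 hf, (within_iff ha hb (C.isSide_left.isBoundary he)).2 (by omega),
    (within_iff ha hb (C.isSide_right.isBoundary hf)).2 (by omega)⟩, hak⟩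

include C in
-- The upper end lies on one of the chains, so an edge of the segment starts there. Hence a segment
-- is determined by its two edges.
theorem pos_upper_eq (s : Segment L) : L.1.pos s.upper =
    max (L.1.pos (D.top s.leftEdge)) (L.1.pos (D.top s.rightEdge)) := by
  have h1 := s.pos_le true
  have h2 := s.pos_le false
  simp only [edge] at h1 h2
  refine le_antisymm (le_max_iff.2 ?_) (max_le h1.1 h2.1)
  have hl : s.leftEdge ∈ C.left := (C.mem_left _).2 s.right_leftEdge
  have hr : s.rightEdge ∈ C.right := (C.mem_right _).2 s.left_rightEdge
  rcases (L.mem_iff C).1 s.upper_mem with h | h | h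
  · rw [h, L.pos_max C]
    exact Or.inl (Nat.zero_le _)
  · exact Or.inl ((LinearExtension.not_between C.isSide_left (Or.inr h) hl).resolve_right
      h1.2.not_ge)
  · exact Or.inr ((LinearExtension.not_between C.isSide_right (Or.inr h) hr).resolve_right
      h2.2.not_ge)

theorem overlap (s : Segment L) : Overlap L s.rightEdge s.leftEdge := by
  have h1 := s.pos_le true
  have h2 := s.pos_le false
  simp only [edge] at h1 h2
  constructor <;> omega

include C in
theorem eq_of_edges {s s' : Segment L} (hl : s.leftEdge = s'.leftEdge)
    (hr : s.rightEdge = s'.rightEdge) : s = s' := by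
  refine eq_of_pos_upper_eq (C := C) ?_
  rw [pos_upper_eq (C := C), pos_upper_eq (C := C), hl, hr]

include C in
theorem exists_edges {e f : D.E} (he : e ∈ C.left) (hf : f ∈ C.right) (h : Overlap L f e) :
    ∃ s : Segment L, s.leftEdge = e ∧ s.rightEdge = f := by
  have h1 := L.pos_lt (C.isSide_left.isBoundary he)
  have h2 := L.pos_lt (C.isSide_right.isBoundary hf)
  have h3 := h.1
  have h4 := h.2
  have h5 := List.pos_lt_length (L.bot_mem (C.isSide_left.isBoundary he))
  have h6 := List.pos_lt_length (L.bot_mem (C.isSide_right.isBoundary hf))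
  obtain ⟨s, hs⟩ := exists_pos_upper_eq (C := C) (L := L)
    (k := max (L.1.pos (D.top e)) (L.1.pos (D.top f))) (by omega)
  exact ⟨s, (edge_eq_iff (C := C) (b := true) he).2 (by omega),
    (edge_eq_iff (C := C) (b := false) hf).2 (by omega)⟩

include C in
/-- The segments between two elements of a linear extension form a chain. -/
theorem exists_between {u v : V} (hu : u ∈ L.1) (hv : v ∈ L.1) (huv : L.1.pos u ≤ L.1.pos v) :
    ∃ l : List (Segment L), DownPath upper lower u l v ∧
      (∀ s, s ∈ l ↔ L.1.pos u ≤ L.1.pos s.upper ∧ L.1.pos s.upper < L.1.pos v) ∧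
      l.Pairwise fun s s' => L.1.pos s.upper < L.1.pos s'.upper := by
  obtain ⟨m, hm⟩ := Nat.exists_eq_add_of_le huv
  induction m generalizing u with
  | zero =>
    refine ⟨[], List.eq_of_pos_eq hu (by omega), fun s => ?_, List.Pairwise.nil⟩
    simp only [List.not_mem_nil, false_iff]
    omega
  | succ m ih =>
    have h1 := List.pos_lt_length hv
    obtain ⟨s, hs⟩ := exists_pos_upper_eq (C := C) (L := L) (k := L.1.pos u) (by omega)
    have hs' := s.pos_lower
    obtain ⟨l, hl, hmem, hpw⟩ := ih s.lower_mem (by omega) (by omega)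
    refine ⟨s :: l, ⟨List.eq_of_pos_eq s.upper_mem hs, hl⟩, fun s' => ?_,
      List.Pairwise.cons (fun s' h => ?_) hpw⟩
    · rw [List.mem_cons, hmem]
      constructor
      · rintro (rfl | h) <;> omega
      · intro h
        rcases h.1.eq_or_lt with h2 | h2
        · exact Or.inl (eq_of_pos_upper_eq (C := C) (by omega))
        · exact Or.inr ⟨by omega, h.2⟩
    · have := ((hmem s').1 h).1
      omega

end Segment

end Diagram

theorem DownPath.transGen {V E : Type*} {top bot : E → V} {a b : V} {l : List E}
    (h : DownPath top bot a l b) (hl : l ≠ []) :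
    Relation.TransGen (fun u v => ∃ e, bot e = u ∧ top e = v) b a := by
  induction l generalizing a with
  | nil => exact absurd rfl hl
  | cons e l ih =>
    have h1 : Relation.TransGen (fun u v => ∃ e, bot e = u ∧ top e = v) (bot e) a :=
      Relation.TransGen.single ⟨e, rfl, h.1⟩
    cases l with
    | nil => rwa [← show bot e = b from h.2]
    | cons e' l => exact (ih h.2 (by simp)).trans h1

namespace Diagram

variable {V : Type u} {D : Diagram V} {F : Set (ℝ × ℝ)}

/-! ### The diagram in which a face is replaced by a linear extension -/

/-- An edge that remains when a face is replaced. -/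
def oldEdge (L : D.LinearExtension F) (e : {e : D.E // ¬ D.IsBoundary F e}) : (replace L).E :=
  Sum.inl e

/-- An edge of the chain by which a face is replaced. -/
def newEdge (L : D.LinearExtension F) (s : Segment L) : (replace L).E := Sum.inr s

theorem oldEdge_injective (L : D.LinearExtension F) : Function.Injective (oldEdge L) :=
  Sum.inl_injective

theorem newEdge_injective (L : D.LinearExtension F) : Function.Injective (newEdge L) :=
  Sum.inr_injective

theorem edge_cases {L : D.LinearExtension F} (e : (replace L).E) :
    (∃ e', e = oldEdge L e') ∨ ∃ s, e = newEdge L s := by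
  rcases e with e | s
  exacts [Or.inl ⟨e, rfl⟩, Or.inr ⟨s, rfl⟩]

theorem oldEdge_ne_newEdge {L : D.LinearExtension F} {e : {e : D.E // ¬ D.IsBoundary F e}}
    {s : Segment L} : oldEdge L e ≠ newEdge L s := Sum.inl_ne_inr

/-- The edge of which an edge of the new diagram is a part; for an edge of the new chain, take the
edge of the left (`true`) or of the right (`false`) boundary. -/
def part (L : D.LinearExtension F) (b : Bool) : (replace L).E → D.E :=
  Sum.elim (fun e => e.1) fun s => s.edge b

variable {C : D.FaceChains F} {L : D.LinearExtension F}

/-- A segment has on its right what the right boundary has on its right, but the right boundary is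
named by `false`; hence the negation. -/
theorem face_replace (b : Bool) (e : (replace L).E) :
    (replace L).face b e = D.face b (part L (!b) e) := by
  cases b <;> rcases e with e | e <;> rfl

theorem isBoundary_of_face_not_ne {b : Bool} {e : D.E} (h : D.IsBoundary F e)
    (h' : D.face (!b) e ≠ F) : D.face b e = F := by
  cases b
  · exact h.resolve_left h'
  · exact h.resolve_right h'

include C in
/-- The edges of the new diagram that are part of a given edge form a chain. -/
theorem exists_block {b : Bool} {e : D.E} (he : D.face (!b) e ≠ F) :
    ∃ l : List (replace L).E, l ≠ [] ∧ (∀ e', e' ∈ l ↔ part L b e' = e) ∧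
      DownPath (replace L).top (replace L).bot (D.top e) l (D.bot e) ∧
      (l.map (replace L).bot).Nodup ∧
      l.Pairwise (fun e₁ e₂ => D.face b e = F ∧
        part L (!b) e₁ ∈ C.chain (!b) ∧ part L (!b) e₂ ∈ C.chain (!b) ∧
        (C.chain (!b)).pos (part L (!b) e₁) < (C.chain (!b)).pos (part L (!b) e₂)) ∧
      ∀ e' ∈ l, (replace L).bot e' = D.bot e ∨ D.face b e = F ∧
        (replace L).bot e' ∈ (C.chain (!b)).map D.bot ∧ (replace L).bot e' ≠ C.min ∧
        L.1.pos (D.top e) < L.1.pos ((replace L).bot e') ∧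
        L.1.pos ((replace L).bot e') < L.1.pos (D.bot e) := by
  -- A boundary edge is cut into the segments within it; any other edge stays whole.
  by_cases hb : D.IsBoundary F e
  · have hbF := isBoundary_of_face_not_ne hb he
    have hec : e ∈ C.chain b := C.mem_chain.2 hbF
    have hlt := L.pos_lt hb
    obtain ⟨l, hl, hmem, hpw⟩ := Segment.exists_between (C := C) (L.top_mem hb) (L.bot_mem hb)
      hlt.le
    have hmem' : ∀ s, s ∈ l ↔ s.edge b = e := fun s => by
      rw [hmem, Segment.edge_eq_iff hec]
    refine ⟨l.map (newEdge L), ?_, ?_, ?_, ?_, ?_, ?_⟩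
    · rintro h
      rw [List.map_eq_nil_iff] at h
      subst h
      rw [show D.top e = D.bot e from hl] at hlt
      exact hlt.false
    · intro e'
      rcases edge_cases e' with ⟨e', rfl⟩ | ⟨s, rfl⟩
      · refine ⟨fun h => ?_, ?_⟩
        · obtain ⟨s, -, h⟩ := List.mem_map.1 h
          exact absurd h.symm oldEdge_ne_newEdge
        · rintro rfl
          exact absurd hb e'.2
      · rw [List.mem_map_of_injective (newEdge_injective L), hmem']
        rfl
    · clear hmem hmem' hpw
      generalize D.top e = a at hl
      induction l generalizing a with
      | nil => exact hl
      | cons s l ih => exact ⟨hl.1, ih _ hl.2⟩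
    · rw [List.map_map]
      refine List.Nodup.of_map L.1.pos ?_
      rw [List.map_map]
      refine (List.pairwise_map.2 (hpw.imp fun {s s'} h => ?_))
      have h1 := s.pos_lower
      have h2 := s'.pos_lower
      change L.1.pos s.lower ≠ L.1.pos s'.lower
      omega
    -- Different segments within `e` have different edges on the opposite chain, as the pair of
    -- edges determines a segment, and these edges occur in the order of the segments.
    · refine List.pairwise_map.2 (hpw.imp_of_mem fun {s s'} hs hs' h => ?_)
      refine ⟨hbF, s.edge_mem C _, s'.edge_mem C _, ?_⟩
      change (C.chain (!b)).pos (s.edge (!b)) < (C.chain (!b)).pos (s'.edge (!b))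
      by_contra h1
      rcases (not_lt.1 h1).eq_or_lt with h2 | h2
      · have h3 := List.eq_of_pos_eq (s'.edge_mem C _) h2
        have h4 : s.edge b = s'.edge b := ((hmem' s).1 hs).trans ((hmem' s').1 hs').symm
        have h5 : s = s' := by
          cases b
          · exact Segment.eq_of_edges (C := C) h3.symm h4
          · exact Segment.eq_of_edges (C := C) h4 h3.symm
        rw [h5] at h
        exact h.false
      · have h3 := LinearExtension.pos_bot_le_pos_top (L := L) (C.isSide_chain (!b))
          (s'.edge_mem C _) (s.edge_mem C _) h2
        have h4 := s.pos_le (!b)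
        have h5 := s'.pos_le (!b)
        omega
    -- A lower end strictly inside `e` is not on the chain of `e`, so it is on the opposite chain.
    · intro e' he'
      obtain ⟨s, hs, rfl⟩ := List.mem_map.1 he'
      have h1 := s.pos_lower
      have h2 := (hmem s).1 hs
      change s.lower = _ ∨ _ ∧ s.lower ∈ _ ∧ s.lower ≠ _ ∧ _ < L.1.pos s.lower ∧
        L.1.pos s.lower < _
      by_cases h3 : L.1.pos s.lower = L.1.pos (D.bot e)
      · exact Or.inl (List.eq_of_pos_eq s.lower_mem h3)
      · have h4 := (LinearExtension.bounds (L := L) (C.isSide_chain b) hec).2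
        refine Or.inr ⟨hbF, ?_, fun h => ?_, by omega, by omega⟩
        · have h5 : ¬ (s.lower = C.max ∨ s.lower ∈ (C.chain b).map D.bot) := fun h5 => by
            have := LinearExtension.not_between (L := L) (C.isSide_chain b) h5 hec
            omega
          have h6 := (L.mem_iff C).1 s.lower_mem
          rw [not_or] at h5
          cases b
          · exact (h6.resolve_left h5.1).resolve_right h5.2
          · exact (h6.resolve_left h5.1).resolve_left h5.2
        · rw [h] at h3 h1
          omega
  · refine ⟨[oldEdge L ⟨e, hb⟩], by simp, fun e' => ?_, ⟨rfl, rfl⟩, by simp, by simp, ?_⟩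
    · rw [List.mem_singleton]
      rcases edge_cases e' with ⟨e', rfl⟩ | ⟨s, rfl⟩
      · rw [(oldEdge_injective L).eq_iff, Subtype.ext_iff]
        rfl
      · refine ⟨fun h => absurd h.symm oldEdge_ne_newEdge, ?_⟩
        rintro rfl
        exact absurd (s.edge_isBoundary b) hb
    · intro e' he'
      rw [List.mem_singleton.1 he']
      exact Or.inl rfl

theorem exists_face_not_ne (hD : ∀ e, D.left e ≠ D.right e) (e : D.E) :
    ∃ b, D.face (!b) e ≠ F := by
  by_cases h : D.left e = F
  · exact ⟨false, fun h' => hD e (h.trans h'.symm)⟩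
  · exact ⟨true, h⟩

include C in
-- Every edge turns into a nonempty descending path: no edge has `F` on both sides, so
-- `exists_block` applies for one of the two values of `b`.
theorem lt_replace (hD : ∀ e, D.left e ≠ D.right e) {a b : V} (h : D.lt a b) :
    (replace L).lt a b := by
  refine Relation.TransGen.trans_induction_on h (fun h => ?_) fun _ _ => Relation.TransGen.trans
  obtain ⟨e, rfl, rfl⟩ := h
  obtain ⟨b, hb⟩ := exists_face_not_ne (F := F) hD e
  obtain ⟨l, h1, -, h2, -⟩ := exists_block (C := C) (L := L) hb
  exact h2.transGen h1

include C in
theorem exists_bot_eq_replace (e : (replace L).E) : ∃ e', (replace L).bot e = D.bot e' := by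
  rcases e with e | s
  · exact ⟨e.1, rfl⟩
  · change ∃ e', s.lower = D.bot e'
    rcases (L.mem_iff C).1 s.lower_mem with h | h | h
    · have h1 := s.pos_lower
      rw [h, L.pos_max C] at h1
      omega
    all_goals
      obtain ⟨e, -, h⟩ := List.mem_map.1 h
      exact ⟨e, h.symm⟩

include C in
theorem exists_top_eq_replace (e : (replace L).E) : ∃ e', (replace L).top e = D.top e' := by
  rcases e with e | s
  · exact ⟨e.1, rfl⟩
  · change ∃ e', s.upper = D.top e'
    obtain ⟨e, -, h⟩ := C.exists_top_eq ((L.mem_iff C).1 s.upper_mem) fun h => by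
      have h1 := s.pos_lower
      have h2 := List.pos_lt_length s.lower_mem
      have h3 := L.pos_min C
      rw [h] at h1
      omega
    exact ⟨e, h.symm⟩

end Diagram

/-! ### Compounded reductions -/

theorem sum_filter_comp {α β : Type*} [Fintype α] [Fintype β] [DecidableEq β] (h : α → β)
    (p : β → Prop) [DecidablePred p] [DecidablePred fun a => p (h a)] (g : α → ℝ) :
    ∑ b with p b, ∑ a with h a = b, g a = ∑ a with p (h a), g a := by
  rw [← Finset.sum_fiberwise_of_maps_to (s := Finset.univ.filter fun a => p (h a))
    (t := Finset.univ.filter p) (g := h) (fun a ha => by simpa using ha)]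
  refine Finset.sum_congr rfl fun b hb => Finset.sum_congr ?_ fun _ _ => rfl
  ext a
  simp only [Finset.mem_filter, Finset.mem_univ, true_and] at hb ⊢
  exact ⟨fun h => ⟨h ▸ hb, h⟩, fun h => h.2⟩

namespace FlowNetwork

variable {V : Type u} (N : FlowNetwork V)

/-- The tail (`true`) or the head (`false`) of an edge. -/
def endp : Bool → N.E → V
  | true => N.tail
  | false => N.head

/-- The order of the outgoing (`true`) or of the incoming (`false`) edges. -/
def above : Bool → N.E → N.E → Prop
  | true => N.outAbove
  | false => N.inAbove

variable {N} {w : V} (T : N.NoncrossingTree w)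

/-- The last (`true`) or the first (`false`) edge of which an edge of the reduced network is
formed. -/
def side : Bool → (reduce T).E → N.E
  | true => last T
  | false => first T

variable {T}

theorem endp_reduce (b : Bool) (e : (reduce T).E) :
    (reduce T).endp b e = N.endp b (side T (!b) e) := by
  cases b <;> rfl

theorem above_reduce (b : Bool) (e e' : (reduce T).E) : (reduce T).above b e e' ↔
    N.above b (side T (!b) e) (side T (!b) e') ∨
      side T (!b) e = side T (!b) e' ∧ N.above b (side T b e) (side T b e') := by
  cases b <;> rfl

variable (T) in
/-- An edge that is not incident to the deleted vertex. -/
def oldEdge (e : {e : N.E // N.tail e ≠ w ∧ N.head e ≠ w}) : (reduce T).E := Sum.inl e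

variable (T) in
/-- The edge of the reduced network for an edge of the tree. -/
def newEdge (a : {a // a ∈ T.1}) : (reduce T).E := Sum.inr a

theorem edge_cases (e : (reduce T).E) : (∃ e', e = oldEdge T e') ∨ ∃ a, e = newEdge T a := by
  rcases e with e | a
  exacts [Or.inl ⟨e, rfl⟩, Or.inr ⟨a, rfl⟩]

theorem endp_side_newEdge (b : Bool) (a : {a // a ∈ T.1}) :
    N.endp b (side T b (newEdge T a)) = w := by
  cases b
  exacts [a.1.1.2, a.1.2.2]

theorem endp_ne (b : Bool) (e : {e : N.E // N.tail e ≠ w ∧ N.head e ≠ w}) : N.endp b e.1 ≠ w := by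
  cases b
  exacts [e.2.2, e.2.1]

theorem side_oldEdge (b : Bool) (e : {e : N.E // N.tail e ≠ w ∧ N.head e ≠ w}) :
    side T b (oldEdge T e) = e.1 := by
  cases b <;> rfl

open Classical in
-- An edge that does not end at `w` (`b = true`) is not the first part of a tree edge; one that does
-- not begin there (`b = false`) is not the last part. So one alternative in `lift` suffices.
theorem lift_eq {b : Bool} {e : N.E} (he : N.endp (!b) e ≠ w) (g : (reduce T).E → ℝ) :
    lift T g e = ∑ e' with side T b e' = e, g e' := by
  have h0 : lift T g e =
    ∑ e', if side T false e' = e ∨ side T true e' = e then g e' else 0 := rfl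
  rw [h0, ← Finset.sum_filter]
  refine Finset.sum_congr (Finset.filter_congr fun e' _ => ?_) fun _ _ => rfl
  have h : side T (!b) e' = e → side T b e' = e := by
    rintro rfl
    rcases edge_cases e' with ⟨e', rfl⟩ | ⟨a, rfl⟩
    · rw [side_oldEdge, side_oldEdge]
    · exact absurd (endp_side_newEdge _ a) he
  cases b
  · exact ⟨fun h' => h'.elim id h, Or.inl⟩
  · exact ⟨fun h' => h'.elim h id, Or.inr⟩

theorem exists_endp_not_ne (hN : ∀ b e, N.endp b e = w → N.endp (!b) e ≠ w) (e : N.E) :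
    ∃ b, N.endp (!b) e ≠ w := by
  by_cases h : N.endp false e = w
  exacts [⟨false, hN _ _ h⟩, ⟨true, h⟩]

theorem lift_nonneg (hN : ∀ b e, N.endp b e = w → N.endp (!b) e ≠ w) {g : (reduce T).E → ℝ} (hg : ∀ e, 0 ≤ g e)
    (e : N.E) : 0 ≤ lift T g e := by
  classical
  obtain ⟨b, hb⟩ := exists_endp_not_ne (w := w) hN e
  rw [lift_eq hb]
  exact Finset.sum_nonneg fun e _ => hg e

open Classical in
theorem sum_endp_lift {b : Bool} {v : V} (hv : v ≠ w) (g : (reduce T).E → ℝ) :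
    ∑ e with N.endp b e = v, lift T g e = ∑ e with (reduce T).endp b e = v, g e := by
  have h := sum_filter_comp (side T (!b)) (fun e => N.endp b e = v) g
  refine Eq.trans ?_ (h.trans (Finset.sum_congr (Finset.filter_congr fun e _ => by
    rw [endp_reduce]) fun _ _ => rfl))
  refine Finset.sum_congr rfl fun e he => lift_eq ?_ g
  rw [Bool.not_not, (Finset.mem_filter.1 he).2]
  exact hv

open Classical in
-- Inflow and outflow at `w` both count every tree edge once, so conservation at `w` is automatic.
theorem sum_endp_lift_self (hN : ∀ b e, N.endp b e = w → N.endp (!b) e ≠ w) (b : Bool) (g : (reduce T).E → ℝ) :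
    ∑ e with N.endp b e = w, lift T g e = ∑ e with ∃ a, e = newEdge T a, g e := by
  have h := sum_filter_comp (side T b) (fun e => N.endp b e = w) g
  rw [Finset.sum_congr (Finset.filter_congr fun e _ => show (∃ a, e = newEdge T a) ↔
    N.endp b (side T b e) = w from ?_) fun _ _ => rfl, ← h]
  · exact Finset.sum_congr rfl fun e he => lift_eq (hN _ _ (Finset.mem_filter.1 he).2) g
  · constructor
    · rintro ⟨a, rfl⟩
      exact endp_side_newEdge _ a
    · intro h
      refine (edge_cases e).resolve_left ?_
      rintro ⟨e', rfl⟩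
      rw [side_oldEdge] at h
      exact endp_ne _ _ h

theorem mem_flowPolytope_reduce_iff (hN : ∀ b e, N.endp b e = w → N.endp (!b) e ≠ w) (hw : N.netflow w = 0)
    (hT : ∀ b e, N.endp (!b) e ≠ w → ∃ e', side T b e' = e) {g : (reduce T).E → ℝ} :
    g ∈ (reduce T).flowPolytope ↔ (∀ e, 0 ≤ g e) ∧ lift T g ∈ N.flowPolytope := by
  classical
  have hinc : ∀ v ≠ w, ∀ b, (∃ e, (reduce T).endp b e = v) ↔ ∃ e, N.endp b e = v := by
    intro v hv b
    constructor
    · rintro ⟨e, rfl⟩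
      exact ⟨_, (endp_reduce b e).symm⟩
    · rintro ⟨e, rfl⟩
      obtain ⟨e', rfl⟩ := hT (!b) e (by rwa [Bool.not_not])
      exact ⟨e', endp_reduce b e'⟩
  have hinc' : ∀ v ≠ w, (∃ e, (reduce T).tail e = v ∨ (reduce T).head e = v) ↔
      ∃ e, N.tail e = v ∨ N.head e = v := by
    intro v hv
    rw [exists_or, exists_or]
    exact or_congr (hinc v hv true) (hinc v hv false)
  have hsum : ∀ v ≠ w, (∑ e with N.tail e = v, lift T g e) - (∑ e with N.head e = v, lift T g e) =
      (∑ e with (reduce T).tail e = v, g e) - (∑ e with (reduce T).head e = v, g e) := by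
    intro v hv
    exact congrArg₂ _ (sum_endp_lift (b := true) hv g) (sum_endp_lift (b := false) hv g)
  constructor
  · rintro ⟨h0, h⟩
    refine ⟨h0, lift_nonneg hN h0, fun v hv => ?_⟩
    by_cases hvw : v = w
    · subst hvw
      rw [hw]
      exact sub_eq_zero.2 ((sum_endp_lift_self hN true g).trans (sum_endp_lift_self hN false g).symm)
    · exact (hsum v hvw).trans (h v ((hinc' v hvw).2 hv))
  · rintro ⟨h0, -, h⟩
    refine ⟨h0, fun v hv => ?_⟩
    have hvw : v ≠ w := by
      rintro rfl
      obtain ⟨e, he⟩ := hv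
      have hb : ∃ b, (reduce T).endp b e = v := he.elim (fun h => ⟨true, h⟩) fun h => ⟨false, h⟩
      obtain ⟨b, hb⟩ := hb
      rw [endp_reduce] at hb
      rcases edge_cases e with ⟨e, rfl⟩ | ⟨a, rfl⟩
      · rw [side_oldEdge] at hb
        exact endp_ne _ _ hb
      · exact hN _ _ hb (endp_side_newEdge (!b) a)
    exact (hsum v hvw).symm.trans (h v ((hinc' v hvw).1 hv))

/-- Induction on the rank sum. By noncrossing, each tree edge is the last one at its incoming or at
its outgoing edge; the lift there, minus the earlier values, determines its value. -/
theorem lift_injective {r : N.In w → ℕ} {s : N.Out w → ℕ} (hr : Function.Injective r)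
    (hs : Function.Injective s)
    (hT : ∀ a ∈ T.1, ∀ b ∈ T.1, r a.1 < r b.1 → ¬ s b.2 < s a.2)
    (hN : ∀ b e, N.endp b e = w → N.endp (!b) e ≠ w) : Function.Injective (lift T) := by
  classical
  intro g g' hgg
  have hsum : ∀ b e, N.endp (!b) e ≠ w → ∑ e' with side T b e' = e, (g e' - g' e') = 0 := by
    intro b e he
    rw [Finset.sum_sub_distrib, ← lift_eq he, ← lift_eq he, hgg, sub_self]
  have hsingle : ∀ b e, N.endp (!b) (side T b e) ≠ w →
      (∀ e', side T b e' = side T b e → e' ≠ e → g e' = g' e') → g e = g' e := by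
    intro b e he h
    refine sub_eq_zero.1 (Eq.trans (Finset.sum_eq_single (f := fun e' => g e' - g' e') e
      (fun e' he' hne => ?_) fun h => ?_).symm (hsum b _ he))
    · exact sub_eq_zero.2 (h e' (Finset.mem_filter.1 he').2 hne)
    · exact (h (Finset.mem_filter.2 ⟨Finset.mem_univ _, rfl⟩)).elim
  have hold : ∀ e, g (oldEdge T e) = g' (oldEdge T e) := by
    intro e
    refine hsingle true _ (by rw [side_oldEdge]; exact endp_ne _ _) fun e' h hne => ?_
    rcases edge_cases e' with ⟨e', rfl⟩ | ⟨a, rfl⟩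
    · rw [side_oldEdge, side_oldEdge] at h
      exact absurd (congrArg (oldEdge T) (Subtype.ext h)) hne
    · exact absurd (h ▸ endp_side_newEdge true a) (by rw [side_oldEdge]; exact endp_ne _ _)
  have hloop : ∀ b a, N.endp (!b) (side T b (newEdge T a)) ≠ w := fun b a =>
    hN _ _ (endp_side_newEdge b a)
  have hnew : ∀ n, ∀ a : {a // a ∈ T.1}, r a.1.1 + s a.1.2 = n →
      g (newEdge T a) = g' (newEdge T a) := by
    intro n
    induction n using Nat.strong_induction_on with
    | _ n ih =>
      intro a ha
      have hb : ∃ b, ∀ a' : {a // a ∈ T.1}, side T b (newEdge T a') = side T b (newEdge T a) →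
          a' ≠ a → r a'.1.1 + s a'.1.2 < n := by
        by_contra hcon
        simp only [not_exists, not_forall, not_lt, exists_prop] at hcon
        obtain ⟨a', h1, h2, h3⟩ := hcon false
        obtain ⟨a'', h4, h5, h6⟩ := hcon true
        have h1' : a'.1.1 = a.1.1 := Subtype.ext h1
        have h4' : a''.1.2 = a.1.2 := Subtype.ext h4
        have h7 : s a'.1.2 ≠ s a.1.2 := fun h => h2 (Subtype.ext (Prod.ext h1' (hs h)))
        have h8 : r a''.1.1 ≠ r a.1.1 := fun h => h5 (Subtype.ext (Prod.ext (hr h) h4'))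
        -- `a'` shares the incoming edge of `a` and has a later outgoing one; for `a''` it is the
        -- other way round. So they cross.
        refine hT a'.1 a'.2 a''.1 a''.2 ?_ ?_
        · rw [h1']
          rw [h4'] at h6
          omega
        · rw [h4']
          rw [h1'] at h3
          omega
      obtain ⟨b, hb⟩ := hb
      refine hsingle b _ (hloop b a) fun e' h hne => ?_
      rcases edge_cases e' with ⟨e', rfl⟩ | ⟨a', rfl⟩
      · exact hold e'
      · exact ih _ (hb a' h fun h' => hne (h' ▸ rfl)) a' rfl
  funext e
  rcases edge_cases e with ⟨e, rfl⟩ | ⟨a, rfl⟩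
  exacts [hold e, hnew _ a rfl]

end FlowNetwork

/-! ### Linear extensions of a face and compounded reductions at its vertex -/

namespace Diagram

variable {V W : Type u} {D : Diagram V} {F : Set (ℝ × ℝ)} {C : D.FaceChains F}
  {N : FlowNetwork W} {w : W} {φ : N.E ≃ D.E}

/-- The vertex `w` of a network, whose edges are labelled by those of a diagram, belongs to a face of
the diagram. -/
structure FaceChains.IsVertex (C : D.FaceChains F) (N : FlowNetwork W) (w : W) (φ : N.E ≃ D.E) :
    Prop where
  endp_iff : ∀ b e, N.endp b e = w ↔ D.face b (φ e) = F
  above_iff : ∀ b e e', φ e ∈ C.chain b → φ e' ∈ C.chain b →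
    (N.above b e e' ↔ (C.chain b).pos (φ e) < (C.chain b).pos (φ e'))

namespace FaceChains.IsVertex

variable (hw : C.IsVertex N w φ)
include hw

theorem mem_chain_iff {b : Bool} {e : N.E} : φ e ∈ C.chain b ↔ N.endp b e = w :=
  C.mem_chain.trans (hw.endp_iff b e).symm

theorem labelling : C.Labelling (fun i : N.In w => φ i.1) fun o : N.Out w => φ o.1 where
  injective_right _ _ h := Subtype.ext (φ.injective h)
  injective_left _ _ h := Subtype.ext (φ.injective h)
  mem_right e := by
    refine ⟨fun he => ?_, ?_⟩
    · obtain ⟨e, rfl⟩ := φ.surjective e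
      exact ⟨⟨e, (hw.mem_chain_iff (b := false)).1 he⟩, rfl⟩
    · rintro ⟨i, rfl⟩
      exact (hw.mem_chain_iff (b := false)).2 i.2
  mem_left e := by
    refine ⟨fun he => ?_, ?_⟩
    · obtain ⟨e, rfl⟩ := φ.surjective e
      exact ⟨⟨e, (hw.mem_chain_iff (b := true)).1 he⟩, rfl⟩
    · rintro ⟨o, rfl⟩
      exact (hw.mem_chain_iff (b := true)).2 o.2

theorem inAbove_iff (i i' : N.In w) :
    N.inAbove i.1 i'.1 ↔ C.right.pos (φ i.1) < C.right.pos (φ i'.1) :=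
  hw.above_iff false _ _ (hw.labelling.right_mem i) (hw.labelling.right_mem i')

theorem outAbove_iff (o o' : N.Out w) :
    N.outAbove o.1 o'.1 ↔ C.left.pos (φ o.1) < C.left.pos (φ o'.1) :=
  hw.above_iff true _ _ (hw.labelling.left_mem o) (hw.labelling.left_mem o')

theorem noncrossing (T : N.NoncrossingTree w) : ∀ a ∈ T.1, ∀ b ∈ T.1,
    C.right.pos (φ a.1.1) < C.right.pos (φ b.1.1) →
      ¬ C.left.pos (φ b.2.1) < C.left.pos (φ a.2.1) := by
  intro a ha b hb
  rw [← hw.inAbove_iff, ← hw.outAbove_iff]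
  exact T.2.2 a ha b hb

theorem exists_tree (L : D.LinearExtension F) :
    ∃ T : N.NoncrossingTree w, ∀ i o, (i, o) ∈ T.1 ↔ Overlap L (φ i.1) (φ o.1) := by
  have hT : ∀ i o, (i, o) ∈
      (Set.toFinite {a : N.In w × N.Out w | Overlap L (φ a.1.1) (φ a.2.1)}).toFinset ↔
      Overlap L (φ i.1) (φ o.1) := fun i o => Set.Finite.mem_toFinset _
  refine ⟨⟨_, hw.labelling.isTree_of_overlap hT, fun a ha b hb => ?_⟩, hT⟩
  rw [hw.inAbove_iff, hw.outAbove_iff]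
  exact hw.labelling.noncrossing_of_overlap ((hT _ _).1 ha) ((hT _ _).1 hb)

/-- The linear extensions of a face correspond to the noncrossing trees at its vertex. -/
theorem exists_equiv : ∃ γ : D.LinearExtension F ≃ N.NoncrossingTree w,
    ∀ L i o, (i, o) ∈ (γ L).1 ↔ Overlap L (φ i.1) (φ o.1) := by
  choose γ hγ using hw.exists_tree
  refine ⟨Equiv.ofBijective γ ⟨fun L L' h => ?_, fun T => ?_⟩, hγ⟩
  · refine LinearExtension.eq_of_overlap_iff (C := C) fun f hf e he => ?_
    obtain ⟨i, rfl⟩ := (hw.labelling.mem_right f).1 hf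
    obtain ⟨o, rfl⟩ := (hw.labelling.mem_left e).1 he
    rw [← hγ, h, hγ]
  · obtain ⟨L, hL⟩ := hw.labelling.exists_linearExtension T.2.1 (hw.noncrossing T)
    refine ⟨L, Subtype.ext (Finset.ext ?_)⟩
    rintro ⟨i, o⟩
    rw [hγ, hL]

variable {L : D.LinearExtension F} {T : N.NoncrossingTree w}
  (hT : ∀ i o, (i, o) ∈ T.1 ↔ Overlap L (φ i.1) (φ o.1))
include hT

/-- The edges of the reduced network correspond to those of the new diagram. -/
theorem exists_edge_equiv : ∃ φ' : (FlowNetwork.reduce T).E ≃ (replace L).E,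
    ∀ b e, φ (FlowNetwork.side T b e) = part L b (φ' e) := by
  have hs : ∀ a : {a // a ∈ T.1}, ∃ s : Segment L,
      s.leftEdge = φ a.1.2.1 ∧ s.rightEdge = φ a.1.1.1 := fun a =>
    Segment.exists_edges (hw.labelling.left_mem a.1.2) (hw.labelling.right_mem a.1.1)
      ((hT _ _).1 a.2)
  choose σ hl hr using hs
  have hσ : Function.Bijective σ := by
    refine ⟨fun a a' h => ?_, fun s => ?_⟩
    · have h1 := hl a
      have h2 := hr a
      rw [h, hl a'] at h1
      rw [h, hr a'] at h2
      exact Subtype.ext (Prod.ext (Subtype.ext (φ.injective h2.symm))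
        (Subtype.ext (φ.injective h1.symm)))
    · obtain ⟨i, hi⟩ := (hw.labelling.mem_right s.rightEdge).1 (s.edge_mem C false)
      obtain ⟨o, ho⟩ := (hw.labelling.mem_left s.leftEdge).1 (s.edge_mem C true)
      have h := s.overlap
      rw [← hi, ← ho, ← hT] at h
      exact ⟨⟨(i, o), h⟩, Segment.eq_of_edges (C := C) ((hl _).trans ho) ((hr _).trans hi)⟩
  have hold : ∀ e : N.E, (N.tail e ≠ w ∧ N.head e ≠ w) ↔ ¬ D.IsBoundary F (φ e) := by
    intro e
    rw [← not_or]
    exact not_congr (or_congr (hw.endp_iff true e) (hw.endp_iff false e))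
  refine ⟨Equiv.sumCongr (φ.subtypeEquiv hold) (Equiv.ofBijective σ hσ), fun b e => ?_⟩
  rcases e with e | a
  · cases b <;> rfl
  · cases b
    exacts [(hr a).symm, (hl a).symm]

end FaceChains.IsVertex

end Diagram

/-! ### The polytopes after one step -/

namespace Diagram.FaceChains.IsVertex

variable {P : Type u} [PartialOrder P] {M : MarkedPoset P} {W : Type u} {D : Diagram (Hat P)}
  {F : Set (ℝ × ℝ)} {C : D.FaceChains F} {N : FlowNetwork W} {w : W} {φ : N.E ≃ D.E}
  {L : D.LinearExtension F} {T : N.NoncrossingTree w}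
  {φ' : (FlowNetwork.reduce T).E ≃ (replace L).E}

theorem endp_ne (hw : C.IsVertex N w φ) (hD : ∀ e, D.left e ≠ D.right e) (b : Bool) (e : N.E)
    (h : N.endp b e = w) : N.endp (!b) e ≠ w := by
  rw [hw.endp_iff] at h
  rw [Ne, hw.endp_iff]
  intro h'
  refine hD (φ e) ?_
  cases b
  exacts [Eq.trans h h'.symm, Eq.trans h' h.symm]

theorem exists_fiber (hw : C.IsVertex N w φ)
    (hφ : ∀ b e, φ (FlowNetwork.side T b e) = part L b (φ' e)) {b : Bool} {e : N.E}
    (he : N.endp (!b) e ≠ w) : ∃ l : List (FlowNetwork.reduce T).E, l ≠ [] ∧ l.Nodup ∧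
      (∀ e', e' ∈ l ↔ FlowNetwork.side T b e' = e) ∧
      DownPath (fun e => (replace L).top (φ' e)) (fun e => (replace L).bot (φ' e))
        (D.top (φ e)) l (D.bot (φ e)) := by
  rw [Ne, hw.endp_iff] at he
  obtain ⟨l, h1, h2, h3, h4, -⟩ := exists_block (C := C) (L := L) he
  have hl : (l.map φ'.symm).map φ' = l := by simp
  refine ⟨l.map φ'.symm, by simpa using h1, h4.of_map.map φ'.symm.injective, fun e' => ?_, ?_⟩
  · rw [← φ.injective.eq_iff, hφ, ← h2, ← List.mem_map_of_injective φ'.symm.injective,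
      Equiv.symm_apply_apply]
  · rw [← hl] at h3
    exact h3.of_map

/-- The new edges that are part of an old edge descend from its top to its bottom, so their
increments telescope. -/
theorem lift_edgeMap (hw : C.IsVertex N w φ) (hD : ∀ e, D.left e ≠ D.right e)
    (hφ : ∀ b e, φ (FlowNetwork.side T b e) = part L b (φ' e)) (x : P → ℝ) :
    FlowNetwork.lift T (fun e => M.edgeMap (replace L).top (replace L).bot x (φ' e)) =
      fun e => M.edgeMap D.top D.bot x (φ e) := by
  classical
  funext e
  obtain ⟨b, hb⟩ := FlowNetwork.exists_endp_not_ne (hw.endp_ne hD) e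
  obtain ⟨l, -, h1, h2, h3⟩ := hw.exists_fiber hφ hb
  rw [FlowNetwork.lift_eq hb, sum_filter_eq_sum_list h1 h2]
  exact h3.sum_sub (M.extend x)

/-- If the differences map the polytope of a diagram onto the flow polytope of a network, then this
also holds after replacing a face by a linear extension, and reducing the network accordingly. -/
theorem image_edgePolytope_replace (hw : C.IsVertex N w φ) (hD : ∀ e, D.left e ≠ D.right e)
    (hnet : N.netflow w = 0) (hφ : ∀ b e, φ (FlowNetwork.side T b e) = part L b (φ' e))
    (h : (fun x e => M.edgeMap D.top D.bot x (φ e)) '' M.edgePolytope D.top D.bot =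
      N.flowPolytope) :
    (fun x e => M.edgeMap (replace L).top (replace L).bot x (φ' e)) ''
      M.edgePolytope (replace L).top (replace L).bot = (FlowNetwork.reduce T).flowPolytope := by
  have hmem : ∀ x, x ∈ M.edgePolytope (replace L).top (replace L).bot ↔
      (∀ e, 0 ≤ M.edgeMap (replace L).top (replace L).bot x (φ' e)) ∧ ∀ a : M.A, x a = M.mark a := by
    intro x
    refine and_congr_left fun _ => ?_
    rw [φ'.forall_congr_left]
    simp [MarkedPoset.edgeMap]
  have hlift := hw.lift_edgeMap (M := M) hD hφ
  have hN := hw.endp_ne hD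
  have hflow := fun g => FlowNetwork.mem_flowPolytope_reduce_iff (T := T) (g := g) hN hnet fun b e he => by
    obtain ⟨l, h1, -, h2, -⟩ := hw.exists_fiber hφ he
    obtain ⟨e', he'⟩ := List.exists_mem_of_ne_nil _ h1
    exact ⟨e', (h2 e').1 he'⟩
  have hinj := FlowNetwork.lift_injective hw.labelling.rank_right_injective
    hw.labelling.rank_left_injective (hw.noncrossing T) hN
  ext g
  rw [hflow]
  constructor
  · rintro ⟨x, hx, rfl⟩
    obtain ⟨h1, h2⟩ := (hmem x).1 hx
    refine ⟨h1, ?_⟩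
    rw [hlift, ← h]
    refine mem_image_of_mem (fun x e => M.edgeMap D.top D.bot x (φ e)) ⟨fun e => ?_, h2⟩
    have h3 := FlowNetwork.lift_nonneg hN h1 (φ.symm e)
    rw [hlift] at h3
    simpa [MarkedPoset.edgeMap] using h3
  · rintro ⟨h0, h1⟩
    rw [← h] at h1
    obtain ⟨x, hx, hxg⟩ := h1
    -- The new increments of `x` have the same lift as `g`, so they are `g`; nonnegativity of `g`
    -- then makes `x` increase along the new edges.
    have h2 : (fun e => M.edgeMap (replace L).top (replace L).bot x (φ' e)) = g :=
      hinj ((hlift x).trans hxg)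
    refine ⟨x, (hmem x).2 ⟨fun e => ?_, hx.2⟩, h2⟩
    exact (h0 e).trans_eq (congrFun h2 e).symm

end Diagram.FaceChains.IsVertex

/-! ### Families of faces -/

namespace Diagram

variable {V : Type u} {D : Diagram V} {F G : Set (ℝ × ℝ)}

namespace FaceChains

variable (C : D.FaceChains F)

/-- The vertices of a boundary chain, except for the maximum and the minimum of the face. -/
def inner (b : Bool) : Set V := {v | v ∈ (C.chain b).map D.bot ∧ v ≠ C.min}

variable {C}

theorem mem_chain_iff {b : Bool} {v : V} :
    v ∈ (C.chain b).map D.bot ↔ v ∈ C.inner b ∨ v = C.min := by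
  constructor
  · intro h
    by_cases hv : v = C.min
    exacts [Or.inr hv, Or.inl ⟨h, hv⟩]
  · rintro (h | rfl)
    · exact h.1
    · obtain ⟨e, he, h⟩ := (C.isSide_chain b).path.exists_bot (C.isSide_chain b).ne_nil
      exact List.mem_map.2 ⟨e, he, h⟩

theorem ne_max_of_mem_inner {b : Bool} {v : V} (h : v ∈ C.inner b) : v ≠ C.max := by
  rintro rfl
  exact (List.nodup_cons.1 (C.isSide_chain b).nodup_verts).1 h.1

/-- The vertex `v` of the face `F` becomes a new inner vertex of the face `G` when `F` is replaced by
the linear extension. -/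
def IsNew (C : D.FaceChains F) (L : D.LinearExtension F) (C' : D.FaceChains G) (b : Bool) (v : V) :
    Prop :=
  v ∈ C.inner b ∧ ∃ e ∈ C'.chain b, e ∈ C.chain (!b) ∧ L.1.pos (D.top e) < L.1.pos v ∧
    L.1.pos v < L.1.pos (D.bot e)

/-- The order of the edges of a boundary chain of the face `G` after the face `F` is replaced by the
linear extension. -/
def NewOrder (C : D.FaceChains F) (L : D.LinearExtension F) (C' : D.FaceChains G) (b : Bool)
    (e e' : (replace L).E) : Prop :=
  (part L (!b) e ∈ C'.chain b ∧ part L (!b) e' ∈ C'.chain b ∧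
      (C'.chain b).pos (part L (!b) e) < (C'.chain b).pos (part L (!b) e')) ∨
    part L (!b) e = part L (!b) e' ∧ part L b e ∈ C.chain b ∧ part L b e' ∈ C.chain b ∧
      (C.chain b).pos (part L b e) < (C.chain b).pos (part L b e')

/-- The boundary chain of the face `G` after the face `F` is replaced. -/
theorem exists_chain_replace (C : D.FaceChains F) (L : D.LinearExtension F)
    (C' : D.FaceChains G) (hFG : G ≠ F) (b : Bool)
    (h : ∀ e ∈ C'.chain b, e ∈ C.chain (!b) → ∀ v ∈ C.inner b,
      v ≠ C'.max ∧ v ∉ (C'.chain b).map D.bot) :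
    ∃ l : List (replace L).E, (∀ e, e ∈ l ↔ (replace L).face b e = G) ∧
      DownPath (replace L).top (replace L).bot C'.max l C'.min ∧
      (C'.max :: l.map (replace L).bot).Nodup ∧
      (∀ v ∈ l.map (replace L).bot, v ∈ (C'.chain b).map D.bot ∨ C.IsNew L C' b v) ∧
      l.Pairwise (C.NewOrder L C' b) := by
  have hex : ∀ e, ∃ l : List (replace L).E, D.face b e ≠ F → (∀ e', e' ∈ l ↔ part L (!b) e' = e) ∧
      DownPath (replace L).top (replace L).bot (D.top e) l (D.bot e) ∧
      (l.map (replace L).bot).Nodup ∧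
      l.Pairwise (fun e₁ e₂ => D.face (!b) e = F ∧
        part L b e₁ ∈ C.chain b ∧ part L b e₂ ∈ C.chain b ∧
        (C.chain b).pos (part L b e₁) < (C.chain b).pos (part L b e₂)) ∧
      ∀ e' ∈ l, (replace L).bot e' = D.bot e ∨ D.face (!b) e = F ∧
        (replace L).bot e' ∈ (C.chain b).map D.bot ∧ (replace L).bot e' ≠ C.min ∧
        L.1.pos (D.top e) < L.1.pos ((replace L).bot e') ∧
        L.1.pos ((replace L).bot e') < L.1.pos (D.bot e) := by
    intro e
    by_cases he : D.face b e = F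
    · exact ⟨[], fun h => absurd he h⟩
    · obtain ⟨l, -, hl⟩ := exists_block (C := C) (L := L) (b := !b) (e := e) (by rwa [Bool.not_not])
      rw [Bool.not_not] at hl
      exact ⟨l, fun _ => hl⟩
  choose g hg using hex
  have hgC : ∀ e ∈ C'.chain b, D.face b e ≠ F := fun e he h' =>
    hFG ((C'.mem_chain.1 he).symm.trans h')
  have hside := C'.isSide_chain b
  have hbot : ∀ e ∈ C'.chain b, ∀ v ∈ (g e).map (replace L).bot, v = D.bot e ∨
      v ∈ C.inner b ∧ e ∈ C.chain (!b) ∧ L.1.pos (D.top e) < L.1.pos v ∧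
        L.1.pos v < L.1.pos (D.bot e) := by
    intro e he v hv
    obtain ⟨e', he', rfl⟩ := List.mem_map.1 hv
    rcases (hg e (hgC e he)).2.2.2.2 e' he' with h1 | ⟨h1, h2, h3, h4⟩
    · exact Or.inl h1
    · exact Or.inr ⟨⟨h2, h3⟩, C.mem_chain.2 h1, h4⟩
  refine ⟨(C'.chain b).flatMap g, fun e => ?_, ?_, ?_, fun v hv => ?_, ?_⟩
  · rw [List.mem_flatMap, face_replace]
    constructor
    · rintro ⟨e', he', h1⟩
      rw [(hg e' (hgC e' he')).1] at h1
      rw [h1]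
      exact C'.mem_chain.1 he'
    · intro h1
      have he' := C'.mem_chain.2 h1
      exact ⟨_, he', ((hg _ (hgC _ he')).1 e).2 rfl⟩
  · exact hside.path.flatMap fun e he => (hg e (hgC e he)).2.1
  · rw [List.map_flatMap, List.nodup_cons, List.nodup_flatMap]
    refine ⟨fun h1 => ?_, fun e he => (hg e (hgC e he)).2.2.1, ?_⟩
    · obtain ⟨e, he, h1⟩ := List.mem_flatMap.1 h1
      rcases hbot e he _ h1 with h1 | ⟨h1, h2, -⟩
      · exact hside.bot_ne_max he h1.symm
      · exact (h e he h2 _ h1).1 rfl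
    -- Old vertices do not repeat, new ones are not old by `h`, and a new vertex lies strictly
    -- within only one edge of the opposite chain of `F`.
    · refine List.Pairwise.imp_of_mem (fun {e e'} he he' hne v hv hv' => hne ?_) hside.nodup
      rcases hbot e he _ hv with h1 | ⟨h1, h2, h3⟩ <;>
        rcases hbot e' he' _ hv' with h1' | ⟨h1', h2', h3'⟩
      · exact List.inj_on_of_nodup_map (List.nodup_cons.1 hside.nodup_verts).2 he he'
          (h1.symm.trans h1')
      · exact absurd (List.mem_map.2 ⟨e, he, h1.symm⟩) (h e' he' h2' v h1').2
      · exact absurd (List.mem_map.2 ⟨e', he', h1'.symm⟩) (h e he h2 v h1).2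
      · exact LinearExtension.cover_unique (C.isSide_chain (!b)) h2 h2' h3.1.le h3.2 h3'.1.le h3'.2
  · rw [List.map_flatMap] at hv
    obtain ⟨e, he, hv⟩ := List.mem_flatMap.1 hv
    rcases hbot e he _ hv with h1 | ⟨h1, h2, h3⟩
    · exact Or.inl (List.mem_map.2 ⟨e, he, h1.symm⟩)
    · exact Or.inr ⟨h1, e, he, h2, h3⟩
  · rw [List.pairwise_flatMap]
    refine ⟨fun e he => ?_, ?_⟩
    · obtain ⟨h1, -, -, h2, -⟩ := hg e (hgC e he)
      refine h2.imp_of_mem fun {e₁ e₂} he₁ he₂ h3 => Or.inr ⟨?_, h3.2⟩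
      rw [(h1 e₁).1 he₁, (h1 e₂).1 he₂]
    · refine List.Pairwise.imp_of_mem (fun {e e'} he he' hlt e₁ he₁ e₂ he₂ => Or.inl ?_)
        hside.nodup.pairwise_pos
      rw [((hg e (hgC e he)).1 e₁).1 he₁, ((hg e' (hgC e' he')).1 e₂).1 he₂]
      exact ⟨he, he', hlt⟩

end FaceChains

/-- The strict order of the ranks of faces, or its opposite. -/
def SideLT {X : Type*} [Preorder X] (rk : Set (ℝ × ℝ) → X) : Bool → Set (ℝ × ℝ) → Set (ℝ × ℝ) → Prop
  | true, F, G => rk F < rk G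
  | false, F, G => rk G < rk F

section

variable {X : Type*} [Preorder X] {rk : Set (ℝ × ℝ) → X} {b : Bool} {F₁ F₂ F₃ : Set (ℝ × ℝ)}

theorem SideLT.trans (h : SideLT rk b F₁ F₂) (h' : SideLT rk b F₂ F₃) : SideLT rk b F₁ F₃ := by
  cases b
  exacts [lt_trans h' h, lt_trans h h']

theorem SideLT.irrefl (h : SideLT rk b F₁ F₁) : False := by
  cases b <;> exact lt_irrefl _ h

theorem SideLT.symm (h : SideLT rk (!b) F₁ F₂) : SideLT rk b F₂ F₁ := by
  cases b <;> exact h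

end

/-- Boundary chains of the faces of a list, and a rank of the faces that increases from the left to
the right. -/
structure ChainFamily {X : Type*} [Preorder X] (D : Diagram V) (rk : Set (ℝ × ℝ) → X)
    (Fs : List (Set (ℝ × ℝ))) where
  chains : ∀ F ∈ Fs, D.FaceChains F
  face_lt : ∀ b e, SideLT rk b (D.face (!b) e) (D.face b e)
  -- For `b = true`: an inner vertex of the left boundary of `F` that is on the right boundary of
  -- `G` puts `G` to the left of `F`.
  lt_of_mem : ∀ b F hF G hG v, v ∈ (chains F hF).inner b →
    v = (chains G hG).max ∨ v ∈ ((chains G hG).chain (!b)).map D.bot → SideLT rk b G F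
  eq_of_mem : ∀ b F hF G hG v, v ∈ (chains F hF).inner b → v ∈ (chains G hG).inner b → F = G

namespace ChainFamily

variable {X : Type*} [Preorder X] {rk : Set (ℝ × ℝ) → X} {Fs : List (Set (ℝ × ℝ))}

theorem left_ne_right (K : D.ChainFamily rk Fs) (e : D.E) : D.left e ≠ D.right e := fun h => by
  have h1 := K.face_lt true e
  change SideLT rk true (D.left e) (D.right e) at h1
  rw [h] at h1
  exact h1.irrefl

/-- Replacing a face keeps a family of other faces. -/
theorem exists_replace (K : D.ChainFamily rk (F :: Fs)) (hF : F ∉ Fs) (L : D.LinearExtension F) :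
    ∃ K' : (replace L).ChainFamily rk Fs, ∀ G (hG : G ∈ Fs) b,
      ((K'.chains G hG).chain b).Pairwise
        ((K.chains F List.mem_cons_self).NewOrder L
          (K.chains G (List.mem_cons_of_mem F hG)) b) := by
  set C := K.chains F List.mem_cons_self with hC
  have hlt : ∀ {b G} (hG : G ∈ F :: Fs) {v}, v ∈ (K.chains G hG).inner b →
      v = C.max ∨ v ∈ (C.chain (!b)).map D.bot → SideLT rk b F G := fun hG _ hv h =>
    K.lt_of_mem _ _ hG _ List.mem_cons_self _ hv h
  have hlt' : ∀ {b G} (hG : G ∈ F :: Fs) {v}, v ∈ C.inner b → v = (K.chains G hG).max ∨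
      v ∈ ((K.chains G hG).chain (!b)).map D.bot → SideLT rk b G F := fun hG _ hv h =>
    K.lt_of_mem _ _ List.mem_cons_self _ hG _ hv h
  have hedge : ∀ {b G} (hG : G ∈ F :: Fs) {e}, e ∈ (K.chains G hG).chain b → e ∈ C.chain (!b) →
      SideLT rk b F G := by
    intro b G hG e he he'
    have := K.face_lt b e
    rwa [C.mem_chain.1 he', (K.chains G hG).mem_chain.1 he] at this
  have hne : ∀ {G}, G ∈ Fs → G ≠ F := fun hG h => hF (h ▸ hG)
  have hex : ∀ G (hG : G ∈ Fs) b, _ := fun G hG b =>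
    C.exists_chain_replace L (K.chains G (List.mem_cons_of_mem F hG)) (hne hG) b
      -- The common edge puts `F` and `G` in one order. If `v` were the maximum or minimum of `G`,
      -- they would be in the opposite order; if it were inner on the same side of both, they would
      -- be equal.
      fun e he he' v hv => by
        have h1 := hedge _ he he'
        have h2 : ¬ SideLT rk b G F := fun h2 => (h1.trans h2).irrefl
        refine ⟨fun h => h2 (hlt' _ hv (Or.inl h)), fun h => ?_⟩
        rcases FaceChains.mem_chain_iff.1 h with h | h
        · exact hne hG (K.eq_of_mem b _ _ _ _ _ h hv)
        · exact h2 (hlt' _ hv (Or.inr (FaceChains.mem_chain_iff.2 (Or.inr h))))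
  choose l hmem hpath hnodup hbot hord using hex
  have hnew : ∀ {b G} (hG : G ∈ Fs) {v},
      C.IsNew L (K.chains G (List.mem_cons_of_mem F hG)) b v → v ∈ C.inner b ∧ SideLT rk b F G :=
    fun hG _ h => ⟨h.1, by
      obtain ⟨-, e, he, he', -⟩ := h
      exact hedge _ he he'⟩
  -- A new incidence comes with an edge shared with `F`, so `F` can be inserted between `G'` and
  -- `G`. The vertex is not new for both, since it would then be inner on both chains of `F`.
  have key : ∀ b G (hG : G ∈ Fs) G' (hG' : G' ∈ Fs) v, v ∈ (l G hG b).map (replace L).bot →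
      v ≠ (K.chains G (List.mem_cons_of_mem F hG)).min →
      v = (K.chains G' (List.mem_cons_of_mem F hG')).max ∨
        v ∈ (l G' hG' (!b)).map (replace L).bot → SideLT rk b G' G := by
    intro b G hG G' hG' v hv hmin hv'
    have hv' : (v = (K.chains G' (List.mem_cons_of_mem F hG')).max ∨
        v ∈ ((K.chains G' (List.mem_cons_of_mem F hG')).chain (!b)).map D.bot) ∨
        C.IsNew L (K.chains G' (List.mem_cons_of_mem F hG')) (!b) v := by
      rcases hv' with h | h
      · exact Or.inl (Or.inl h)
      · exact (hbot _ _ _ _ h).imp_left Or.inr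
    rcases hbot _ _ _ _ hv with h | h <;> rcases hv' with h' | h'
    · exact K.lt_of_mem _ _ _ _ _ _ ⟨h, hmin⟩ h'
    · obtain ⟨h1, h2⟩ := hnew hG' h'
      exact h2.symm.trans (hlt _ ⟨h, hmin⟩ (Or.inr h1.1))
    · obtain ⟨h1, h2⟩ := hnew hG h
      exact (hlt' _ h1 h').trans h2
    · exact (K.lt_of_mem _ _ _ _ _ _ h.1 (Or.inr h'.1.1)).irrefl.elim
  let C' : ∀ G (hG : G ∈ Fs), (replace L).FaceChains G := fun G hG =>
    { max := (K.chains G (List.mem_cons_of_mem F hG)).max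
      min := (K.chains G (List.mem_cons_of_mem F hG)).min
      left := l G hG true
      right := l G hG false
      mem_left := hmem G hG true
      mem_right := hmem G hG false
      path_left := hpath G hG true
      path_right := hpath G hG false
      nodup_left := hnodup G hG true
      nodup_right := hnodup G hG false
      max_ne_min := (K.chains G (List.mem_cons_of_mem F hG)).max_ne_min
      eq_min := fun v hv hv' => by
        by_contra h
        exact (key true G hG G hG v hv h (Or.inr hv')).irrefl }
  have hC' : ∀ G hG b, (C' G hG).chain b = l G hG b := fun G hG b => by cases b <;> rfl
  refine ⟨⟨C', fun b e => ?_, fun b G hG G' hG' v hv hv' => ?_, fun b G hG G' hG' v hv hv' => ?_⟩,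
    fun G hG b => by rw [hC']; exact hord G hG b⟩
  · rw [face_replace, face_replace, Bool.not_not]
    rcases edge_cases e with ⟨e, rfl⟩ | ⟨s, rfl⟩
    · exact K.face_lt b e.1
    · have h1 := K.face_lt b (s.edge b)
      have h2 := K.face_lt b (s.edge (!b))
      rw [s.face_edge] at h1 h2
      exact h1.trans h2
  · replace hv : v ∈ ((C' G hG).chain b).map (replace L).bot ∧ v ≠ (C' G hG).min := hv
    rw [hC'] at hv hv'
    exact key b G hG G' hG' v hv.1 hv.2 hv'
  · replace hv : v ∈ ((C' G hG).chain b).map (replace L).bot ∧ v ≠ (C' G hG).min := hv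
    replace hv' : v ∈ ((C' G' hG').chain b).map (replace L).bot ∧ v ≠ (C' G' hG').min := hv'
    rw [hC'] at hv hv'
    rcases hbot _ _ _ _ hv.1 with h | h <;> rcases hbot _ _ _ _ hv'.1 with h' | h'
    · exact K.eq_of_mem _ _ _ _ _ _ ⟨h, hv.2⟩ ⟨h', hv'.2⟩
    · exact absurd (K.eq_of_mem _ _ _ _ _ _ ⟨h, hv.2⟩ h'.1) (hne hG)
    · exact absurd (K.eq_of_mem _ _ _ _ _ _ ⟨h', hv'.2⟩ h.1) (hne hG')
    -- The new vertex lies strictly within one edge of the opposite chain of `F`, and this edge has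
    -- a single face on side `b`.
    · obtain ⟨-, e, he, he', h1, h2⟩ := h
      obtain ⟨-, e', he₁, he₁', h1', h2'⟩ := h'
      have h3 := LinearExtension.cover_unique (C.isSide_chain (!b)) he' he₁' h1.le h2 h1'.le h2'
      rw [← (FaceChains.mem_chain _).1 he, ← (FaceChains.mem_chain _).1 he₁, h3]

end ChainFamily

end Diagram

/-! ### Iterated replacements and reductions -/

namespace Diagram.ChainFamily

section

variable {V W : Type u} {D : Diagram V} {N : FlowNetwork W} {X : Type*} [Preorder X]
  {rk : Set (ℝ × ℝ) → X} {F : Set (ℝ × ℝ)} {Fs : List (Set (ℝ × ℝ))} {ν : Set (ℝ × ℝ) → W}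
  {φ : N.E ≃ D.E}

/-- The vertices `ν F` of the network, whose edges are labelled by those of the diagram, belong to
the faces `F` of the family. -/
structure IsNetwork (K : D.ChainFamily rk Fs) (N : FlowNetwork W) (ν : Set (ℝ × ℝ) → W)
    (φ : N.E ≃ D.E) : Prop where
  isVertex : ∀ F hF, (K.chains F hF).IsVertex N (ν F) φ
  netflow_eq : ∀ F ∈ Fs, N.netflow (ν F) = 0
  not_above : ∀ b e, ¬ N.above b e e

/-- `NewOrder` and the order in the reduced network are the same lexicographic rule: first by the
edge of `G`, then by the opposite part along `F`. -/
theorem IsNetwork.reduce {K : D.ChainFamily rk (F :: Fs)} (hK : K.IsNetwork N ν φ)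
    {L : D.LinearExtension F} {T : N.NoncrossingTree (ν F)}
    {φ' : (FlowNetwork.reduce T).E ≃ (replace L).E}
    (hφ : ∀ b e, φ (FlowNetwork.side T b e) = part L b (φ' e))
    {K' : (replace L).ChainFamily rk Fs} (hK' : ∀ G (hG : G ∈ Fs) b,
      ((K'.chains G hG).chain b).Pairwise
        ((K.chains F List.mem_cons_self).NewOrder L
          (K.chains G (List.mem_cons_of_mem F hG)) b)) :
    K'.IsNetwork (FlowNetwork.reduce T) ν φ' := by
  have hirr : ∀ b e, ¬ (FlowNetwork.reduce T).above b e e := by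
    intro b e
    rw [FlowNetwork.above_reduce]
    rintro (h | ⟨-, h⟩) <;> exact hK.not_above _ _ h
  have hinj : ∀ {b e e'}, part L b (φ' e) = part L b (φ' e') ↔
      FlowNetwork.side T b e = FlowNetwork.side T b e' := by
    intro b e e'
    rw [← hφ, ← hφ, φ.injective.eq_iff]
  have hiff : ∀ {G} (hG : G ∈ F :: Fs) {b c e e'}, part L c (φ' e) ∈ (K.chains G hG).chain b →
      part L c (φ' e') ∈ (K.chains G hG).chain b →
      (N.above b (FlowNetwork.side T c e) (FlowNetwork.side T c e') ↔
        ((K.chains G hG).chain b).pos (part L c (φ' e)) <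
          ((K.chains G hG).chain b).pos (part L c (φ' e'))) := by
    intro G hG b c e e' h h'
    rw [← hφ] at h h' ⊢
    rw [← hφ]
    exact (hK.isVertex G hG).above_iff b _ _ h h'
  refine ⟨fun G hG => ⟨fun b e => ?_, fun b e e' he he' => ?_⟩,
    fun G hG => hK.netflow_eq G (List.mem_cons_of_mem F hG), hirr⟩
  · rw [FlowNetwork.endp_reduce, face_replace, ← hφ,
      (hK.isVertex G (List.mem_cons_of_mem F hG)).endp_iff]
  · have hord : ∀ e e', φ' e ∈ (K'.chains G hG).chain b → φ' e' ∈ (K'.chains G hG).chain b →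
        ((K'.chains G hG).chain b).pos (φ' e) < ((K'.chains G hG).chain b).pos (φ' e') →
        (FlowNetwork.reduce T).above b e e' ∧ ¬ (FlowNetwork.reduce T).above b e' e := by
      intro e e' he he' h
      rw [FlowNetwork.above_reduce, FlowNetwork.above_reduce]
      rcases (hK' G hG b).of_pos_lt he he' h with ⟨h1, h2, h3⟩ | ⟨h1, h2, h3, h4⟩
      · rw [hiff _ h1 h2, hiff _ h2 h1]
        refine ⟨Or.inl h3, ?_⟩
        rintro (h4 | ⟨h4, -⟩)
        · exact h3.not_gt h4
        · rw [hinj.2 h4] at h3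
          exact h3.false
      · rw [hinj] at h1
        rw [h1, hiff _ h2 h3, hiff _ h3 h2]
        refine ⟨Or.inr ⟨rfl, h4⟩, ?_⟩
        rintro (h5 | ⟨-, h5⟩)
        · exact hK.not_above _ _ h5
        · exact h4.not_gt h5
    refine ⟨fun h => ?_, fun h => (hord e e' he he' h).1⟩
    by_contra h1
    rcases (not_lt.1 h1).eq_or_lt with h2 | h2
    · rw [φ'.injective (List.eq_of_pos_eq he' h2)] at h
      exact hirr _ _ h
    · exact (hord e' e he' he h2).2 h

end

variable {P : Type u} [PartialOrder P] {M : MarkedPoset P} {W : Type u} {X : Type*} [Preorder X]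
  {rk : Set (ℝ × ℝ) → X} {ν : Set (ℝ × ℝ) → W}

/-- The choices of linear extensions for a family of faces correspond to the choices of noncrossing
trees at their vertices, and the differences map the one regions onto the other ones. -/
theorem IsNetwork.exists_equiv {Fs : List (Set (ℝ × ℝ))} (hFs : Fs.Nodup) {D : Diagram (Hat P)}
    {N : FlowNetwork W} {φ : N.E ≃ D.E} {K : D.ChainFamily rk Fs} (hK : K.IsNetwork N ν φ)
    (h : (fun x e => M.edgeMap D.top D.bot x (φ e)) '' M.edgePolytope D.top D.bot =
      N.flowPolytope) :
    ∃ γ : D.Leaf Fs ≃ FlowNetwork.Leaf (Fs.map ν) N, ∀ l,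
      (fun x e => M.edgeMap D.top D.bot x (φ e)) ''
        M.edgePolytope (result Fs D l).top (result Fs D l).bot =
          FlowNetwork.region (Fs.map ν) N (γ l) ∧
      (∀ a b, D.lt a b → (result Fs D l).lt a b) ∧
      (∀ e, ∃ e', (result Fs D l).bot e = D.bot e') ∧
      ∀ e, ∃ e', (result Fs D l).top e = D.top e' := by
  induction Fs generalizing D N with
  | nil => exact ⟨Equiv.refl _, fun l => ⟨h, fun _ _ => id, fun e => ⟨e, rfl⟩, fun e => ⟨e, rfl⟩⟩⟩
  | cons F Fs ih =>
    obtain ⟨hF, hFs⟩ := List.nodup_cons.1 hFs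
    have hw := hK.isVertex F List.mem_cons_self
    obtain ⟨γ₀, hγ₀⟩ := hw.exists_equiv
    have hD := K.left_ne_right
    have hstep : ∀ L, ∃ γ : (replace L).Leaf Fs ≃
        FlowNetwork.Leaf (Fs.map ν) (FlowNetwork.reduce (γ₀ L)), ∀ l,
        (fun x e => M.edgeMap D.top D.bot x (φ e)) ''
          M.edgePolytope (result Fs (replace L) l).top (result Fs (replace L) l).bot =
            FlowNetwork.lift (γ₀ L) '' FlowNetwork.region (Fs.map ν) _ (γ l) ∧
        (∀ a b, D.lt a b → (result Fs (replace L) l).lt a b) ∧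
        (∀ e, ∃ e', (result Fs (replace L) l).bot e = D.bot e') ∧
        ∀ e, ∃ e', (result Fs (replace L) l).top e = D.top e' := by
      intro L
      obtain ⟨φ', hφ⟩ := hw.exists_edge_equiv (hγ₀ L)
      obtain ⟨K', hK'⟩ := K.exists_replace hF L
      obtain ⟨γ, hγ⟩ := ih hFs (hK.reduce hφ hK')
        (hw.image_edgePolytope_replace hD (hK.netflow_eq F List.mem_cons_self) hφ h)
      refine ⟨γ, fun l => ?_⟩
      obtain ⟨h1, h2, h3, h4⟩ := hγ l
      refine ⟨?_, fun a b hab => h2 a b (lt_replace (C := K.chains F List.mem_cons_self) hD hab),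
        fun e => ?_, fun e => ?_⟩
      -- The later steps produce increments in the new diagram, and `lift` turns these into
      -- increments in `D`.
      · rw [← h1, image_image]
        exact image_congr fun x _ => (hw.lift_edgeMap hD hφ x).symm
      · obtain ⟨e', he'⟩ := h3 e
        rw [he']
        exact exists_bot_eq_replace (C := K.chains F List.mem_cons_self) e'
      · obtain ⟨e', he'⟩ := h4 e
        rw [he']
        exact exists_top_eq_replace (C := K.chains F List.mem_cons_self) e'
    choose γ hγ using hstep
    exact ⟨Equiv.sigmaCongr γ₀ γ, fun l => hγ l.1 l.2⟩

end Diagram.ChainFamily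

/-! ### The faces of a bounded embedding -/

namespace BoundedEmbedding

variable {P : Type u} [PartialOrder P] [Finite P] {H : BoundedEmbedding P} {M : MarkedPoset P}
  {F G : Set (ℝ × ℝ)}

variable (H) in
/-- The paths to the left of a face. -/
def rank (F : Set (ℝ × ℝ)) : Set (ℝ → ℝ) := {g | H.IsPath g ∧ ∃ z ∈ F, g z.2 < z.1}

namespace FaceBoundary

variable (B : H.FaceBoundary F) (B' : H.FaceBoundary G)

theorem mem_rank_iff {g : ℝ → ℝ} : g ∈ H.rank F ↔ H.IsPath g ∧ g ≤ B.U := by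
  refine and_congr_right fun hg => ⟨?_, fun h => ?_⟩
  · rintro ⟨z, hz, h⟩
    rw [B.eq_between] at hz
    exact (B.gap.le_or_le g hg).resolve_right fun h' => (h.trans hz.2).not_ge (h' _)
  · obtain ⟨z, hz⟩ := B.gap.nonempty
    exact ⟨z, B.eq_between ▸ hz, (h _).trans_lt hz.1⟩

/-- A path to the left of `F` is below `B'.W` at height `t`, so it is to the left of `G`. The
inclusion is strict because of the path `B'.U` in the first case and `B.W` in the second. -/
theorem rank_lt_rank {t : ℝ} (h : B.U t < B'.W t) (h' : B.U t < B'.U t ∨ B.W t < B'.W t) :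
    H.rank F < H.rank G := by
  refine ⟨fun g hg => ?_, fun hle => ?_⟩
  · rw [B.mem_rank_iff] at hg
    rw [B'.mem_rank_iff]
    exact ⟨hg.1, (B'.gap.le_or_le g hg.1).resolve_right fun h1 =>
      ((hg.2 t).trans_lt h).not_ge (h1 t)⟩
  · rcases h' with h' | h'
    · have h1 := hle (B'.mem_rank_iff.2 ⟨B'.gap.left, le_rfl⟩)
      exact h'.not_ge ((B.mem_rank_iff.1 h1).2 t)
    · have h1 : B.W ≤ B'.U := (B'.gap.le_or_le _ B.gap.right).resolve_right fun h1 =>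
        h'.not_ge (h1 t)
      have h2 := (B.mem_rank_iff.1 (hle (B'.mem_rank_iff.2 ⟨B.gap.right, h1⟩))).2
      obtain ⟨s, hs⟩ := B.gap.exists_lt
      exact hs.not_ge (h2 s)

theorem U_le_W {v : Hat P} (h₁ : B.min ≤ v) (h₂ : v ≤ B.max) : B.U (H.y v) ≤ B.W (H.y v) := by
  rcases h₁.eq_or_lt with rfl | h₁
  · rw [B.U_min, B.W_min]
  rcases h₂.eq_or_lt with rfl | h₂
  · rw [B.U_max, B.W_max]
  exact ((B.lt_iff _).2 ⟨H.y_strictMono h₁, H.y_strictMono h₂⟩).le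

theorem eq_of_between {z : ℝ × ℝ} (h : z ∈ between B.U B.W) (h' : z ∈ between B'.U B'.W) :
    F = G := by
  rw [B.eq_between, B'.eq_between, B.gap.between_eq B'.gap h h']

end FaceBoundary

theorem rank_leftFace_lt (e : HasseEdge P) :
    H.rank (H.leftFace (.hasse e)) < H.rank (H.rightFace (.hasse e)) := by
  obtain ⟨B⟩ := (isFace_leftFace (H := H) (e := .hasse e) (by simp)).exists_boundary
  obtain ⟨B'⟩ := (isFace_rightFace (H := H) (e := .hasse e) (by simp)).exists_boundary
  obtain ⟨t, ht⟩ := nonempty_Ioo.2 (H.y_bot_lt_y_top (.hasse e))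
  have h1 := (B.lt_iff t).2 (B.openDom_subset_of_leftFace rfl ht)
  have h2 := (B'.lt_iff t).2 (B'.openDom_subset_of_rightFace rfl ht)
  have h3 := B.W_eqOn rfl (Ioo_subset_Icc_self ht)
  have h4 := B'.U_eqOn rfl (Ioo_subset_Icc_self ht)
  rw [h3, ← h4] at h1
  exact B.rank_lt_rank B' (h1.trans h2) (Or.inl h1)

/-- The boundary graph of a face on the left (`true`) or on the right (`false`). -/
def FaceBoundary.graph (B : H.FaceBoundary F) : Bool → ℝ → ℝ
  | true => B.U
  | false => B.W

/-- The chains are those of the boundary of a face. -/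
structure FaceBoundary.Agrees (B : H.FaceBoundary F) (C : H.diagram.FaceChains F) : Prop where
  max_eq : C.max = B.max
  min_eq : C.min = B.min

namespace FaceBoundary.Agrees

variable {B : H.FaceBoundary F} {C : H.diagram.FaceChains F} (hB : B.Agrees C)
include hB

theorem path (b : Bool) : DownPath HasseEdge.top HasseEdge.bot B.max (C.chain b) B.min := by
  rw [← hB.max_eq, ← hB.min_eq]
  exact (C.isSide_chain b).path

theorem of_mem_verts {b : Bool} {v : Hat P}
    (hv : v = C.max ∨ v ∈ (C.chain b).map H.diagram.bot) :
    B.graph b (H.y v) = H.x v ∧ B.min ≤ v ∧ v ≤ B.max := by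
  rcases hv with rfl | hv
  · rw [hB.max_eq]
    refine ⟨?_, hasse_le (hB.path b), le_rfl⟩
    cases b
    exacts [B.W_max, B.U_max]
  · obtain ⟨e, he, rfl⟩ := List.mem_map.1 hv
    have h1 := hasse_bounds (hB.path b) he
    have hlt := H.y_bot_lt_y_top (.hasse e)
    have h2 : H.y (BoundedEdge.hasse e).bot ∈ H.dom (.hasse e) := ⟨le_rfl, hlt.le⟩
    refine ⟨?_, h1.2, (e.2.lt.le.trans h1.1 :)⟩
    cases b
    · exact (B.W_eqOn ((C.mem_right e).1 he) h2).trans (H.arc_bot (.hasse e))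
    · exact (B.U_eqOn ((C.mem_left e).1 he) h2).trans (H.arc_bot (.hasse e))

theorem of_mem_inner {b : Bool} {v : Hat P} (hv : v ∈ C.inner b) :
    B.graph b (H.y v) = H.x v ∧ B.U (H.y v) < B.W (H.y v) := by
  obtain ⟨h1, h2, h3⟩ := hB.of_mem_verts (Or.inr hv.1)
  refine ⟨h1, (B.lt_iff _).2 ⟨H.y_strictMono (lt_of_le_of_ne h2 fun h => hv.2 ?_),
    H.y_strictMono (lt_of_le_of_ne h3 fun h => ?_)⟩⟩
  · rw [hB.min_eq, h]
  · exact Diagram.FaceChains.ne_max_of_mem_inner hv (h.trans hB.max_eq.symm)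

end FaceBoundary.Agrees

/-- The additional edges would make `⊥` a vertex of the left boundary, so both chains consist of
Hasse edges. They meet only at the extremes, because `U < W` at all heights in between. -/
theorem exists_faceChains (hF : H.IsFace F) (hM : ¬ H.LeftMarked M F) :
    ∃ (B : H.FaceBoundary F) (C : H.diagram.FaceChains F), B.Agrees C := by
  obtain ⟨B⟩ := hF.exists_boundary
  obtain ⟨l, hl, hl'⟩ := B.exists_left (B.leftmost_notMem_left hM)
  obtain ⟨r, hr, hr'⟩ := B.exists_right (B.rightmost_notMem_right hM)
  have hnodup : ∀ {c}, DownPath HasseEdge.top HasseEdge.bot B.max c B.min →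
      (B.max :: c.map HasseEdge.bot).Nodup := fun hc =>
    hc.nodup (k := OrderDual.toDual) fun e _ => e.2.lt
  refine ⟨B, ⟨B.max, B.min, l, r, hl', hr', hl, hr, hnodup hl, hnodup hr, B.min_ne_max.symm,
    fun v hv hv' => ?_⟩, rfl, rfl⟩
  obtain ⟨e, he, rfl⟩ := List.mem_map.1 hv
  obtain ⟨e', he', heq⟩ := List.mem_map.1 hv'
  have heq : e'.bot = e.bot := heq
  change e.bot = B.min
  have h1 := hasse_bounds hl he
  by_contra hne
  have h2 := (B.lt_iff (H.y e.bot)).2 ⟨H.y_strictMono (lt_of_le_of_ne h1.2 (Ne.symm hne)),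
    H.y_strictMono (e.2.lt.trans_le h1.1)⟩
  have h3 : ∀ e : HasseEdge P, H.y e.bot ∈ H.dom (.hasse e) := fun e =>
    ⟨le_rfl, (H.y_bot_lt_y_top (.hasse e)).le⟩
  have h4 : B.U (H.y e.bot) = H.x e.bot :=
    (B.U_eqOn ((hl' e).1 he) (h3 e)).trans (H.arc_bot (.hasse e))
  have h5 : B.W (H.y e'.bot) = H.x e'.bot :=
    (B.W_eqOn ((hr' e').1 he') (h3 e')).trans (H.arc_bot (.hasse e'))
  rw [heq] at h5
  rw [h4, h5] at h2
  exact h2.false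

/-- At an inner vertex of a face `U < W` is strict, at any vertex `U ≤ W`; comparing graphs at the
height of a common vertex gives the rank inequalities. Two faces with a common inner vertex on the
same side share points next to it. -/
theorem exists_chainFamily {Fs : List (Set (ℝ × ℝ))}
    (hF : ∀ F ∈ Fs, H.IsFace F ∧ ¬ H.LeftMarked M F) :
    Nonempty (H.diagram.ChainFamily H.rank Fs) := by
  choose B C hBC using fun F hFs => exists_faceChains (hF F hFs).1 (hF F hFs).2
  refine ⟨⟨C, fun b e => ?_, fun b F hF G hG v hv hv' => ?_, fun b F hF G hG v hv hv' => ?_⟩⟩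
  · cases b <;> exact rank_leftFace_lt e
  · obtain ⟨h1, h2⟩ := (hBC F hF).of_mem_inner hv
    obtain ⟨h3, h4, h5⟩ := (hBC G hG).of_mem_verts hv'
    have h6 := (B G hG).U_le_W h4 h5
    cases b
    · replace h1 : (B F hF).W (H.y v) = H.x v := h1
      replace h3 : (B G hG).U (H.y v) = H.x v := h3
      refine (B F hF).rank_lt_rank (B G hG) (t := H.y v) (by linarith) (Or.inl (by linarith))
    · replace h1 : (B F hF).U (H.y v) = H.x v := h1
      replace h3 : (B G hG).W (H.y v) = H.x v := h3
      refine (B G hG).rank_lt_rank (B F hF) (t := H.y v) (by linarith) (Or.inr (by linarith))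
  · obtain ⟨h1, h2⟩ := (hBC F hF).of_mem_inner hv
    obtain ⟨h3, h4⟩ := (hBC G hG).of_mem_inner hv'
    cases b
    · replace h1 : (B F hF).W (H.y v) = H.x v := h1
      replace h3 : (B G hG).W (H.y v) = H.x v := h3
      rw [h1] at h2
      rw [h3] at h4
      obtain ⟨s, hs, hs'⟩ := exists_between (max_lt h2 h4)
      obtain ⟨hs1, hs2⟩ := max_lt_iff.1 hs
      exact (B F hF).eq_of_between (B G hG) (z := (s, H.y v)) ⟨hs1, hs'.trans_eq h1.symm⟩
        ⟨hs2, hs'.trans_eq h3.symm⟩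
    · replace h1 : (B F hF).U (H.y v) = H.x v := h1
      replace h3 : (B G hG).U (H.y v) = H.x v := h3
      rw [h1] at h2
      rw [h3] at h4
      obtain ⟨s, hs', hs⟩ := exists_between (lt_min h2 h4)
      obtain ⟨hs1, hs2⟩ := lt_min_iff.1 hs
      exact (B F hF).eq_of_between (B G hG) (z := (s, H.y v)) ⟨h1.trans_lt hs', hs1⟩
        ⟨h3.trans_lt hs', hs2⟩

theorem isNetwork {Fs : List (Set (ℝ × ℝ))} (hF : ∀ F ∈ Fs, H.IsFace F ∧ ¬ H.LeftMarked M F)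
    (K : H.diagram.ChainFamily H.rank Fs) :
    K.IsNetwork (H.network M) NetVertex.inner (Equiv.refl (HasseEdge P)) := by
  have habove : ∀ b (e e' : HasseEdge P), (H.network M).above b e e' ↔ e'.top ≤ e.bot :=
    fun b e e' => by cases b <;> rfl
  refine ⟨fun F hFs => ⟨fun b e => ?_, fun b e e' he he' => ?_⟩, fun F _ => rfl, fun b e => ?_⟩
  · cases b
    · exact head_eq_inner_iff (hF F hFs).2
    · exact tail_eq_inner_iff (hF F hFs).2
  · refine (habove b e e').trans ?_
    have hp := ((K.chains F hFs).isSide_chain b).path.pairwise (k := OrderDual.toDual)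
      fun (e : HasseEdge P) _ => e.2.lt
    refine ⟨fun h => ?_, fun h => hp.of_pos_lt he he' h⟩
    by_contra h1
    rcases (not_lt.1 h1).eq_or_lt with h2 | h2
    · have h3 : e' = e := List.eq_of_pos_eq he' h2
      rw [h3] at h
      exact lt_irrefl _ ((show e.bot < e.top from e.2.lt).trans_le h)
    · have h3 : e.top ≤ e'.bot := hp.of_pos_lt he' he h2
      exact absurd (e.2.lt.trans_le (h3.trans (e'.2.lt.le.trans h))) (lt_irrefl _)
  · exact fun h => lt_irrefl _ ((CovBy.lt e.2).trans_le ((habove b e e).1 h))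

end BoundedEmbedding

/-! ### The theorem -/

theorem mainTheorem7 {P : Type u} [PartialOrder P] [Finite P] [Nonempty P]
    (M : MarkedPoset P) (H : BoundedEmbedding P) (hH : H.IsStronglyPlanar M)
    (Fs : List (Set (ℝ × ℝ))) (hFs : Fs.Nodup)
    (hF : ∀ F ∈ Fs, H.IsFace F ∧ ¬ H.LeftMarked M F) :
    BijOn M.Gam (M.orderPolytope (· < ·)) (H.network M).flowPolytope ∧
    ((∀ a, ∃ n : ℤ, M.mark a = n) →
      IsIntegralEquivalence M.Gam (M.orderPolytope (· < ·)) (H.network M).flowPolytope) ∧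
    (∃ γ : H.OrderLeaf Fs ≃ H.FlowLeaf M Fs,
      ∀ l, M.Gam '' H.orderRegion M Fs l = H.flowRegion M Fs (γ l)) ∧
    BijOn (fun R => M.Gam '' R) (range (H.orderRegion M Fs)) (range (H.flowRegion M Fs)) := by
  have himage := BoundedEmbedding.image_Gam_eq hH
  have himage' : M.Gam '' M.orderPolytope (· < ·) = (H.network M).flowPolytope := by
    rw [← BoundedEmbedding.edgePolytope_hasse, himage]
  have hγ : ∃ γ : H.OrderLeaf Fs ≃ H.FlowLeaf M Fs,
      ∀ l, M.Gam '' H.orderRegion M Fs l = H.flowRegion M Fs (γ l) := by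
    obtain ⟨K⟩ := BoundedEmbedding.exists_chainFamily hF
    obtain ⟨γ, hγ⟩ := (BoundedEmbedding.isNetwork hF K).exists_equiv hFs himage
    refine ⟨γ, fun l => ?_⟩
    obtain ⟨h1, h2, h3, h4⟩ := hγ l
    -- The order polytope compares elements of `P` only, the edges also `0̂` and `1̂`. The latter
    -- inequalities are automatic, as the resulting order refines that of `P`.
    have hregion := MarkedPoset.edgePolytope_eq_orderPolytope (M := M)
      (top := (Diagram.result Fs H.diagram l).top) (bot := (Diagram.result Fs H.diagram l).bot)
      (fun e => ⟨?_, ?_⟩) fun p q hpq => h2 _ _ (BoundedEmbedding.transGen_covBy_iff.2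
        (BoundedEmbedding.toHat_lt_toHat.2 hpq))
    · rw [hregion] at h1
      exact h1
    · obtain ⟨e', he'⟩ := h3 e
      rw [he']
      exact (BoundedEmbedding.hasse_ne e').1
    · obtain ⟨e', he'⟩ := h4 e
      rw [he']
      exact (BoundedEmbedding.hasse_ne e').2
  refine ⟨himage' ▸ MarkedPoset.Gam_injective.injOn.bijOn_image,
    fun hM => MarkedPoset.isIntegralEquivalence_Gam hM himage', hγ, ?_⟩
  obtain ⟨γ, hγ⟩ := hγ
  have hrange : range (H.flowRegion M Fs) =
      (fun R => M.Gam '' R) '' range (H.orderRegion M Fs) := by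
    rw [← range_comp, ← γ.surjective.range_comp]
    exact congrArg range (funext fun l => (hγ l).symm)
  rw [hrange]
  exact (MarkedPoset.Gam_injective.image_injective).injOn.bijOn_image
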